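/- Let $k$ be a field of characteristic $\neq 2$. All algebras, coalgebras and tensor products are over $k$, and isomorphism means isomorphism of Hopf algebras. Sweedler's Hopf algebra $H_4$ is generated as an algebra by $g,x$ with relations $g^2=1$, $x^2=0$, $xg=-gx$, with $\Delta(g)=g\otimes g$, $\Delta(x)=x\otimes 1+g\otimes x$, $\varepsilon(g)=1$, $\varepsilon(x)=0$, $S(g)=g$, $S(x)=-gx$. For $\lambda\in k$ let $\mathcal H_{16,\lambda}$ be the Hopf algebra generated as an algebra by $g,x,G,X$ with relations $$g^2=G^2=1,\quad x^2=X^2=0,\quad gx=-xg,\quad GX=-XG,\quad gG=Gg,\quad gX=-Xg,\quad xG=-Gx,\quad xX+Xx=\lambda(1-Gg),$$ with $\Delta(g)=g\otimes g$, $\Delta(x)=x\otimes 1+g\otimes x$, $\Delta(G)=G\otimes G$, $\Delta(X)=X\otimes 1+G\otimes X$, $\varepsilon(g)=\varepsilon(G)=1$, $\varepsilon(x)=\varepsilon(X)=0$, and $S(g)=g$, $S(x)=-gx$, $S(G)=G$, $S(X)=-GX$. A Hopf algebra $E$ *factorizes through* Hopf algebras $A$ and $H$ if there are injective Hopf algebra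 maps $i:A\to E$ and $j:H\to E$ such that the map $A\otimes H\to E$, $a\otimes h\mapsto i(a)j(h)$, is bijective. A Hopf algebra is *pointed* if all its simple subcoalgebras are one-dimensional. A finite-dimensional Hopf algebra is *unimodular* if its space of left integrals $\{t: ht=\varepsilon(h)t\ \forall h\}$ equals its space of right integrals $\{t: th=\varepsilon(h)t\ \forall h\}$. The Drinfel'd double $D(H)$ of a finite-dimensional Hopf algebra $H$ is the coalgebra $(H^*)^{\rm cop}\otimes H$ with unit $\varepsilon\otimes 1$ and multiplication $$(p\otimes a)(q\otimes b)=\sum p\,q\big(S^{-1}(a_{(3)})\,?\,a_{(1)}\big)\otimes a_{(2)}b .$$ Theorem. 1. A Hopf algebra $E$ factorizes through $H_4$ and $H_4$ if and only if $E\cong H_4\otimes H_4$ or $E\cong\mathcal H_{16,\lambda}$ for some $\lambda\in k$. 2. For every $\lambda\in k$, $\mathcal H_{16,\lambda}$ is pointed, unimodular, non-semisimple (that is, not semisimple as a ring), and of dimension $16$. 3. Up to isomorphism there are exactly three Hopf algebras that factorize through $H_4$ and $H_4$, namely $H_4\otimes H_4$, $\mathcal H_{16,0}$ and $\mathcal H_{16,1}$: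 a Hopf algebra $E$ factorizes through $H_4$ and $H_4$ if and only if it is isomorphic to one of these three, and no two of these three are isomorphic. Moreover $\mathcal H_{16,1}\cong D(H_4)$. -/

import Mathlib

open scoped TensorProduct

set_option linter.unusedSimpArgs false
set_option linter.unusedSectionVars false
set_option linter.unusedVariables false

universe u v w

noncomputable section

section shortcuts

variable {k : Type u} [Field k] {M : Type v} {N : Type w} [AddCommMonoid M] [Module k M]
  [AddCommMonoid N] [Module k N]

/-! Shortcuts for the instance search in the proofs below. -/

theorem linearMap_zeroHomClass : ZeroHomClass (M →ₗ[k] N) M N := inferInstance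
theorem linearMap_addHomClass : AddHomClass (M →ₗ[k] N) M N := inferInstance
theorem linearEquiv_zeroHomClass : ZeroHomClass (M ≃ₗ[k] N) M N := inferInstance
theorem linearEquiv_addHomClass : AddHomClass (M ≃ₗ[k] N) M N := inferInstance

end shortcuts

attribute [local instance] linearMap_zeroHomClass linearMap_addHomClass linearEquiv_zeroHomClass
  linearEquiv_addHomClass

/-! ### A Hopf algebra structure from a candidate antipode checked on algebra generators -/

/-- A bialgebra `A` with an algebra anti-endomorphism `S` satisfying the two antipode identities on a
generating set is a Hopf algebra with antipode `S`. -/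
abbrev HopfAlgebra.ofGenerators {k : Type u} {A : Type v} [CommRing k] [Ring A] [Bialgebra k A]
    (S : A →ₐ[k] Aᵐᵒᵖ) (s : Set A) (hs : Algebra.adjoin k s = ⊤)
    (h₁ : ∀ a ∈ s, LinearMap.mul' k A
      ((((MulOpposite.opLinearEquiv k).symm.toLinearMap ∘ₗ S.toLinearMap).rTensor A)
        (Coalgebra.comul (R := k) a)) = algebraMap k A (Coalgebra.counit a))
    (h₂ : ∀ a ∈ s, LinearMap.mul' k A
      ((((MulOpposite.opLinearEquiv k).symm.toLinearMap ∘ₗ S.toLinearMap).lTensor A)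
        (Coalgebra.comul (R := k) a)) = algebraMap k A (Coalgebra.counit a)) :
    HopfAlgebra k A where
  antipode := (MulOpposite.opLinearEquiv k).symm.toLinearMap ∘ₗ S.toLinearMap
  mul_antipode_rTensor_comul := by
    ext a
    have ha : a ∈ Algebra.adjoin k s := by rw [hs]; trivial
    simp only [LinearMap.comp_apply, Algebra.linearMap_apply]
    induction ha using Algebra.adjoin_induction with
    | mem a ha => exact h₁ a ha
    | algebraMap r =>
      simp [Algebra.TensorProduct.algebraMap_apply]
    | add a b _ _ ha hb => simp only [map_add, ha, hb]
    | mul a b _ _ ha hb =>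
      have key : ∀ t u : A ⊗[k] A, ∀ c : k, LinearMap.mul' k A
          ((((MulOpposite.opLinearEquiv k).symm.toLinearMap ∘ₗ S.toLinearMap).rTensor A) t) =
            algebraMap k A c →
          LinearMap.mul' k A
          ((((MulOpposite.opLinearEquiv k).symm.toLinearMap ∘ₗ S.toLinearMap).rTensor A) (t * u)) =
          algebraMap k A c * LinearMap.mul' k A
          ((((MulOpposite.opLinearEquiv k).symm.toLinearMap ∘ₗ S.toLinearMap).rTensor A) u) := by
        intro t u c ht
        induction u using TensorProduct.induction_on with
        | zero => simp
        | add u v hu hv => simp only [mul_add, map_add, hu, hv]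
        | tmul x y =>
          have : ∀ t : A ⊗[k] A, LinearMap.mul' k A
            ((((MulOpposite.opLinearEquiv k).symm.toLinearMap ∘ₗ S.toLinearMap).rTensor A)
              (t * (x ⊗ₜ y))) = (S x).unop * LinearMap.mul' k A
            ((((MulOpposite.opLinearEquiv k).symm.toLinearMap ∘ₗ S.toLinearMap).rTensor A) t)
              * y := by
            intro t
            induction t using TensorProduct.induction_on with
            | zero => simp
            | add t t' h h' => simp only [add_mul, mul_add, map_add, h, h']
            | tmul a b => simp [mul_assoc]
          rw [this, ht, ← Algebra.commutes]
          simp [mul_assoc]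
      rw [Bialgebra.comul_mul, key _ _ _ ha, hb, Bialgebra.counit_mul, map_mul]
  mul_antipode_lTensor_comul := by
    ext a
    have ha : a ∈ Algebra.adjoin k s := by rw [hs]; trivial
    simp only [LinearMap.comp_apply, Algebra.linearMap_apply]
    induction ha using Algebra.adjoin_induction with
    | mem a ha => exact h₂ a ha
    | algebraMap r =>
      simp [Algebra.TensorProduct.algebraMap_apply]
    | add a b _ _ ha hb => simp only [map_add, ha, hb]
    | mul a b _ _ ha hb =>
      have key : ∀ t u : A ⊗[k] A, ∀ c : k, LinearMap.mul' k A
          ((((MulOpposite.opLinearEquiv k).symm.toLinearMap ∘ₗ S.toLinearMap).lTensor A) u) =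
            algebraMap k A c →
          LinearMap.mul' k A
          ((((MulOpposite.opLinearEquiv k).symm.toLinearMap ∘ₗ S.toLinearMap).lTensor A) (t * u)) =
          LinearMap.mul' k A
          ((((MulOpposite.opLinearEquiv k).symm.toLinearMap ∘ₗ S.toLinearMap).lTensor A) t) *
          algebraMap k A c := by
        intro t u c hu
        induction t using TensorProduct.induction_on with
        | zero => simp
        | add t t' h h' => simp only [add_mul, map_add, h, h']
        | tmul x y =>
          have : ∀ u : A ⊗[k] A, LinearMap.mul' k A
            ((((MulOpposite.opLinearEquiv k).symm.toLinearMap ∘ₗ S.toLinearMap).lTensor A)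
              ((x ⊗ₜ y) * u)) = x * LinearMap.mul' k A
            ((((MulOpposite.opLinearEquiv k).symm.toLinearMap ∘ₗ S.toLinearMap).lTensor A) u)
              * (S y).unop := by
            intro u
            induction u using TensorProduct.induction_on with
            | zero => simp
            | add t t' h h' => simp only [add_mul, mul_add, map_add, h, h']
            | tmul a b => simp [mul_assoc]
          rw [this, hu, mul_assoc, Algebra.commutes]
          simp [mul_assoc]
      rw [Bialgebra.comul_mul, key _ _ _ hb, ha, Bialgebra.counit_mul, map_mul]

/-! ### Sweedler's Hopf algebra -/

/-- The generators `g`, `x` of Sweedler's Hopf algebra. -/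
inductive H4.Gen
  | g
  | x

/-- The relations `g² = 1`, `x² = 0`, `x g = - g x`. -/
inductive H4.Rel (k : Type u) [Field k] : FreeAlgebra k H4.Gen → FreeAlgebra k H4.Gen → Prop
  | gg : Rel k (FreeAlgebra.ι k Gen.g * FreeAlgebra.ι k Gen.g) 1
  | xx : Rel k (FreeAlgebra.ι k Gen.x * FreeAlgebra.ι k Gen.x) 0
  | xg : Rel k (FreeAlgebra.ι k Gen.x * FreeAlgebra.ι k Gen.g)
      (-(FreeAlgebra.ι k Gen.g * FreeAlgebra.ι k Gen.x))

/-- Sweedler's Hopf algebra, as the algebra with generators `g`, `x` and the relations `H4.Rel`. -/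
def H4 (k : Type u) [Field k] : Type u := RingQuot (H4.Rel k)

namespace H4

variable (k : Type u) [Field k]

instance instRing : Ring (H4 k) := inferInstanceAs (Ring (RingQuot (H4.Rel k)))
instance instAlgebra : Algebra k (H4 k) := inferInstanceAs (Algebra k (RingQuot (H4.Rel k)))

/-- The images of the generators in `H4 k`. -/
def of (i : Gen) : H4 k := RingQuot.mkAlgHom k (H4.Rel k) (FreeAlgebra.ι k i)

/-- The group-like generator `g`. -/
def g : H4 k := of k Gen.g

/-- The skew-primitive generator `x`. -/
def x : H4 k := of k Gen.x

lemma g_mul_g : g k * g k = 1 := by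
  simpa [g, of] using! RingQuot.mkAlgHom_rel k (Rel.gg (k := k))

lemma x_mul_x : x k * x k = 0 := by
  simpa [x, of] using! RingQuot.mkAlgHom_rel k (Rel.xx (k := k))

lemma x_mul_g : x k * g k = -(g k * x k) := by
  simpa [x, g, of] using! RingQuot.mkAlgHom_rel k (Rel.xg (k := k))

variable {k}

/-- The universal property of the presentation. -/
def lift {A : Type v} [Ring A] [Algebra k A] (a b : A) (haa : a * a = 1) (hbb : b * b = 0)
    (hba : b * a = -(a * b)) : H4 k →ₐ[k] A :=
  RingQuot.liftAlgHom k ⟨FreeAlgebra.lift k (fun i => match i with | Gen.g => a | Gen.x => b), by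
    intro p q h
    cases h <;> simp [haa, hbb, hba]⟩

section lift
variable {A : Type v} [Ring A] [Algebra k A] (a b : A) (haa : a * a = 1) (hbb : b * b = 0)
    (hba : b * a = -(a * b))

@[simp] lemma lift_g : lift (k := k) a b haa hbb hba (g k) = a := by
  refine (RingQuot.liftAlgHom_mkAlgHom_apply k _ _ _).trans ?_
  simp

@[simp] lemma lift_x : lift (k := k) a b haa hbb hba (x k) = b := by
  refine (RingQuot.liftAlgHom_mkAlgHom_apply k _ _ _).trans ?_
  simp

end lift

lemma algHom_ext {A : Type v} [Semiring A] [Algebra k A] {f f' : H4 k →ₐ[k] A}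
    (hg : f (g k) = f' (g k)) (hx : f (x k) = f' (x k)) : f = f' := by
  refine RingQuot.ringQuot_ext' k _ _ ?_
  refine FreeAlgebra.hom_ext ?_
  funext i
  cases i
  · exact hg
  · exact hx

variable (k)

lemma adjoin_eq_top : Algebra.adjoin k ({g k, x k} : Set (H4 k)) = ⊤ := by
  set B := Algebra.adjoin k ({g k, x k} : Set (H4 k)) with hB
  have hg : g k ∈ B := Algebra.subset_adjoin (by simp)
  have hx : x k ∈ B := Algebra.subset_adjoin (by simp)
  let φ : H4 k →ₐ[k] B := lift ⟨g k, hg⟩ ⟨x k, hx⟩ (Subtype.ext (g_mul_g k))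
    (Subtype.ext (x_mul_x k)) (Subtype.ext (x_mul_g k))
  have h : B.val.comp φ = AlgHom.id k _ := algHom_ext (by simp [φ]) (by simp [φ])
  refine eq_top_iff.2 fun a _ => ?_
  have := DFunLike.congr_fun h a
  simp only [AlgHom.comp_apply, AlgHom.id_apply] at this
  rw [← this]
  exact (φ a).2

/-- `Δ(g) = g ⊗ g`, `Δ(x) = x ⊗ 1 + g ⊗ x`. -/
def comulHom : H4 k →ₐ[k] H4 k ⊗[k] H4 k :=
  lift (g k ⊗ₜ g k) (x k ⊗ₜ 1 + g k ⊗ₜ x k)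
    (by simp [g_mul_g, Algebra.TensorProduct.one_def])
    (by simp [mul_add, add_mul, g_mul_g, x_mul_x, x_mul_g, TensorProduct.neg_tmul])
    (by
      simp [mul_add, add_mul, x_mul_g, TensorProduct.neg_tmul, TensorProduct.tmul_neg, add_comm])

/-- `ε(g) = 1`, `ε(x) = 0`. -/
def counitHom : H4 k →ₐ[k] k := lift 1 0 (by simp) (by simp) (by simp)

instance instBialgebra : Bialgebra k (H4 k) :=
  Bialgebra.ofAlgHom (comulHom k) (counitHom k)
    (algHom_ext (by simp [comulHom]) (by
      simp [comulHom, TensorProduct.add_tmul, TensorProduct.tmul_add, add_assoc,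
        Algebra.TensorProduct.one_def]))
    (algHom_ext (by simp [comulHom, counitHom]) (by simp [comulHom, counitHom]))
    (algHom_ext (by simp [comulHom, counitHom]) (by simp [comulHom, counitHom]))

@[simp] lemma comul_g : Coalgebra.comul (R := k) (g k) = g k ⊗ₜ g k := by
  change comulHom k _ = _
  simp [comulHom]

@[simp] lemma comul_x : Coalgebra.comul (R := k) (x k) = x k ⊗ₜ 1 + g k ⊗ₜ x k := by
  change comulHom k _ = _
  simp [comulHom]

@[simp] lemma counit_g : Coalgebra.counit (R := k) (g k) = 1 := by
  change counitHom k _ = _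
  simp [counitHom]

@[simp] lemma counit_x : Coalgebra.counit (R := k) (x k) = 0 := by
  change counitHom k _ = _
  simp [counitHom]

/-- `S(g) = g`, `S(x) = - g x`. -/
def antipodeHom : H4 k →ₐ[k] (H4 k)ᵐᵒᵖ :=
  lift (MulOpposite.op (g k)) (MulOpposite.op (-(g k * x k)))
    (by simp [← MulOpposite.op_mul, g_mul_g])
    (by
      rw [← MulOpposite.op_mul]
      have : g k * x k * (g k * x k) = -((g k * g k) * (x k * x k)) := by
        rw [mul_assoc, ← mul_assoc (x k), x_mul_g]; simp [mul_assoc]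
      simp [this, x_mul_x])
    (by
      rw [← MulOpposite.op_mul, ← MulOpposite.op_mul, ← MulOpposite.op_neg]
      congr 1
      simp [mul_assoc, x_mul_g])

instance instHopfAlgebra : HopfAlgebra k (H4 k) :=
  HopfAlgebra.ofGenerators (antipodeHom k) {g k, x k} (adjoin_eq_top k)
    (by
      rintro a (rfl | rfl)
      · simp [antipodeHom, g_mul_g]
      · simp [antipodeHom])
    (by
      rintro a (rfl | rfl)
      · simp [antipodeHom, g_mul_g]
      · simp [antipodeHom, ← mul_assoc, g_mul_g])

@[simp] lemma antipode_g : HopfAlgebra.antipode k (g k) = g k := by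
  change (antipodeHom k _).unop = _
  simp [antipodeHom]

@[simp] lemma antipode_x : HopfAlgebra.antipode k (x k) = -(g k * x k) := by
  change (antipodeHom k _).unop = _
  simp [antipodeHom]

instance instFinite : Module.Finite k (H4 k) := by
  let M : Submodule k (H4 k) := Submodule.span k {1, g k, x k, g k * x k}
  have h1 : (1 : H4 k) ∈ M := Submodule.subset_span (by simp)
  have hg : g k ∈ M := Submodule.subset_span (by simp)
  have hx : x k ∈ M := Submodule.subset_span (by simp)
  have hgx : g k * x k ∈ M := Submodule.subset_span (by simp)
  have hgM : ∀ a ∈ M, g k * a ∈ M := by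
    intro a ha
    induction ha using Submodule.span_induction with
    | mem a ha =>
      rcases ha with rfl | rfl | rfl | rfl
      · simpa using hg
      · simpa [g_mul_g] using h1
      · exact hgx
      · simpa [← mul_assoc, g_mul_g] using hx
    | zero => simp
    | add a b _ _ ha hb => simpa [mul_add] using add_mem ha hb
    | smul c a _ ha => simpa using M.smul_mem c ha
  have hxM : ∀ a ∈ M, x k * a ∈ M := by
    intro a ha
    induction ha using Submodule.span_induction with
    | mem a ha =>
      rcases ha with rfl | rfl | rfl | rfl
      · simpa using hx
      · simpa [x_mul_g] using hgx
      · simp [x_mul_x]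
      · simp [← mul_assoc, x_mul_g]
        simp [mul_assoc, x_mul_x]
    | zero => simp
    | add a b _ _ ha hb => simpa [mul_add] using add_mem ha hb
    | smul c a _ ha => simpa using M.smul_mem c ha
  have key : ∀ a : H4 k, ∀ m ∈ M, a * m ∈ M := by
    intro a
    have ha : a ∈ Algebra.adjoin k ({g k, x k} : Set (H4 k)) := by rw [adjoin_eq_top]; trivial
    induction ha using Algebra.adjoin_induction with
    | mem a ha =>
      rcases ha with rfl | rfl
      · exact hgM
      · exact hxM
    | algebraMap r => intro m hm; rw [← Algebra.smul_def]; exact M.smul_mem r hm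
    | add a b _ _ ha hb => intro m hm; rw [add_mul]; exact add_mem (ha m hm) (hb m hm)
    | mul a b _ _ ha hb => intro m hm; rw [mul_assoc]; exact ha _ (hb m hm)
  have hM : M = ⊤ := eq_top_iff.2 fun a _ => by simpa using key a 1 h1
  exact ⟨hM ▸ Submodule.fg_span (by simp)⟩

end H4

/-! ### The Hopf algebras of dimension sixteen -/

/-- The generators `g`, `x`, `G`, `X`. -/
inductive H16.Gen
  | g
  | x
  | G
  | X

/-- The relations `g² = G² = 1`, `x² = X² = 0`, `g x = - x g`, `G X = - X G`, `g G = G g`,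
`g X = - X g`, `x G = - G x`, `x X + X x = l (1 - G g)`. -/
inductive H16.Rel (k : Type u) [Field k] (l : k) :
    FreeAlgebra k H16.Gen → FreeAlgebra k H16.Gen → Prop
  | gg : Rel k l (FreeAlgebra.ι k Gen.g * FreeAlgebra.ι k Gen.g) 1
  | GG : Rel k l (FreeAlgebra.ι k Gen.G * FreeAlgebra.ι k Gen.G) 1
  | xx : Rel k l (FreeAlgebra.ι k Gen.x * FreeAlgebra.ι k Gen.x) 0
  | XX : Rel k l (FreeAlgebra.ι k Gen.X * FreeAlgebra.ι k Gen.X) 0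
  | gx : Rel k l (FreeAlgebra.ι k Gen.g * FreeAlgebra.ι k Gen.x)
      (-(FreeAlgebra.ι k Gen.x * FreeAlgebra.ι k Gen.g))
  | GX : Rel k l (FreeAlgebra.ι k Gen.G * FreeAlgebra.ι k Gen.X)
      (-(FreeAlgebra.ι k Gen.X * FreeAlgebra.ι k Gen.G))
  | gG : Rel k l (FreeAlgebra.ι k Gen.g * FreeAlgebra.ι k Gen.G)
      (FreeAlgebra.ι k Gen.G * FreeAlgebra.ι k Gen.g)
  | gX : Rel k l (FreeAlgebra.ι k Gen.g * FreeAlgebra.ι k Gen.X)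
      (-(FreeAlgebra.ι k Gen.X * FreeAlgebra.ι k Gen.g))
  | xG : Rel k l (FreeAlgebra.ι k Gen.x * FreeAlgebra.ι k Gen.G)
      (-(FreeAlgebra.ι k Gen.G * FreeAlgebra.ι k Gen.x))
  | xX : Rel k l (FreeAlgebra.ι k Gen.x * FreeAlgebra.ι k Gen.X +
      FreeAlgebra.ι k Gen.X * FreeAlgebra.ι k Gen.x)
      (l • (1 - FreeAlgebra.ι k Gen.G * FreeAlgebra.ι k Gen.g))

/-- The Hopf algebra `𝓗_{16, l}`, as the algebra presented by `H16.Gen` and `H16.Rel`. -/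
def H16 (k : Type u) [Field k] (l : k) : Type u := RingQuot (H16.Rel k l)

namespace H16

variable (k : Type u) [Field k] (l : k)

instance instRing : Ring (H16 k l) := inferInstanceAs (Ring (RingQuot (H16.Rel k l)))
instance instAlgebra : Algebra k (H16 k l) := inferInstanceAs (Algebra k (RingQuot (H16.Rel k l)))

/-- The images of the generators in `H16 k l`. -/
def of (i : Gen) : H16 k l := RingQuot.mkAlgHom k (H16.Rel k l) (FreeAlgebra.ι k i)

/-- The group-like generator `g`. -/
def g : H16 k l := of k l Gen.g

/-- The `(1, g)`-primitive generator `x`. -/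
def x : H16 k l := of k l Gen.x

/-- The group-like generator `G`. -/
def G : H16 k l := of k l Gen.G

/-- The `(1, G)`-primitive generator `X`. -/
def X : H16 k l := of k l Gen.X

lemma g_mul_g : g k l * g k l = 1 := by
  simpa [g, of] using! RingQuot.mkAlgHom_rel k (Rel.gg (k := k) (l := l))

lemma G_mul_G : G k l * G k l = 1 := by
  simpa [G, of] using! RingQuot.mkAlgHom_rel k (Rel.GG (k := k) (l := l))

lemma x_mul_x : x k l * x k l = 0 := by
  simpa [x, of] using! RingQuot.mkAlgHom_rel k (Rel.xx (k := k) (l := l))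

lemma X_mul_X : X k l * X k l = 0 := by
  simpa [X, of] using! RingQuot.mkAlgHom_rel k (Rel.XX (k := k) (l := l))

lemma g_mul_x : g k l * x k l = -(x k l * g k l) := by
  simpa [g, x, of] using! RingQuot.mkAlgHom_rel k (Rel.gx (k := k) (l := l))

lemma G_mul_X : G k l * X k l = -(X k l * G k l) := by
  simpa [G, X, of] using! RingQuot.mkAlgHom_rel k (Rel.GX (k := k) (l := l))

lemma g_mul_G : g k l * G k l = G k l * g k l := by
  simpa [g, G, of] using! RingQuot.mkAlgHom_rel k (Rel.gG (k := k) (l := l))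

lemma g_mul_X : g k l * X k l = -(X k l * g k l) := by
  simpa [g, X, of] using! RingQuot.mkAlgHom_rel k (Rel.gX (k := k) (l := l))

lemma x_mul_G : x k l * G k l = -(G k l * x k l) := by
  simpa [x, G, of] using! RingQuot.mkAlgHom_rel k (Rel.xG (k := k) (l := l))

lemma x_mul_X_add : x k l * X k l + X k l * x k l = l • (1 - G k l * g k l) := by
  have := RingQuot.mkAlgHom_rel k (Rel.xX (k := k) (l := l))
  simp only [map_add, map_mul, map_smul, map_sub, map_one] at this
  exact this

variable {k l}

/-- The universal property of the presentation. -/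
def lift {A : Type v} [Ring A] [Algebra k A] (a b c d : A) (haa : a * a = 1) (hcc : c * c = 1)
    (hbb : b * b = 0) (hdd : d * d = 0) (hab : a * b = -(b * a)) (hcd : c * d = -(d * c))
    (hac : a * c = c * a) (had : a * d = -(d * a)) (hbc : b * c = -(c * b))
    (hbd : b * d + d * b = l • (1 - c * a)) : H16 k l →ₐ[k] A :=
  RingQuot.liftAlgHom k ⟨FreeAlgebra.lift k
    (fun i => match i with | Gen.g => a | Gen.x => b | Gen.G => c | Gen.X => d), by
    intro p q h
    cases h <;> simp only [map_mul, map_add, map_neg, map_smul, map_sub, map_one, map_zero,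
      FreeAlgebra.lift_ι_apply] <;> assumption⟩

section lift
variable {A : Type v} [Ring A] [Algebra k A] (a b c d : A) (haa : a * a = 1) (hcc : c * c = 1)
    (hbb : b * b = 0) (hdd : d * d = 0) (hab : a * b = -(b * a)) (hcd : c * d = -(d * c))
    (hac : a * c = c * a) (had : a * d = -(d * a)) (hbc : b * c = -(c * b))
    (hbd : b * d + d * b = l • (1 - c * a))

@[simp] lemma lift_g :
    lift (l := l) a b c d haa hcc hbb hdd hab hcd hac had hbc hbd (g k l) = a := by
  refine (RingQuot.liftAlgHom_mkAlgHom_apply k _ _ _).trans ?_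
  simp

@[simp] lemma lift_x :
    lift (l := l) a b c d haa hcc hbb hdd hab hcd hac had hbc hbd (x k l) = b := by
  refine (RingQuot.liftAlgHom_mkAlgHom_apply k _ _ _).trans ?_
  simp

@[simp] lemma lift_G :
    lift (l := l) a b c d haa hcc hbb hdd hab hcd hac had hbc hbd (G k l) = c := by
  refine (RingQuot.liftAlgHom_mkAlgHom_apply k _ _ _).trans ?_
  simp

@[simp] lemma lift_X :
    lift (l := l) a b c d haa hcc hbb hdd hab hcd hac had hbc hbd (X k l) = d := by
  refine (RingQuot.liftAlgHom_mkAlgHom_apply k _ _ _).trans ?_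
  simp

end lift

lemma algHom_ext {A : Type v} [Semiring A] [Algebra k A] {f f' : H16 k l →ₐ[k] A}
    (hg : f (g k l) = f' (g k l)) (hx : f (x k l) = f' (x k l))
    (hG : f (G k l) = f' (G k l)) (hX : f (X k l) = f' (X k l)) : f = f' := by
  refine RingQuot.ringQuot_ext' k _ _ ?_
  refine FreeAlgebra.hom_ext ?_
  funext i
  cases i
  · exact hg
  · exact hx
  · exact hG
  · exact hX

variable (k l)

lemma adjoin_eq_top :
    Algebra.adjoin k ({g k l, x k l, G k l, X k l} : Set (H16 k l)) = ⊤ := by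
  set B := Algebra.adjoin k ({g k l, x k l, G k l, X k l} : Set (H16 k l)) with hB
  have hg : g k l ∈ B := Algebra.subset_adjoin (by simp)
  have hx : x k l ∈ B := Algebra.subset_adjoin (by simp)
  have hG : G k l ∈ B := Algebra.subset_adjoin (by simp)
  have hX : X k l ∈ B := Algebra.subset_adjoin (by simp)
  let φ : H16 k l →ₐ[k] B := lift ⟨g k l, hg⟩ ⟨x k l, hx⟩ ⟨G k l, hG⟩ ⟨X k l, hX⟩
    (Subtype.ext (g_mul_g k l)) (Subtype.ext (G_mul_G k l)) (Subtype.ext (x_mul_x k l))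
    (Subtype.ext (X_mul_X k l)) (Subtype.ext (g_mul_x k l)) (Subtype.ext (G_mul_X k l))
    (Subtype.ext (g_mul_G k l)) (Subtype.ext (g_mul_X k l)) (Subtype.ext (x_mul_G k l))
    (Subtype.ext (x_mul_X_add k l))
  have h : B.val.comp φ = AlgHom.id k _ :=
    algHom_ext (by simp [φ]) (by simp [φ]) (by simp [φ]) (by simp [φ])
  refine eq_top_iff.2 fun a _ => ?_
  have := DFunLike.congr_fun h a
  simp only [AlgHom.comp_apply, AlgHom.id_apply] at this
  rw [← this]
  exact (φ a).2

/-- `Δ(g) = g ⊗ g`, `Δ(x) = x ⊗ 1 + g ⊗ x`, `Δ(G) = G ⊗ G`, `Δ(X) = X ⊗ 1 + G ⊗ X`. -/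
def comulHom : H16 k l →ₐ[k] H16 k l ⊗[k] H16 k l :=
  lift (g k l ⊗ₜ g k l) (x k l ⊗ₜ 1 + g k l ⊗ₜ x k l) (G k l ⊗ₜ G k l)
    (X k l ⊗ₜ 1 + G k l ⊗ₜ X k l)
    (by simp [g_mul_g, Algebra.TensorProduct.one_def])
    (by simp [G_mul_G, Algebra.TensorProduct.one_def])
    (by simp [mul_add, add_mul, g_mul_g, x_mul_x, g_mul_x, TensorProduct.neg_tmul])
    (by simp [mul_add, add_mul, G_mul_G, X_mul_X, G_mul_X, TensorProduct.neg_tmul])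
    (by
      simp only [mul_add, add_mul, Algebra.TensorProduct.tmul_mul_tmul, one_mul, mul_one, g_mul_x,
        TensorProduct.neg_tmul, TensorProduct.tmul_neg]
      abel)
    (by
      simp only [mul_add, add_mul, Algebra.TensorProduct.tmul_mul_tmul, one_mul, mul_one, G_mul_X,
        TensorProduct.neg_tmul, TensorProduct.tmul_neg]
      abel)
    (by simp [g_mul_G])
    (by
      simp only [mul_add, add_mul, Algebra.TensorProduct.tmul_mul_tmul, one_mul, mul_one, g_mul_X, g_mul_G,
        TensorProduct.neg_tmul, TensorProduct.tmul_neg]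
      abel)
    (by
      simp only [mul_add, add_mul, Algebra.TensorProduct.tmul_mul_tmul, one_mul, mul_one, x_mul_G, g_mul_G,
        TensorProduct.neg_tmul, TensorProduct.tmul_neg]
      abel)
    (by
      have h1 : x k l * X k l = l • (1 - G k l * g k l) - X k l * x k l :=
        eq_sub_of_add_eq (x_mul_X_add k l)
      simp only [mul_add, add_mul, Algebra.TensorProduct.tmul_mul_tmul, one_mul, mul_one, h1,
        x_mul_G, g_mul_X, g_mul_G, TensorProduct.neg_tmul,
        TensorProduct.sub_tmul, TensorProduct.tmul_sub, TensorProduct.smul_tmul', smul_sub,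
        TensorProduct.tmul_smul, Algebra.TensorProduct.one_def]
      abel)

lemma comulHom_g : comulHom k l (g k l) = g k l ⊗ₜ g k l := by
  refine (RingQuot.liftAlgHom_mkAlgHom_apply k _ _ _).trans ?_
  simp

lemma comulHom_x : comulHom k l (x k l) = x k l ⊗ₜ 1 + g k l ⊗ₜ x k l := by
  refine (RingQuot.liftAlgHom_mkAlgHom_apply k _ _ _).trans ?_
  simp

lemma comulHom_G : comulHom k l (G k l) = G k l ⊗ₜ G k l := by
  refine (RingQuot.liftAlgHom_mkAlgHom_apply k _ _ _).trans ?_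
  simp

lemma comulHom_X : comulHom k l (X k l) = X k l ⊗ₜ 1 + G k l ⊗ₜ X k l := by
  refine (RingQuot.liftAlgHom_mkAlgHom_apply k _ _ _).trans ?_
  simp

/-- `ε(g) = ε(G) = 1`, `ε(x) = ε(X) = 0`. -/
def counitHom : H16 k l →ₐ[k] k :=
  lift 1 0 1 0 (by simp) (by simp) (by simp) (by simp) (by simp) (by simp) (by simp) (by simp)
    (by simp) (by simp)

instance instBialgebra : Bialgebra k (H16 k l) :=
  Bialgebra.ofAlgHom (comulHom k l) (counitHom k l)
    (algHom_ext
      (by simp [comulHom_g, comulHom_x, comulHom_G, comulHom_X])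
      (by simp [comulHom_g, comulHom_x, comulHom_G, comulHom_X, TensorProduct.add_tmul, TensorProduct.tmul_add, add_assoc,
        Algebra.TensorProduct.one_def])
      (by simp [comulHom_g, comulHom_x, comulHom_G, comulHom_X])
      (by simp [comulHom_g, comulHom_x, comulHom_G, comulHom_X, TensorProduct.add_tmul, TensorProduct.tmul_add, add_assoc,
        Algebra.TensorProduct.one_def]))
    (algHom_ext (by simp [comulHom_g, comulHom_x, comulHom_G, comulHom_X, counitHom]) (by simp [comulHom_g, comulHom_x, comulHom_G, comulHom_X, counitHom])
      (by simp [comulHom_g, comulHom_x, comulHom_G, comulHom_X, counitHom]) (by simp [comulHom_g, comulHom_x, comulHom_G, comulHom_X, counitHom]))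
    (algHom_ext (by simp [comulHom_g, comulHom_x, comulHom_G, comulHom_X, counitHom]) (by simp [comulHom_g, comulHom_x, comulHom_G, comulHom_X, counitHom])
      (by simp [comulHom_g, comulHom_x, comulHom_G, comulHom_X, counitHom]) (by simp [comulHom_g, comulHom_x, comulHom_G, comulHom_X, counitHom]))

@[simp] lemma comul_g : Coalgebra.comul (R := k) (g k l) = g k l ⊗ₜ g k l :=
  comulHom_g k l

@[simp] lemma comul_x :
    Coalgebra.comul (R := k) (x k l) = x k l ⊗ₜ 1 + g k l ⊗ₜ x k l :=
  comulHom_x k l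

@[simp] lemma comul_G : Coalgebra.comul (R := k) (G k l) = G k l ⊗ₜ G k l :=
  comulHom_G k l

@[simp] lemma comul_X :
    Coalgebra.comul (R := k) (X k l) = X k l ⊗ₜ 1 + G k l ⊗ₜ X k l :=
  comulHom_X k l

@[simp] lemma counit_g : Coalgebra.counit (R := k) (g k l) = 1 := by
  change counitHom k l _ = _
  simp [counitHom]

@[simp] lemma counit_x : Coalgebra.counit (R := k) (x k l) = 0 := by
  change counitHom k l _ = _
  simp [counitHom]

@[simp] lemma counit_G : Coalgebra.counit (R := k) (G k l) = 1 := by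
  change counitHom k l _ = _
  simp [counitHom]

@[simp] lemma counit_X : Coalgebra.counit (R := k) (X k l) = 0 := by
  change counitHom k l _ = _
  simp [counitHom]

/-- `S(g) = g`, `S(x) = - g x`, `S(G) = G`, `S(X) = - G X`. -/
def antipodeHom : H16 k l →ₐ[k] (H16 k l)ᵐᵒᵖ :=
  have hxg : x k l * g k l = -(g k l * x k l) := by rw [g_mul_x, neg_neg]
  have hXG : X k l * G k l = -(G k l * X k l) := by rw [G_mul_X, neg_neg]
  have hGg : G k l * g k l = g k l * G k l := (g_mul_G k l).symm
  have hXg : X k l * g k l = -(g k l * X k l) := by rw [g_mul_X, neg_neg]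
  have hGx : G k l * x k l = -(x k l * G k l) := by rw [x_mul_G, neg_neg]
  lift (MulOpposite.op (g k l)) (MulOpposite.op (-(g k l * x k l))) (MulOpposite.op (G k l))
    (MulOpposite.op (-(G k l * X k l)))
    (by simp [← MulOpposite.op_mul, g_mul_g])
    (by simp [← MulOpposite.op_mul, G_mul_G])
    (by
      rw [← MulOpposite.op_mul, MulOpposite.op_eq_zero_iff, neg_mul_neg, mul_assoc,
        ← mul_assoc (x k l), hxg, neg_mul, mul_assoc, x_mul_x]
      simp)
    (by
      rw [← MulOpposite.op_mul, MulOpposite.op_eq_zero_iff, neg_mul_neg, mul_assoc,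
        ← mul_assoc (X k l), hXG, neg_mul, mul_assoc, X_mul_X]
      simp)
    (by
      rw [← MulOpposite.op_mul, ← MulOpposite.op_mul, ← MulOpposite.op_neg]
      congr 1
      simp [mul_assoc, hxg])
    (by
      rw [← MulOpposite.op_mul, ← MulOpposite.op_mul, ← MulOpposite.op_neg]
      congr 1
      simp [mul_assoc, hXG])
    (by rw [← MulOpposite.op_mul, ← MulOpposite.op_mul, g_mul_G])
    (by
      rw [← MulOpposite.op_mul, ← MulOpposite.op_mul, ← MulOpposite.op_neg]
      congr 1
      rw [neg_mul, mul_neg, neg_neg, mul_assoc, hXg, mul_neg, neg_neg, ← mul_assoc, hGg,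
        mul_assoc])
    (by
      rw [← MulOpposite.op_mul, ← MulOpposite.op_mul, ← MulOpposite.op_neg]
      congr 1
      rw [mul_neg, ← mul_assoc, hGg, neg_mul, neg_neg, mul_assoc (g k l) (x k l), x_mul_G,
        mul_neg, mul_assoc])
    (by
      rw [← MulOpposite.op_mul, ← MulOpposite.op_mul, ← MulOpposite.op_mul,
        ← MulOpposite.op_add, ← MulOpposite.op_one, ← MulOpposite.op_sub, ← MulOpposite.op_smul]
      congr 1
      have e1 : G k l * X k l * (g k l * x k l) = -(G k l * g k l * (X k l * x k l)) := by
        rw [mul_assoc, ← mul_assoc (X k l), hXg]; simp [mul_assoc]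
      have e2 : g k l * x k l * (G k l * X k l) = -(G k l * g k l * (x k l * X k l)) := by
        rw [mul_assoc, ← mul_assoc (x k l), x_mul_G, hGg]; simp [mul_assoc]
      have e3 : G k l * g k l * (G k l * g k l) = 1 := by
        rw [mul_assoc, ← mul_assoc (g k l), g_mul_G, mul_assoc (G k l), g_mul_g, mul_one, G_mul_G]
      rw [neg_mul_neg, neg_mul_neg, e1, e2, ← neg_add, ← mul_add, add_comm (X k l * x k l),
        x_mul_X_add, mul_smul_comm, mul_sub, e3, mul_one, ← smul_neg, neg_sub, hGg])

instance instHopfAlgebra : HopfAlgebra k (H16 k l) :=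
  HopfAlgebra.ofGenerators (antipodeHom k l) {g k l, x k l, G k l, X k l} (adjoin_eq_top k l)
    (by
      rintro a (rfl | rfl | rfl | rfl)
      · simp [antipodeHom, g_mul_g]
      · simp [antipodeHom]
      · simp [antipodeHom, G_mul_G]
      · simp [antipodeHom])
    (by
      rintro a (rfl | rfl | rfl | rfl)
      · simp [antipodeHom, g_mul_g]
      · simp [antipodeHom, ← mul_assoc, g_mul_g]
      · simp [antipodeHom, G_mul_G]
      · simp [antipodeHom, ← mul_assoc, G_mul_G])

end H16

/-! ### The inverse of the antipode -/

section antipode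

open Coalgebra HopfAlgebra LinearMap

/-- The antipode reverses the comultiplication. -/
lemma HopfAlgebra.comul_antipode_eq (k : Type u) {H : Type v} [Field k] [Ring H] [HopfAlgebra k H]
    (a : H) : comul (R := k) (antipode k a) =
      TensorProduct.map (antipode k) (antipode k) (TensorProduct.comm k H H (comul a)) := by
  let G' : H ⊗[k] H →ₗ[k] H ⊗[k] H :=
    TensorProduct.map (antipode k) (antipode k) ∘ₗ (TensorProduct.comm k H H).toLinearMap
  let m : H ⊗[k] H →ₗ[k] H := LinearMap.mul' k H ∘ₗ (antipode k).rTensor H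
  have h1 : WithConv.toConv (comul (R := k) (A := H)) *
      WithConv.toConv (comul (R := k) (A := H) ∘ₗ antipode k) = 1 := LinearMap.comul_right_inv
  have h2 : WithConv.toConv (G' ∘ₗ comul) * WithConv.toConv (comul (R := k) (A := H)) = 1 := by
    let f : H ⊗[k] ((H ⊗[k] H) ⊗[k] H) →ₗ[k] H ⊗[k] H :=
      TensorProduct.map m m ∘ₗ (TensorProduct.leftComm k H (H ⊗[k] H) H).toLinearMap
    have e1 : LinearMap.mul' k (H ⊗[k] H) ∘ₗ TensorProduct.map G' .id =
        f ∘ₗ (TensorProduct.assoc k H H H).symm.toLinearMap.lTensor H ∘ₗ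
          (TensorProduct.assoc k H H (H ⊗[k] H)).toLinearMap := by
      ext a b c d
      simp [G', f, m]
    have e2 : (TensorProduct.assoc k H H H).symm.toLinearMap.lTensor H ∘ₗ
          (TensorProduct.assoc k H H (H ⊗[k] H)).toLinearMap ∘ₗ
            TensorProduct.map (comul (R := k) (A := H)) (comul (R := k) (A := H)) ∘ₗ comul =
        ((comul (R := k) (A := H)).rTensor H ∘ₗ comul).lTensor H ∘ₗ comul := by
      simp only [coassoc_simps]
    have e3 : f ∘ₗ ((comul (R := k) (A := H)).rTensor H ∘ₗ comul).lTensor H =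
        TensorProduct.mk k H H 1 ∘ₗ m := by
      ext a b
      have : ∀ t : H ⊗[k] H, f (a ⊗ₜ ((comul (R := k) (A := H)).rTensor H t)) =
          1 ⊗ₜ (antipode k a * TensorProduct.lid k H ((counit (R := k) (A := H)).rTensor H t)) := by
        intro t
        induction t using TensorProduct.induction_on with
        | zero => simp
        | add s t hs ht => simp only [map_add, TensorProduct.tmul_add, mul_add, hs, ht]
        | tmul b d =>
          simp [f, m, Algebra.algebraMap_eq_smul_one, TensorProduct.smul_tmul]
      simp [this, m]
    ext a
    calc _ = (LinearMap.mul' k (H ⊗[k] H) ∘ₗ TensorProduct.map G' .id)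
          ((TensorProduct.map (comul (R := k) (A := H)) (comul (R := k) (A := H)) ∘ₗ comul) a) := by
          rw [LinearMap.convMul_apply]
          simp only [LinearMap.comp_apply]
          generalize comul (R := k) a = t
          induction t using TensorProduct.induction_on with
          | zero => simp
          | add s t hs ht => simp only [map_add, hs, ht]
          | tmul b d => simp
      _ = f (((comul (R := k) (A := H)).rTensor H ∘ₗ comul).lTensor H (comul a)) := by
          rw [e1]
          exact congrArg f (LinearMap.congr_fun e2 a)
      _ = 1 ⊗ₜ m (comul a) := LinearMap.congr_fun e3 (comul a)
      _ = _ := by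
        simp [m, Algebra.TensorProduct.algebraMap_apply, Algebra.algebraMap_eq_smul_one,
          Algebra.TensorProduct.one_def]
  have h3 := left_inv_eq_right_inv h2 h1
  have h4 := congrArg WithConv.ofConv h3
  exact (LinearMap.congr_fun h4 a).symm

/-- The antipode of `H` is bijective (which is automatic if `H` is finite-dimensional). -/
class HopfAlgebra.BijectiveAntipode (k : Type u) (H : Type v) [Field k] [Ring H]
    [HopfAlgebra k H] : Prop where
  bijective : Function.Bijective (antipode k : H →ₗ[k] H)

/-- The inverse `S⁻¹` of the antipode. -/
def HopfAlgebra.antipodeInv (k : Type u) (H : Type v) [Field k] [Ring H] [HopfAlgebra k H]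
    [BijectiveAntipode k H] : H →ₗ[k] H :=
  (LinearEquiv.ofBijective (antipode k) (BijectiveAntipode.bijective (k := k) (H := H))).symm

namespace HopfAlgebra

variable {k : Type u} {H : Type v} [Field k] [Ring H] [HopfAlgebra k H] [BijectiveAntipode k H]

@[simp] lemma antipodeInv_antipode (a : H) : antipodeInv k H (antipode k a) = a :=
  LinearEquiv.symm_apply_apply (LinearEquiv.ofBijective (antipode k) _) a

@[simp] lemma antipode_antipodeInv (a : H) : antipode k (antipodeInv k H a) = a :=
  LinearEquiv.apply_symm_apply (LinearEquiv.ofBijective (antipode k) _) a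

lemma antipode_injective : Function.Injective (antipode k : H →ₗ[k] H) :=
  (BijectiveAntipode.bijective (k := k) (H := H)).1

@[simp] lemma antipodeInv_one : antipodeInv k H 1 = 1 :=
  antipode_injective (k := k) (by simp)

lemma antipodeInv_mul (a b : H) :
    antipodeInv k H (a * b) = antipodeInv k H b * antipodeInv k H a :=
  antipode_injective (k := k) (by simp [antipode_mul_antidistrib])

@[simp] lemma counit_antipodeInv (a : H) :
    counit (R := k) (antipodeInv k H a) = counit (R := k) a := by
  rw [← counit_antipode (R := k) (antipodeInv k H a), antipode_antipodeInv]

lemma comul_antipodeInv (a : H) : comul (R := k) (antipodeInv k H a) =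
    TensorProduct.map (antipodeInv k H) (antipodeInv k H) (TensorProduct.comm k H H (comul a)) := by
  have h := comul_antipode_eq k (antipodeInv k H a)
  rw [antipode_antipodeInv] at h
  rw [h]
  generalize comul (R := k) (antipodeInv k H a) = t
  induction t using TensorProduct.induction_on with
  | zero => simp
  | add s t hs ht => simp only [map_add, ← hs, ← ht]
  | tmul b d => simp

/-- `∑ a₂ S⁻¹(a₁) = ε(a)`. -/
lemma mul_antipodeInv_comul (a : H) :
    LinearMap.mul' k H ((antipodeInv k H).lTensor H (TensorProduct.comm k H H (comul a))) =
      algebraMap k H (counit a) := by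
  apply antipode_injective (k := k)
  have h := mul_antipode_lTensor_comul_apply (R := k) a
  rw [Algebra.algebraMap_eq_smul_one, map_smul, antipode_one, ← Algebra.algebraMap_eq_smul_one, ← h]
  generalize comul (R := k) a = t
  induction t using TensorProduct.induction_on with
  | zero => simp
  | add s t hs ht => simp only [map_add, ← hs, ← ht]
  | tmul b d => simp [antipode_mul_antidistrib]

/-- `∑ S⁻¹(a₂) a₁ = ε(a)`. -/
lemma antipodeInv_mul_comul (a : H) :
    LinearMap.mul' k H ((antipodeInv k H).rTensor H (TensorProduct.comm k H H (comul a))) =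
      algebraMap k H (counit a) := by
  apply antipode_injective (k := k)
  have h := mul_antipode_rTensor_comul_apply (R := k) a
  rw [Algebra.algebraMap_eq_smul_one, map_smul, antipode_one, ← Algebra.algebraMap_eq_smul_one, ← h]
  generalize comul (R := k) a = t
  induction t using TensorProduct.induction_on with
  | zero => simp
  | add s t hs ht => simp only [map_add, ← hs, ← ht]
  | tmul b d => simp [antipode_mul_antidistrib]

end HopfAlgebra

end antipode

/-! ### The Hopf algebra `(H^*)^cop` -/

section dual

open Coalgebra HopfAlgebra

/-- The dual `(H^*)^cop` of a finite-dimensional Hopf algebra, with the convolution product and the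
opposite of the comultiplication dual to the product of `H`. -/
def DualCop (k : Type u) (H : Type v) [Field k] [Ring H] [HopfAlgebra k H] : Type (max v u) :=
  WithConv (H →ₗ[k] k)

namespace DualCop

variable (k : Type u) (H : Type v) [Field k] [Ring H] [HopfAlgebra k H]

instance instRing : Ring (DualCop k H) := inferInstanceAs (Ring (WithConv (H →ₗ[k] k)))
instance instAlgebra : Algebra k (DualCop k H) :=
  inferInstanceAs (Algebra k (WithConv (H →ₗ[k] k)))

/-- The identification of `(H^*)^cop` with the dual space of `H`. -/
def toDual : DualCop k H ≃ₗ[k] Module.Dual k H := WithConv.linearEquiv k (H →ₗ[k] k)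

instance instFunLike : FunLike (DualCop k H) H k where
  coe p := toDual k H p
  coe_injective p q h := (toDual k H).injective (DFunLike.coe_injective h)

variable {k H}

@[ext] lemma ext {p q : DualCop k H} (h : ∀ y, p y = q y) : p = q := DFunLike.ext _ _ h

@[simp] lemma toDual_apply (p : DualCop k H) (y : H) : toDual k H p y = p y := rfl
@[simp] lemma toDual_symm_apply (f : Module.Dual k H) (y : H) : (toDual k H).symm f y = f y := rfl
@[simp] lemma add_apply (p q : DualCop k H) (y : H) : (p + q) y = p y + q y := rfl
@[simp] lemma smul_apply (c : k) (p : DualCop k H) (y : H) : (c • p) y = c * p y := rfl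
@[simp] lemma zero_apply (y : H) : (0 : DualCop k H) y = 0 := rfl
@[simp] lemma map_add' (p : DualCop k H) (y z : H) : p (y + z) = p y + p z :=
  map_add (toDual k H p) y z
@[simp] lemma map_smul' (p : DualCop k H) (c : k) (y : H) : p (c • y) = c * p y :=
  map_smul (toDual k H p) c y
@[simp] lemma map_zero' (p : DualCop k H) : p 0 = 0 := map_zero (toDual k H p)
@[simp] lemma one_apply (y : H) : (1 : DualCop k H) y = counit (R := k) y := rfl

variable (k H)

/-- The pairing of `H^* ⊗ H^*` with `H ⊗ H`. -/
def ev₂ [Module.Finite k H] : DualCop k H ⊗[k] DualCop k H ≃ₗ[k] Module.Dual k (H ⊗[k] H) :=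
  TensorProduct.congr (toDual k H) (toDual k H) ≪≫ₗ TensorProduct.dualDistribEquiv k H H

/-- The pairing of `H^* ⊗ (H^* ⊗ H^*)` with `H ⊗ (H ⊗ H)`. -/
def ev₃ [Module.Finite k H] : DualCop k H ⊗[k] (DualCop k H ⊗[k] DualCop k H) ≃ₗ[k]
    Module.Dual k (H ⊗[k] (H ⊗[k] H)) :=
  TensorProduct.congr (toDual k H) (ev₂ k H) ≪≫ₗ TensorProduct.dualDistribEquiv k H (H ⊗[k] H)

variable {k H}
variable [Module.Finite k H]

@[simp] lemma ev₂_tmul (p q : DualCop k H) (y z : H) :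
    ev₂ k H (p ⊗ₜ q) (y ⊗ₜ z) = p y * q z := rfl

@[simp] lemma ev₃_tmul (p : DualCop k H) (s : DualCop k H ⊗[k] DualCop k H) (y : H)
    (t : H ⊗[k] H) : ev₃ k H (p ⊗ₜ s) (y ⊗ₜ t) = p y * ev₂ k H s t := rfl

/-- The product of `H^*` is dual to the comultiplication of `H`. -/
lemma mul_apply (p q : DualCop k H) (y : H) : (p * q) y = ev₂ k H (p ⊗ₜ q) (comul (R := k) y) := by
  change LinearMap.mul' k k (TensorProduct.map (toDual k H p) (toDual k H q) (comul y)) = _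
  generalize comul (R := k) y = t
  induction t using TensorProduct.induction_on with
  | zero => simp
  | add s t hs ht => simp only [map_add, hs, ht]
  | tmul b d => simp

variable (k H)

/-- The comultiplication of `(H^*)^cop`: if `Δ(p) = ∑ p' ⊗ p''` then `∑ p'(y) p''(z) = p(z y)`. -/
def comulMap : DualCop k H →ₗ[k] DualCop k H ⊗[k] DualCop k H :=
  (ev₂ k H).symm.toLinearMap ∘ₗ
    (LinearMap.mul' k H ∘ₗ (TensorProduct.comm k H H).toLinearMap).dualMap ∘ₗ
      (toDual k H).toLinearMap

/-- The counit of `(H^*)^cop`: evaluation at `1`. -/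
def counitMap : DualCop k H →ₗ[k] k := Module.Dual.eval k H 1 ∘ₗ (toDual k H).toLinearMap

variable {k H}

@[simp] lemma ev₂_comulMap (p : DualCop k H) (y z : H) :
    ev₂ k H (comulMap k H p) (y ⊗ₜ z) = p (z * y) := by
  simp [comulMap]

@[simp] lemma counitMap_apply (p : DualCop k H) : counitMap k H p = p 1 := rfl

instance instCoalgebra : Coalgebra k (DualCop k H) where
  comul := comulMap k H
  counit := counitMap k H
  coassoc := by
    ext p
    apply (ev₃ k H).injective
    ext y z w
    have h1 : ∀ t : DualCop k H ⊗[k] DualCop k H,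
        ev₃ k H (TensorProduct.assoc k _ _ _ ((comulMap k H).rTensor _ t)) (y ⊗ₜ (z ⊗ₜ w)) =
          ev₂ k H t ((z * y) ⊗ₜ w) := by
      intro t
      induction t using TensorProduct.induction_on with
      | zero => simp
      | add s t hs ht => simp only [map_add, LinearMap.add_apply, hs, ht]
      | tmul p q =>
        rw [LinearMap.rTensor_tmul, ev₂_tmul, ← ev₂_comulMap]
        generalize comulMap k H p = s
        induction s using TensorProduct.induction_on with
        | zero => simp
        | add s t hs ht =>
          simp only [map_add, LinearMap.add_apply, TensorProduct.add_tmul, hs, ht, add_mul]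
        | tmul u v => simp [mul_assoc]
    have h2 : ∀ t : DualCop k H ⊗[k] DualCop k H,
        ev₃ k H ((comulMap k H).lTensor _ t) (y ⊗ₜ (z ⊗ₜ w)) = ev₂ k H t (y ⊗ₜ (w * z)) := by
      intro t
      induction t using TensorProduct.induction_on with
      | zero => simp
      | add s t hs ht => simp only [map_add, LinearMap.add_apply, hs, ht]
      | tmul p q => simp
    change ev₃ k H (TensorProduct.assoc k _ _ _ ((comulMap k H).rTensor _ (comulMap k H p)))
      (y ⊗ₜ (z ⊗ₜ w)) = ev₃ k H ((comulMap k H).lTensor _ (comulMap k H p)) (y ⊗ₜ (z ⊗ₜ w))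
    rw [h1, h2, ev₂_comulMap, ev₂_comulMap, mul_assoc]
  rTensor_counit_comp_comul := by
    ext p
    apply (TensorProduct.lid k _).injective
    ext z
    have h : ∀ t : DualCop k H ⊗[k] DualCop k H,
        TensorProduct.lid k _ ((counitMap k H).rTensor _ t) z = ev₂ k H t (1 ⊗ₜ z) := by
      intro t
      induction t using TensorProduct.induction_on with
      | zero => simp
      | add s t hs ht => simp only [map_add, LinearMap.add_apply, add_apply, hs, ht]
      | tmul p q => simp
    change TensorProduct.lid k _ ((counitMap k H).rTensor _ (comulMap k H p)) z = _
    rw [h]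
    simp
  lTensor_counit_comp_comul := by
    ext p
    apply (TensorProduct.rid k _).injective
    ext z
    have h : ∀ t : DualCop k H ⊗[k] DualCop k H,
        TensorProduct.rid k _ ((counitMap k H).lTensor _ t) z = ev₂ k H t (z ⊗ₜ 1) := by
      intro t
      induction t using TensorProduct.induction_on with
      | zero => simp
      | add s t hs ht => simp only [map_add, LinearMap.add_apply, add_apply, hs, ht]
      | tmul p q => simp [mul_comm]
    change TensorProduct.rid k _ ((counitMap k H).lTensor _ (comulMap k H p)) z = _
    rw [h]
    simp

@[simp] lemma ev₂_comul (p : DualCop k H) (y z : H) :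
    ev₂ k H (comul (R := k) p) (y ⊗ₜ z) = p (z * y) := ev₂_comulMap p y z

@[simp] lemma counit_apply (p : DualCop k H) : counit (R := k) p = p 1 := rfl

lemma ev₂_mul (s t : DualCop k H ⊗[k] DualCop k H) (u : H ⊗[k] H) :
    ev₂ k H (s * t) u = LinearMap.mul' k k (TensorProduct.map (ev₂ k H s) (ev₂ k H t)
      (comul (R := k) u)) := by
  induction u using TensorProduct.induction_on with
  | zero => simp
  | add u v hu hv => simp only [map_add, hu, hv]
  | tmul y z =>
    rw [TensorProduct.comul_tmul]
    induction s using TensorProduct.induction_on with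
    | zero => simp
    | add s s' hs hs' =>
      simp only [map_add, add_mul, LinearMap.add_apply, TensorProduct.map_add_left, hs, hs']
    | tmul p p' =>
      induction t using TensorProduct.induction_on with
      | zero => simp
      | add s s' hs hs' =>
        simp only [map_add, mul_add, LinearMap.add_apply, TensorProduct.map_add_right, hs, hs']
      | tmul q q' =>
        rw [Algebra.TensorProduct.tmul_mul_tmul, ev₂_tmul, mul_apply, mul_apply]
        generalize comul (R := k) y = a
        generalize comul (R := k) z = b
        induction a using TensorProduct.induction_on with
        | zero => simp
        | add s s' hs hs' => simp only [map_add, TensorProduct.add_tmul, add_mul, hs, hs']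
        | tmul y₁ y₂ =>
          induction b using TensorProduct.induction_on with
          | zero => simp
          | add s s' hs hs' => simp only [map_add, TensorProduct.tmul_add, mul_add, hs, hs']
          | tmul z₁ z₂ =>
            simp
            ring

lemma comul_mul (p q : DualCop k H) :
    comul (R := k) (p * q) = comul (R := k) p * comul (R := k) q := by
  apply (ev₂ k H).injective
  ext y z
  change ev₂ k H (comul (R := k) (p * q)) (y ⊗ₜ z) =
    ev₂ k H (comul (R := k) p * comul (R := k) q) (y ⊗ₜ z)
  rw [ev₂_comul, mul_apply, ev₂_mul, TensorProduct.comul_tmul, Bialgebra.comul_mul]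
  generalize comul (R := k) y = a
  generalize comul (R := k) z = b
  induction a using TensorProduct.induction_on with
  | zero => simp
  | add s s' hs hs' => simp only [map_add, TensorProduct.add_tmul, mul_add, hs, hs']
  | tmul y₁ y₂ =>
    induction b using TensorProduct.induction_on with
    | zero => simp
    | add s s' hs hs' => simp only [map_add, TensorProduct.tmul_add, add_mul, hs, hs']
    | tmul z₁ z₂ => simp

lemma comul_one : comul (R := k) (1 : DualCop k H) = 1 := by
  apply (ev₂ k H).injective
  ext y z
  change ev₂ k H (comul (R := k) (1 : DualCop k H)) (y ⊗ₜ z) = ev₂ k H (1 ⊗ₜ 1) (y ⊗ₜ z)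
  simp [mul_comm]

end DualCop

end dual

/-! ### The Drinfel'd double -/

section double

open Coalgebra HopfAlgebra

namespace DrinfeldDouble

/-- The rearrangement `a ⊗ (b ⊗ c) ↦ (c ⊗ a) ⊗ b`. -/
def rot (k : Type u) [Field k] (M N P : Type*) [AddCommGroup M] [Module k M] [AddCommGroup N]
    [Module k N] [AddCommGroup P] [Module k P] : M ⊗[k] (N ⊗[k] P) →ₗ[k] (P ⊗[k] M) ⊗[k] N :=
  (TensorProduct.comm k N (P ⊗[k] M)).toLinearMap ∘ₗ (TensorProduct.assoc k N P M).toLinearMap ∘ₗ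
    (TensorProduct.comm k M (N ⊗[k] P)).toLinearMap

@[simp] lemma rot_tmul (k : Type u) [Field k] {M N P : Type*} [AddCommGroup M] [Module k M]
    [AddCommGroup N] [Module k N] [AddCommGroup P] [Module k P] (a : M) (b : N) (c : P) :
    rot k M N P (a ⊗ₜ (b ⊗ₜ c)) = (c ⊗ₜ a) ⊗ₜ b := rfl

variable (k : Type u) (H : Type v) [Field k] [Ring H] [HopfAlgebra k H]

/-- `a ↦ ∑ a₁ ⊗ (a₂ ⊗ a₃)`. -/
def comul₃ : H →ₗ[k] H ⊗[k] (H ⊗[k] H) := (comul (R := k) (A := H)).lTensor H ∘ₗ comul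

/-- The action `p ↦ p(? a)` of `H` on `H^*`. -/
def actR : H →ₗ[k] Module.End k (DualCop k H) where
  toFun a := (DualCop.toDual k H).symm.toLinearMap ∘ₗ (LinearMap.mulRight k a).dualMap ∘ₗ
    (DualCop.toDual k H).toLinearMap
  map_add' a b := by ext p y; simp [mul_add]
  map_smul' c a := by ext p y; simp

/-- Left multiplication by elements of `H^*` on `H^* ⊗ H`. -/
def mulDual : DualCop k H →ₗ[k] Module.End k (DualCop k H ⊗[k] H) :=
  LinearMap.rTensorHom H ∘ₗ LinearMap.mul k (DualCop k H)

variable {k H}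

@[simp] lemma actR_apply (a : H) (p : DualCop k H) (y : H) : actR k H a p y = p (y * a) := rfl

lemma actR_mul (a b : H) (p : DualCop k H) : actR k H (a * b) p = actR k H a (actR k H b p) := by
  ext y; simp [mul_assoc]

@[simp] lemma actR_one (p : DualCop k H) : actR k H 1 p = p := by
  ext y; simp

@[simp] lemma mulDual_tmul (p q : DualCop k H) (h : H) :
    mulDual k H p (q ⊗ₜ h) = (p * q) ⊗ₜ h := rfl

lemma mulDual_mul (p q : DualCop k H) (F : DualCop k H ⊗[k] H) :
    mulDual k H (p * q) F = mulDual k H p (mulDual k H q F) := by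
  induction F using TensorProduct.induction_on with
  | zero => simp
  | add F G hF hG => simp only [map_add, hF, hG]
  | tmul r h => simp [mul_assoc]

@[simp] lemma mulDual_one (F : DualCop k H ⊗[k] H) : mulDual k H 1 F = F := by
  induction F using TensorProduct.induction_on with
  | zero => simp
  | add F G hF hG => simp only [map_add, hF, hG]
  | tmul r h => simp

lemma comul₃_one : comul₃ k H 1 = 1 ⊗ₜ (1 ⊗ₜ 1) := by
  simp [comul₃, Algebra.TensorProduct.one_def]

lemma comul₃_mul (a b : H) : comul₃ k H (a * b) = comul₃ k H a * comul₃ k H b := by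
  change (Algebra.TensorProduct.map (AlgHom.id k H) (Bialgebra.comulAlgHom k H))
    (Bialgebra.comulAlgHom k H (a * b)) = _
  rw [map_mul, map_mul]
  rfl

variable [BijectiveAntipode k H]

variable (k H)

/-- The action `p ↦ p(S⁻¹(a) ?)` of `H` on `H^*`. -/
def actL : H →ₗ[k] Module.End k (DualCop k H) where
  toFun a := (DualCop.toDual k H).symm.toLinearMap ∘ₗ
    (LinearMap.mulLeft k (antipodeInv k H a)).dualMap ∘ₗ (DualCop.toDual k H).toLinearMap
  map_add' a b := by ext p y; simp [add_mul]
  map_smul' c a := by ext p y; simp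

/-- `c ⊗ a` acts on `H^*` by `p ↦ p(S⁻¹(c) ? a)`. -/
def actLR : H ⊗[k] H →ₗ[k] Module.End k (DualCop k H) :=
  LinearMap.mul' k (Module.End k (DualCop k H)) ∘ₗ TensorProduct.map (actL k H) (actR k H)

/-- `a ⊗ (b ⊗ c)` acts on `H^* ⊗ H` by `p ⊗ h ↦ p(S⁻¹(c) ? a) ⊗ b h`. -/
def actT : H ⊗[k] (H ⊗[k] H) →ₗ[k] Module.End k (DualCop k H ⊗[k] H) :=
  TensorProduct.homTensorHomMap (.id k) (DualCop k H) H (DualCop k H) H ∘ₗ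
    TensorProduct.map (actLR k H) (LinearMap.mul k H) ∘ₗ rot k H H H

/-- Left multiplication by elements of `H` on `H^* ⊗ H`:
`a · (p ⊗ h) = ∑ p(S⁻¹(a₃) ? a₁) ⊗ a₂ h`. -/
def mulH : H →ₗ[k] Module.End k (DualCop k H ⊗[k] H) := actT k H ∘ₗ comul₃ k H

/-- The product of the Drinfel'd double on `H^* ⊗ H`:
`(p ⊗ a) (q ⊗ b) = ∑ p q(S⁻¹(a₃) ? a₁) ⊗ a₂ b`. -/
def mulMap : DualCop k H ⊗[k] H →ₗ[k] DualCop k H ⊗[k] H →ₗ[k] DualCop k H ⊗[k] H :=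
  TensorProduct.lift
    ((LinearMap.mul k (Module.End k (DualCop k H ⊗[k] H))).compl₁₂ (mulDual k H) (mulH k H))

variable {k H}

@[simp] lemma actL_apply (a : H) (p : DualCop k H) (y : H) :
    actL k H a p y = p (antipodeInv k H a * y) := rfl

lemma actL_mul (a b : H) (p : DualCop k H) : actL k H (a * b) p = actL k H a (actL k H b p) := by
  ext y; simp [mul_assoc, antipodeInv_mul]

@[simp] lemma actL_one (p : DualCop k H) : actL k H 1 p = p := by
  ext y; simp

lemma actL_actR (a b : H) (p : DualCop k H) :
    actL k H a (actR k H b p) = actR k H b (actL k H a p) := by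
  ext y; simp [mul_assoc]

@[simp] lemma actLR_tmul (c a : H) (p : DualCop k H) :
    actLR k H (c ⊗ₜ a) p = actL k H c (actR k H a p) := rfl

@[simp] lemma actT_tmul (a b c : H) (p : DualCop k H) (h : H) :
    actT k H (a ⊗ₜ (b ⊗ₜ c)) (p ⊗ₜ h) = actL k H c (actR k H a p) ⊗ₜ (b * h) := rfl

lemma actT_mul (s t : H ⊗[k] (H ⊗[k] H)) (F : DualCop k H ⊗[k] H) :
    actT k H (s * t) F = actT k H s (actT k H t F) := by
  suffices h : (LinearMap.mul k (H ⊗[k] (H ⊗[k] H))).compr₂ (actT k H) =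
      (LinearMap.mul k (Module.End k (DualCop k H ⊗[k] H))).compl₁₂ (actT k H) (actT k H) from
    LinearMap.congr_fun (LinearMap.congr_fun₂ h s t) F
  ext a b c a' b' c' p h
  simp [actR_mul, actL_mul, mul_assoc, actL_actR]

lemma mulH_apply (a : H) (F : DualCop k H ⊗[k] H) :
    mulH k H a F = actT k H (comul₃ k H a) F := rfl

lemma mulH_mul (a b : H) (F : DualCop k H ⊗[k] H) :
    mulH k H (a * b) F = mulH k H a (mulH k H b F) := by
  rw [mulH_apply, comul₃_mul, actT_mul]
  rfl

@[simp] lemma mulH_one (F : DualCop k H ⊗[k] H) : mulH k H 1 F = F := by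
  rw [mulH_apply, comul₃_one]
  induction F using TensorProduct.induction_on with
  | zero => simp
  | add F G hF hG => simp only [map_add, hF, hG]
  | tmul r h => simp

@[simp] lemma mulMap_tmul (p : DualCop k H) (a : H) (F : DualCop k H ⊗[k] H) :
    mulMap k H (p ⊗ₜ a) F = mulDual k H p (mulH k H a F) := rfl

lemma mulMap_mulDual (p : DualCop k H) (F G : DualCop k H ⊗[k] H) :
    mulMap k H (mulDual k H p F) G = mulDual k H p (mulMap k H F G) := by
  induction F using TensorProduct.induction_on with
  | zero => simp
  | add F G hF hG => simp only [map_add, LinearMap.add_apply, hF, hG]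
  | tmul r h => simp [mulDual_mul]

lemma one_mulMap (F : DualCop k H ⊗[k] H) : mulMap k H (1 ⊗ₜ 1) F = F := by simp

variable [Module.Finite k H]

/-- `(q r)(S⁻¹(c) ? a) = ∑ q(S⁻¹(c₂) ? a₁) r(S⁻¹(c₁) ? a₂)`. -/
lemma actL_actR_mul (a c : H) (q r : DualCop k H) :
    actL k H c (actR k H a (q * r)) = LinearMap.mul' k (DualCop k H)
      (TensorProduct.map ((actLR k H).flip q) ((actLR k H).flip r)
        (TensorProduct.tensorTensorTensorComm k H H H H
          (TensorProduct.comm k H H (comul c) ⊗ₜ comul a))) := by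
  ext y
  rw [actL_apply, actR_apply, DualCop.mul_apply, Bialgebra.comul_mul, Bialgebra.comul_mul,
    comul_antipodeInv]
  generalize comul (R := k) c = s
  generalize comul (R := k) a = t
  induction s using TensorProduct.induction_on with
  | zero => simp
  | add s s' hs hs' =>
    simp only [map_add, TensorProduct.add_tmul, add_mul, DualCop.add_apply, hs, hs']
  | tmul c₁ c₂ =>
    induction t using TensorProduct.induction_on with
    | zero => simp
    | add s s' hs hs' =>
      simp only [map_add, TensorProduct.tmul_add, mul_add, DualCop.add_apply, hs, hs']
    | tmul a₁ a₂ =>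
      simp only [TensorProduct.comm_tmul, TensorProduct.tensorTensorTensorComm_tmul,
        TensorProduct.map_tmul, LinearMap.flip_apply, LinearMap.mul'_apply, DualCop.mul_apply]
      generalize comul (R := k) y = z
      induction z using TensorProduct.induction_on with
      | zero => simp
      | add s s' hs hs' => simp only [map_add, mul_add, add_mul, hs, hs']
      | tmul y₁ y₂ => simp

/-- The commutation rule `a · (q · F) = ∑ q(S⁻¹(a₃) ? a₁) · (a₂ · F)`, in the form of
the associativity `(a · G) F = a · (G F)`. -/
lemma mulMap_mulH (a : H) (F G : DualCop k H ⊗[k] H) :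
    mulMap k H (mulH k H a F) G = mulH k H a (mulMap k H F G) := by
  induction F using TensorProduct.induction_on with
  | zero => simp
  | add F F' hF hF' => simp only [map_add, LinearMap.add_apply, hF, hF']
  | tmul q b =>
    rw [mulMap_tmul]
    have h1 : ∀ t : H ⊗[k] (H ⊗[k] H), mulMap k H (actT k H t (q ⊗ₜ b)) G =
        TensorProduct.lift (mulDual k H) (TensorProduct.map ((actLR k H).flip q)
          ((mulH k H).flip (mulH k H b G)) (rot k H H H t)) := by
      intro t
      suffices h : (mulMap k H).flip G ∘ₗ (actT k H).flip (q ⊗ₜ b) =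
          TensorProduct.lift (mulDual k H) ∘ₗ TensorProduct.map ((actLR k H).flip q)
          ((mulH k H).flip (mulH k H b G)) ∘ₗ rot k H H H from LinearMap.congr_fun h t
      ext a b' c
      simp [mulH_mul]
    rw [mulH_apply, h1]
    generalize mulH k H b G = F
    induction F using TensorProduct.induction_on with
    | zero => simp
    | add F F' hF hF' =>
      simp only [map_add, TensorProduct.map_add_right, LinearMap.add_apply, hF, hF']
    | tmul r h =>
      let Θ : H ⊗[k] ((H ⊗[k] (H ⊗[k] H)) ⊗[k] H) →ₗ[k] DualCop k H ⊗[k] H :=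
        TensorProduct.lift (mulDual k H) ∘ₗ TensorProduct.map ((actLR k H).flip q)
          ((actT k H).flip (r ⊗ₜ h)) ∘ₗ rot k H (H ⊗[k] (H ⊗[k] H)) H
      have h2 : TensorProduct.lift (mulDual k H) ∘ₗ TensorProduct.map ((actLR k H).flip q)
          ((mulH k H).flip (r ⊗ₜ h)) ∘ₗ rot k H H H =
          Θ ∘ₗ ((comul₃ k H).rTensor H).lTensor H := by
        ext a b' c
        simp [Θ, mulH_apply]
      let R : (H ⊗[k] H) ⊗[k] (H ⊗[k] (H ⊗[k] H)) →ₗ[k]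
          H ⊗[k] ((H ⊗[k] (H ⊗[k] H)) ⊗[k] H) :=
        ((TensorProduct.assoc k H (H ⊗[k] H) H).symm.toLinearMap ∘ₗ
          (TensorProduct.assoc k H H H).symm.toLinearMap.lTensor H).lTensor H ∘ₗ
          (TensorProduct.assoc k H H (H ⊗[k] (H ⊗[k] H))).toLinearMap
      have h3 : (actT k H).flip ((q * r) ⊗ₜ h) = Θ ∘ₗ R ∘ₗ
          TensorProduct.map (comul (R := k) (A := H)) ((comul (R := k) (A := H)).lTensor H) := by
        ext a b c
        change actT k H (a ⊗ₜ (b ⊗ₜ c)) ((q * r) ⊗ₜ h) =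
          Θ (R (comul (R := k) a ⊗ₜ (b ⊗ₜ comul (R := k) c)))
        rw [actT_tmul, actL_actR_mul]
        generalize comul (R := k) a = s
        generalize comul (R := k) c = t
        induction s using TensorProduct.induction_on with
        | zero => simp
        | add s s' hs hs' =>
          simp only [map_add, TensorProduct.add_tmul, TensorProduct.tmul_add, hs, hs']
        | tmul c₁ c₂ =>
          induction t using TensorProduct.induction_on with
          | zero => simp
          | add s s' hs hs' =>
            simp only [map_add, TensorProduct.add_tmul, TensorProduct.tmul_add, hs, hs']
          | tmul a₁ a₂ => simp [Θ, R]
      have h4 : R ∘ₗ TensorProduct.map (comul (R := k) (A := H))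
          ((comul (R := k) (A := H)).lTensor H) ∘ₗ comul₃ k H =
          ((comul₃ k H).rTensor H).lTensor H ∘ₗ comul₃ k H := by
        simp only [R, comul₃, coassoc_simps]
      have e1 := LinearMap.congr_fun h2 (comul₃ k H a)
      have e2 := LinearMap.congr_fun h3 (comul₃ k H a)
      have e3 := congrArg Θ (LinearMap.congr_fun h4 a)
      simp only [LinearMap.comp_apply] at e1 e2 e3
      rw [e1, ← e3, ← e2]
      rfl

lemma mulMap_assoc (F G K : DualCop k H ⊗[k] H) :
    mulMap k H (mulMap k H F G) K = mulMap k H F (mulMap k H G K) := by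
  induction F using TensorProduct.induction_on with
  | zero => simp
  | add F F' hF hF' => simp only [map_add, LinearMap.add_apply, hF, hF']
  | tmul p a => rw [mulMap_tmul, mulMap_mulDual, mulMap_mulH, mulMap_tmul]

lemma mulH_one_tmul_one (a : H) : mulH k H a (1 ⊗ₜ 1) = 1 ⊗ₜ a := by
  have h : (actT k H).flip (1 ⊗ₜ 1) = TensorProduct.mk k (DualCop k H) H 1 ∘ₗ
      (TensorProduct.lid k H).toLinearMap ∘ₗ TensorProduct.map (counit (R := k) (A := H))
        ((TensorProduct.rid k H).toLinearMap ∘ₗ (counit (R := k) (A := H)).lTensor H) := by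
    ext a b c
    have : actL k H c (actR k H a 1) = (counit (R := k) a * counit (R := k) c) • 1 := by
      ext y
      simp only [actL_apply, actR_apply, DualCop.one_apply, Bialgebra.counit_mul,
        counit_antipodeInv, DualCop.smul_apply]
      ring
    simp [this, TensorProduct.smul_tmul, mul_smul]
    exact smul_comm _ _ _
  have := LinearMap.congr_fun h (comul₃ k H a)
  rw [mulH_apply]
  refine this.trans ?_
  simp only [LinearMap.comp_apply, TensorProduct.mk_apply]
  congr 1
  have e : ((TensorProduct.lid k H).toLinearMap ∘ₗ TensorProduct.map (counit (R := k) (A := H))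
      ((TensorProduct.rid k H).toLinearMap ∘ₗ (counit (R := k) (A := H)).lTensor H)) ∘ₗ
        (comul (R := k) (A := H)).lTensor H = (TensorProduct.lid k H).toLinearMap ∘ₗ
          (counit (R := k) (A := H)).rTensor H := by
    ext a b
    simp
  have := LinearMap.congr_fun e (comul a)
  simp only [LinearMap.comp_apply] at this
  rw [comul₃, LinearMap.comp_apply, this]
  simp

lemma mulMap_one (F : DualCop k H ⊗[k] H) : mulMap k H F (1 ⊗ₜ 1) = F := by
  induction F using TensorProduct.induction_on with
  | zero => simp
  | add F F' hF hF' => simp only [map_add, LinearMap.add_apply, hF, hF']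
  | tmul p a => simp [mulH_one_tmul_one]

lemma comul_actL_actR (a c : H) (q : DualCop k H) :
    comul (R := k) (actL k H c (actR k H a q)) =
      TensorProduct.map (actR k H a) (actL k H c) (comul q) := by
  apply (DualCop.ev₂ k H).injective
  ext y z
  have h : ∀ t, DualCop.ev₂ k H (TensorProduct.map (actR k H a) (actL k H c) t) (y ⊗ₜ z) =
      DualCop.ev₂ k H t ((y * a) ⊗ₜ (antipodeInv k H c * z)) := by
    intro t
    induction t using TensorProduct.induction_on with
    | zero => simp
    | add s t hs ht => simp only [map_add, LinearMap.add_apply, hs, ht]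
    | tmul p q => simp
  change DualCop.ev₂ k H _ (y ⊗ₜ z) = DualCop.ev₂ k H _ (y ⊗ₜ z)
  rw [h]
  simp [mul_assoc]

/-- `∑ q'(S⁻¹(a₁) ?) ⊗ q''(? a₂) = ε(a) ∑ q' ⊗ q''`. -/
lemma map_actL_actR_comul (a : H) (q : DualCop k H) :
    TensorProduct.homTensorHomMap (.id k) _ _ _ _ (TensorProduct.map (actL k H) (actR k H)
      (comul (R := k) a)) (comul (R := k) q) = counit (R := k) a • comul (R := k) q := by
  apply (DualCop.ev₂ k H).injective
  ext y z
  have h : ∀ t s, DualCop.ev₂ k H (TensorProduct.homTensorHomMap (.id k) _ _ _ _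
      (TensorProduct.map (actL k H) (actR k H) t) s) (y ⊗ₜ z) =
        DualCop.ev₂ k H s (TensorProduct.map (LinearMap.mulRight k y) (LinearMap.mulLeft k z)
          ((antipodeInv k H).rTensor H t)) := by
    intro t s
    induction t using TensorProduct.induction_on with
    | zero => simp
    | add s t hs ht => simp only [map_add, LinearMap.add_apply, hs, ht]
    | tmul a b =>
      induction s using TensorProduct.induction_on with
      | zero => simp
      | add s t hs ht => simp only [map_add, LinearMap.add_apply, hs, ht]
      | tmul p q => simp
  have h' : ∀ t, DualCop.ev₂ k H (comul (R := k) q) (TensorProduct.map (LinearMap.mulRight k y)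
      (LinearMap.mulLeft k z) ((antipodeInv k H).rTensor H t)) =
        q (z * (LinearMap.mul' k H ((antipodeInv k H).lTensor H (TensorProduct.comm k H H t)) *
          y)) := by
    intro t
    induction t using TensorProduct.induction_on with
    | zero => simp
    | add s t hs ht => simp only [map_add, mul_add, add_mul, DualCop.map_add', hs, ht]
    | tmul a b => simp [mul_assoc]
  change DualCop.ev₂ k H _ (y ⊗ₜ z) = DualCop.ev₂ k H _ (y ⊗ₜ z)
  rw [h, h', mul_antipodeInv_comul]
  simp [Algebra.algebraMap_eq_smul_one]

lemma comul_mulDual (p : DualCop k H) (F : DualCop k H ⊗[k] H) :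
    comul (R := k) (mulDual k H p F) = TensorProduct.homTensorHomMap (.id k) _ _ _ _
      (TensorProduct.map (mulDual k H) (mulDual k H) (comul (R := k) p)) (comul (R := k) F) := by
  induction F using TensorProduct.induction_on with
  | zero => simp
  | add F F' hF hF' => simp only [map_add, LinearMap.add_apply, hF, hF']
  | tmul q h =>
    rw [mulDual_tmul, TensorProduct.comul_tmul, TensorProduct.comul_tmul, DualCop.comul_mul]
    generalize comul (R := k) p = s
    generalize comul (R := k) q = t
    generalize comul (R := k) h = r
    induction s using TensorProduct.induction_on with
    | zero => simp
    | add s t hs ht =>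
      simp only [map_add, LinearMap.add_apply, add_mul, TensorProduct.add_tmul, hs, ht]
    | tmul a b =>
      induction t using TensorProduct.induction_on with
      | zero => simp
      | add s t hs ht => simp only [map_add, mul_add, TensorProduct.add_tmul, hs, ht]
      | tmul c d =>
        induction r using TensorProduct.induction_on with
        | zero => simp
        | add s t hs ht => simp only [map_add, TensorProduct.tmul_add, hs, ht]
        | tmul e f => simp

set_option maxHeartbeats 1000000 in
lemma comul_mulH (a : H) (F : DualCop k H ⊗[k] H) :
    comul (R := k) (mulH k H a F) = TensorProduct.homTensorHomMap (.id k) _ _ _ _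
      (TensorProduct.map (mulH k H) (mulH k H) (comul (R := k) a)) (comul (R := k) F) := by
  induction F using TensorProduct.induction_on with
  | zero => simp
  | add F F' hF hF' => simp only [map_add, LinearMap.add_apply, hF, hF']
  | tmul q h =>
    let N : (H ⊗[k] (H ⊗[k] H)) ⊗[k] (H ⊗[k] (H ⊗[k] H)) →ₗ[k]
        (DualCop k H ⊗[k] H) ⊗[k] (DualCop k H ⊗[k] H) :=
      (TensorProduct.homTensorHomMap (.id k) _ _ _ _ ∘ₗ
        TensorProduct.map (actT k H) (actT k H)).flip (comul (R := k) (q ⊗ₜ[k] h))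
    let κ : H ⊗[k] ((H ⊗[k] ((H ⊗[k] H) ⊗[k] H)) ⊗[k] H) →ₗ[k]
        (H ⊗[k] (H ⊗[k] H)) ⊗[k] (H ⊗[k] (H ⊗[k] H)) :=
      (TensorProduct.assoc k H (H ⊗[k] H) (H ⊗[k] (H ⊗[k] H))).symm.toLinearMap ∘ₗ
        ((TensorProduct.assoc k H H (H ⊗[k] (H ⊗[k] H))).symm.toLinearMap ∘ₗ
          ((TensorProduct.assoc k H H (H ⊗[k] H)).toLinearMap ∘ₗ
            (TensorProduct.assoc k (H ⊗[k] H) H H).toLinearMap).lTensor H ∘ₗ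
              (TensorProduct.assoc k H ((H ⊗[k] H) ⊗[k] H) H).toLinearMap).lTensor H
    have hN : ∀ (a b c d : H) (t : H ⊗[k] H), N (κ (a ⊗ₜ ((b ⊗ₜ (t ⊗ₜ c)) ⊗ₜ d))) =
        TensorProduct.tensorTensorTensorComm k _ _ _ _ (TensorProduct.map (actR k H a) (actL k H d)
          (TensorProduct.homTensorHomMap (.id k) _ _ _ _ (TensorProduct.map (actL k H) (actR k H)
            t) (comul (R := k) q)) ⊗ₜ TensorProduct.map (LinearMap.mulLeft k b)
              (LinearMap.mulLeft k c) (comul (R := k) h)) := by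
      intro a b c d t
      simp only [N, TensorProduct.comul_tmul, LinearMap.flip_apply]
      generalize comul (R := k) q = s
      generalize comul (R := k) h = r
      induction t using TensorProduct.induction_on with
      | zero => simp
      | add s t hs ht =>
        simp only [map_add, LinearMap.add_apply, TensorProduct.add_tmul, TensorProduct.tmul_add,
          hs, ht]
      | tmul u v =>
        induction s using TensorProduct.induction_on with
        | zero => simp
        | add s t hs ht => simp only [map_add, TensorProduct.add_tmul, hs, ht]
        | tmul c d =>
          induction r using TensorProduct.induction_on with
          | zero => simp
          | add s t hs ht => simp only [map_add, TensorProduct.tmul_add, hs, ht]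
          | tmul e f => simp [κ, actL_actR]
    have hN' : ∀ (a b c d : H), N (κ (a ⊗ₜ ((b ⊗ₜ ((1 ⊗ₜ 1) ⊗ₜ c)) ⊗ₜ d))) =
        TensorProduct.tensorTensorTensorComm k _ _ _ _ (TensorProduct.map (actR k H a) (actL k H d)
          (comul (R := k) q) ⊗ₜ TensorProduct.map (LinearMap.mulLeft k b)
              (LinearMap.mulLeft k c) (comul (R := k) h)) := by
      intro a b c d
      have e2 : (actL k H) 1 = .id := by ext1 p; simp
      have e3 : (actR k H) 1 = .id := by ext1 p; simp
      rw [hN, TensorProduct.map_tmul, TensorProduct.homTensorHomMap_apply, e2, e3,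
        TensorProduct.map_id]
      rfl
    let ι : H ⊗[k] ((H ⊗[k] H) ⊗[k] H) →ₗ[k] H ⊗[k] ((H ⊗[k] ((H ⊗[k] H) ⊗[k] H)) ⊗[k] H) :=
      (((TensorProduct.mk k (H ⊗[k] H) H (1 ⊗ₜ 1)).lTensor H).rTensor H).lTensor H
    have h1 : comul (R := k) (A := DualCop k H ⊗[k] H) ∘ₗ (actT k H).flip (q ⊗ₜ h) =
        N ∘ₗ κ ∘ₗ ι ∘ₗ ((comul (R := k) (A := H)).rTensor H).lTensor H := by
      ext a b c
      have e : ∀ t : H ⊗[k] H, N (κ (ι (a ⊗ₜ (t ⊗ₜ c)))) =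
          TensorProduct.tensorTensorTensorComm k _ _ _ _
            (TensorProduct.map (actR k H a) (actL k H c) (comul (R := k) q) ⊗ₜ
              (t * comul (R := k) h)) := by
        intro t
        induction t using TensorProduct.induction_on with
        | zero => simp
        | add s t hs ht =>
          simp only [map_add, TensorProduct.add_tmul, TensorProduct.tmul_add, add_mul, hs, ht]
        | tmul u v =>
          have e1 : ι (a ⊗ₜ ((u ⊗ₜ v) ⊗ₜ c)) = a ⊗ₜ ((u ⊗ₜ ((1 ⊗ₜ 1) ⊗ₜ v)) ⊗ₜ c) := rfl
          have e4 : TensorProduct.map (LinearMap.mulLeft k u) (LinearMap.mulLeft k v)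
              (comul (R := k) h) = (u ⊗ₜ v) * comul (R := k) h := by
            generalize comul (R := k) h = r
            induction r using TensorProduct.induction_on with
            | zero => simp
            | add s t hs ht => simp only [map_add, mul_add, hs, ht]
            | tmul e f => simp
          rw [e1, hN', e4]
      change comul (R := k) (actL k H c (actR k H a q) ⊗ₜ (b * h)) =
        N (κ (ι (a ⊗ₜ (comul (R := k) b ⊗ₜ c))))
      rw [e, TensorProduct.comul_tmul, comul_actL_actR, Bialgebra.comul_mul]
      rfl
    have h2 : N ∘ₗ κ ∘ₗ (((((comul (R := k) (A := H)).rTensor H).lTensor H).rTensor H).lTensor H) =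
        N ∘ₗ κ ∘ₗ ι ∘ₗ ((((TensorProduct.lid k H).toLinearMap ∘ₗ
          (counit (R := k) (A := H)).rTensor H).lTensor H).rTensor H).lTensor H := by
      ext a b c d e
      change N (κ (a ⊗ₜ ((b ⊗ₜ (comul (R := k) c ⊗ₜ d)) ⊗ₜ e))) =
        N (κ (a ⊗ₜ ((b ⊗ₜ ((1 ⊗ₜ 1) ⊗ₜ (counit (R := k) c • d))) ⊗ₜ e)))
      have e0 : (a ⊗ₜ[k] ((b ⊗ₜ[k] (((1 : H) ⊗ₜ[k] (1 : H)) ⊗ₜ[k] (counit (R := k) c • d))) ⊗ₜ[k] e)) =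
          counit (R := k) c • (a ⊗ₜ[k] ((b ⊗ₜ[k] (((1 : H) ⊗ₜ[k] (1 : H)) ⊗ₜ[k] d)) ⊗ₜ[k] e)) := by
        rw [TensorProduct.tmul_smul, TensorProduct.tmul_smul, ← TensorProduct.smul_tmul',
          TensorProduct.tmul_smul]
      rw [hN, map_actL_actR_comul, e0, map_smul, map_smul, map_smul, hN',
        ← TensorProduct.smul_tmul', map_smul]
    have h3 : κ ∘ₗ (((((comul (R := k) (A := H)).rTensor H).lTensor H).rTensor H).lTensor H) ∘ₗ
        (((comul₃ k H).rTensor H).lTensor H) ∘ₗ comul₃ k H =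
        TensorProduct.map (comul₃ k H) (comul₃ k H) ∘ₗ comul := by
      simp only [κ, comul₃, coassoc_simps]
    have h4 : ((((TensorProduct.lid k H).toLinearMap ∘ₗ
          (counit (R := k) (A := H)).rTensor H).lTensor H)) ∘ₗ comul₃ k H = comul := by
      have e : ((TensorProduct.lid k H).toLinearMap ∘ₗ (counit (R := k) (A := H)).rTensor H) ∘ₗ
          comul = .id := by
        ext b
        simp
      rw [comul₃, ← LinearMap.comp_assoc, ← LinearMap.lTensor_comp, e, LinearMap.lTensor_id,
        LinearMap.id_comp]
    have e1 := LinearMap.congr_fun h1 (comul₃ k H a)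
    have e2 := LinearMap.congr_fun h2 ((((comul₃ k H).rTensor H).lTensor H) (comul₃ k H a))
    have e3 := congrArg N (LinearMap.congr_fun h3 a)
    rw [← h4] at e1
    have e5 : TensorProduct.homTensorHomMap (.id k) _ _ _ _
      (TensorProduct.map (mulH k H) (mulH k H) (comul (R := k) a)) (comul (R := k) (q ⊗ₜ[k] h)) =
        N (TensorProduct.map (comul₃ k H) (comul₃ k H) (comul a)) := by
      have e : TensorProduct.map (mulH k H) (mulH k H) = TensorProduct.map (actT k H) (actT k H) ∘ₗ
          TensorProduct.map (comul₃ k H) (comul₃ k H) := TensorProduct.map_comp ..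
      rw [e]
      rfl
    rw [e5]
    refine e1.trans (Eq.trans ?_ (e2.symm.trans e3))
    simp only [LinearMap.lTensor_comp, LinearMap.rTensor_comp, LinearMap.comp_apply]
lemma counit_mulDual (p : DualCop k H) (F : DualCop k H ⊗[k] H) :
    counit (R := k) (mulDual k H p F) = p 1 * counit (R := k) F := by
  induction F using TensorProduct.induction_on with
  | zero => simp
  | add F F' hF hF' => simp only [map_add, mul_add, hF, hF']
  | tmul q h =>
    simp [DualCop.mul_apply, Algebra.TensorProduct.one_def, mul_assoc, mul_left_comm]

lemma counit_mulH (a : H) (F : DualCop k H ⊗[k] H) :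
    counit (R := k) (mulH k H a F) = counit (R := k) a * counit (R := k) F := by
  induction F using TensorProduct.induction_on with
  | zero => simp
  | add F F' hF hF' => simp only [map_add, mul_add, hF, hF']
  | tmul q h =>
    have h1 : counit (R := k) (A := DualCop k H ⊗[k] H) ∘ₗ (actT k H).flip (q ⊗ₜ h) =
        (counit (R := k) h) • ((DualCop.toDual k H q) ∘ₗ LinearMap.mul' k H ∘ₗ
          (antipodeInv k H).rTensor H ∘ₗ
          (TensorProduct.comm k H H).toLinearMap ∘ₗ ((TensorProduct.lid k H).toLinearMap ∘ₗ
            (counit (R := k) (A := H)).rTensor H).lTensor H) := by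
      ext a b c
      simp [mul_comm, mul_left_comm, mul_assoc]
    have h2 : ((TensorProduct.lid k H).toLinearMap ∘ₗ (counit (R := k) (A := H)).rTensor H) ∘ₗ
          comul = .id := by
      ext b
      simp
    have h3 : (((TensorProduct.lid k H).toLinearMap ∘ₗ
            (counit (R := k) (A := H)).rTensor H).lTensor H) (comul₃ k H a) = comul a := by
      rw [comul₃, ← LinearMap.comp_apply, ← LinearMap.comp_assoc, ← LinearMap.lTensor_comp, h2,
        LinearMap.lTensor_id, LinearMap.id_comp]
    have e1 := LinearMap.congr_fun h1 (comul₃ k H a)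
    refine e1.trans ?_
    simp only [LinearMap.comp_apply, LinearMap.smul_apply, LinearEquiv.coe_coe, h3,
      antipodeInv_mul_comul]
    simp [Algebra.algebraMap_eq_smul_one, mul_comm, mul_left_comm]

lemma counit_mulMap (F G : DualCop k H ⊗[k] H) :
    counit (R := k) (mulMap k H F G) = counit (R := k) F * counit (R := k) G := by
  induction F using TensorProduct.induction_on with
  | zero => simp
  | add F F' hF hF' => simp only [map_add, add_mul, LinearMap.add_apply, hF, hF']
  | tmul p a => simp [counit_mulDual, counit_mulH, mul_comm, mul_left_comm, mul_assoc]

lemma comul_mulMap (F G : DualCop k H ⊗[k] H) : comul (R := k) (mulMap k H F G) =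
    TensorProduct.homTensorHomMap (.id k) _ _ _ _
      (TensorProduct.map (mulMap k H) (mulMap k H) (comul (R := k) F)) (comul (R := k) G) := by
  induction F using TensorProduct.induction_on with
  | zero => simp
  | add F F' hF hF' => simp only [map_add, LinearMap.add_apply, hF, hF']
  | tmul p a =>
    rw [mulMap_tmul, comul_mulDual, comul_mulH, TensorProduct.comul_tmul]
    generalize comul (R := k) G = W
    generalize comul (R := k) p = s
    generalize comul (R := k) a = t
    induction s using TensorProduct.induction_on with
    | zero => simp
    | add s s' hs hs' =>
      simp only [map_add, TensorProduct.add_tmul, LinearMap.add_apply, hs, hs']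
    | tmul p' p'' =>
      induction t using TensorProduct.induction_on with
      | zero => simp
      | add s s' hs hs' =>
        simp only [map_add, TensorProduct.tmul_add, LinearMap.add_apply, hs, hs']
      | tmul a' a'' =>
        induction W using TensorProduct.induction_on with
        | zero => simp
        | add s s' hs hs' => simp only [map_add, hs, hs']
        | tmul U V => rfl

variable (k H)

/-- The map `p ↦ p ∘ S⁻¹` on `H^*`. -/
def dualAntipodeInv : DualCop k H →ₗ[k] DualCop k H :=
  (DualCop.toDual k H).symm.toLinearMap ∘ₗ (antipodeInv k H).dualMap ∘ₗ
    (DualCop.toDual k H).toLinearMap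

/-- The antipode `p ⊗ a ↦ S(a) · (p ∘ S⁻¹ ⊗ 1)` of the Drinfel'd double. -/
def antipodeMap : DualCop k H ⊗[k] H →ₗ[k] DualCop k H ⊗[k] H :=
  TensorProduct.lift ((mulH k H).compl₁₂ (antipode k)
    ((TensorProduct.mk k (DualCop k H) H).flip 1 ∘ₗ dualAntipodeInv k H)).flip

variable {k H}

@[simp] lemma dualAntipodeInv_apply (p : DualCop k H) (y : H) :
    dualAntipodeInv k H p y = p (antipodeInv k H y) := rfl

@[simp] lemma antipodeMap_tmul (p : DualCop k H) (a : H) : antipodeMap k H (p ⊗ₜ a) =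
    mulH k H (antipode k a) (dualAntipodeInv k H p ⊗ₜ 1) := rfl

lemma mul_dualAntipodeInv_left (p : DualCop k H) : LinearMap.mul' k (DualCop k H)
    ((dualAntipodeInv k H).rTensor _ (comul (R := k) p)) = p 1 • 1 := by
  ext y
  have h : ∀ s, LinearMap.mul' k (DualCop k H) ((dualAntipodeInv k H).rTensor _ s) y =
      DualCop.ev₂ k H s ((antipodeInv k H).rTensor _ (comul (R := k) y)) := by
    intro s
    induction s using TensorProduct.induction_on with
    | zero => simp
    | add s s' hs hs' => simp only [map_add, LinearMap.add_apply, DualCop.add_apply, hs, hs']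
    | tmul p q =>
      simp only [LinearMap.rTensor_tmul, LinearMap.mul'_apply, DualCop.mul_apply]
      generalize comul (R := k) y = t
      induction t using TensorProduct.induction_on with
      | zero => simp
      | add s s' hs hs' => simp only [map_add, hs, hs']
      | tmul a b => simp
  have h' : ∀ t, DualCop.ev₂ k H (comul (R := k) p) ((antipodeInv k H).rTensor _ t) =
      p (LinearMap.mul' k H ((antipodeInv k H).lTensor H (TensorProduct.comm k H H t))) := by
    intro t
    induction t using TensorProduct.induction_on with
    | zero => simp
    | add s s' hs hs' => simp only [map_add, DualCop.map_add', hs, hs']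
    | tmul a b => simp
  rw [h, h', mul_antipodeInv_comul]
  simp [Algebra.algebraMap_eq_smul_one, mul_comm]

lemma mul_dualAntipodeInv_right (p : DualCop k H) : LinearMap.mul' k (DualCop k H)
    ((dualAntipodeInv k H).lTensor _ (comul (R := k) p)) = p 1 • 1 := by
  ext y
  have h : ∀ s, LinearMap.mul' k (DualCop k H) ((dualAntipodeInv k H).lTensor _ s) y =
      DualCop.ev₂ k H s ((antipodeInv k H).lTensor _ (comul (R := k) y)) := by
    intro s
    induction s using TensorProduct.induction_on with
    | zero => simp
    | add s s' hs hs' => simp only [map_add, LinearMap.add_apply, DualCop.add_apply, hs, hs']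
    | tmul p q =>
      simp only [LinearMap.lTensor_tmul, LinearMap.mul'_apply, DualCop.mul_apply]
      generalize comul (R := k) y = t
      induction t using TensorProduct.induction_on with
      | zero => simp
      | add s s' hs hs' => simp only [map_add, hs, hs']
      | tmul a b => simp
  have h' : ∀ t, DualCop.ev₂ k H (comul (R := k) p) ((antipodeInv k H).lTensor _ t) =
      p (LinearMap.mul' k H ((antipodeInv k H).rTensor H (TensorProduct.comm k H H t))) := by
    intro t
    induction t using TensorProduct.induction_on with
    | zero => simp
    | add s s' hs hs' => simp only [map_add, DualCop.map_add', hs, hs']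
    | tmul a b => simp
  rw [h, h', antipodeInv_mul_comul]
  simp [Algebra.algebraMap_eq_smul_one, mul_comm]

lemma antipodeMap_mul_comul (F : DualCop k H ⊗[k] H) :
    TensorProduct.lift (mulMap k H) ((antipodeMap k H).rTensor _ (comul (R := k) F)) =
      counit (R := k) F • (1 ⊗ₜ 1) := by
  induction F using TensorProduct.induction_on with
  | zero => simp
  | add F F' hF hF' => simp only [map_add, add_smul, hF, hF']
  | tmul p a =>
    have h : ∀ s t, TensorProduct.lift (mulMap k H) ((antipodeMap k H).rTensor _
        (TensorProduct.tensorTensorTensorComm k _ _ _ _ (s ⊗ₜ[k] t))) = TensorProduct.lift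
          ((mulH k H).compl₁₂ .id (TensorProduct.mk k (DualCop k H) H
            (LinearMap.mul' k (DualCop k H) ((dualAntipodeInv k H).rTensor _ s))))
          ((antipode k).rTensor H t) := by
      intro s t
      induction t using TensorProduct.induction_on with
      | zero => simp
      | add s s' hs hs' => simp only [map_add, TensorProduct.tmul_add, hs, hs']
      | tmul a b =>
        induction s using TensorProduct.induction_on with
        | zero => simp
        | add s s' hs hs' =>
          simp only [map_add, TensorProduct.add_tmul, hs, hs']
          simp [TensorProduct.add_tmul]
        | tmul p' p'' => simp [mulMap_mulH]
    rw [TensorProduct.comul_tmul]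
    refine (h _ _).trans ?_
    rw [mul_dualAntipodeInv_left]
    have h' : ∀ t, TensorProduct.lift ((mulH k H).compl₁₂ .id (TensorProduct.mk k (DualCop k H) H
        (p 1 • 1))) t = p 1 • mulH k H (LinearMap.mul' k H t) (1 ⊗ₜ 1) := by
      intro t
      induction t using TensorProduct.induction_on with
      | zero => simp
      | add s s' hs hs' => simp only [map_add, LinearMap.add_apply, smul_add, hs, hs']
      | tmul a b =>
        simp only [TensorProduct.lift.tmul, LinearMap.compl₁₂_apply, LinearMap.id_apply,
          TensorProduct.mk_apply, LinearMap.mul'_apply]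
        rw [← TensorProduct.smul_tmul', map_smul, ← mulH_one_tmul_one b, ← mulH_mul]
    rw [h', mul_antipode_rTensor_comul_apply]
    simp [Algebra.algebraMap_eq_smul_one, smul_smul, mul_comm]

lemma mul_antipodeMap_comul (F : DualCop k H ⊗[k] H) :
    TensorProduct.lift (mulMap k H) ((antipodeMap k H).lTensor _ (comul (R := k) F)) =
      counit (R := k) F • (1 ⊗ₜ 1) := by
  induction F using TensorProduct.induction_on with
  | zero => simp
  | add F F' hF hF' => simp only [map_add, add_smul, hF, hF']
  | tmul p a =>
    have h : ∀ s t, TensorProduct.lift (mulMap k H) ((antipodeMap k H).lTensor _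
        (TensorProduct.tensorTensorTensorComm k _ _ _ _ (s ⊗ₜ[k] t))) = TensorProduct.lift
          ((mulDual k H).compl₁₂ .id (mulH k H (LinearMap.mul' k H ((antipode k).lTensor H t)) ∘ₗ
            (TensorProduct.mk k (DualCop k H) H).flip 1 ∘ₗ dualAntipodeInv k H)) s := by
      intro s t
      induction s using TensorProduct.induction_on with
      | zero => simp
      | add s s' hs hs' => simp only [map_add, TensorProduct.add_tmul, hs, hs']
      | tmul p' p'' =>
        induction t using TensorProduct.induction_on with
        | zero => simp
        | add s s' hs hs' =>
          simp only [TensorProduct.tmul_add, map_add, hs, hs']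
          simp
        | tmul a b => simp [mulH_mul]
    rw [TensorProduct.comul_tmul]
    refine (h _ _).trans ?_
    rw [mul_antipode_lTensor_comul_apply]
    have h' : ∀ t, TensorProduct.lift ((mulDual k H).compl₁₂ .id
        (mulH k H (algebraMap k H (counit (R := k) a)) ∘ₗ
          (TensorProduct.mk k (DualCop k H) H).flip 1 ∘ₗ dualAntipodeInv k H)) t =
        counit (R := k) a • (LinearMap.mul' k _ ((dualAntipodeInv k H).lTensor _ t)) ⊗ₜ[k] 1 := by
      intro t
      induction t using TensorProduct.induction_on with
      | zero => simp
      | add s s' hs hs' => simp only [map_add, TensorProduct.add_tmul, smul_add, hs, hs']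
      | tmul a b => simp [Algebra.algebraMap_eq_smul_one]
    rw [h', mul_dualAntipodeInv_right]
    simp [← TensorProduct.smul_tmul', smul_smul, mul_comm]

end DrinfeldDouble

/-- The Drinfel'd double `D(H) = (H^*)^cop ⋈ H` of a finite-dimensional Hopf algebra `H`: the
coalgebra `(H^*)^cop ⊗ H` with the product
`(p ⊗ a) (q ⊗ b) = ∑ p q(S⁻¹(a₃) ? a₁) ⊗ a₂ b`. -/
def DrinfeldDouble (k : Type u) (H : Type v) [Field k] [Ring H] [HopfAlgebra k H] :
    Type (max u v) :=
  DualCop k H ⊗[k] H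

namespace DrinfeldDouble

variable (k : Type u) (H : Type v) [Field k] [Ring H] [HopfAlgebra k H] [BijectiveAntipode k H]
  [Module.Finite k H]

instance instAddCommGroup : AddCommGroup (DrinfeldDouble k H) :=
  inferInstanceAs (AddCommGroup (DualCop k H ⊗[k] H))

instance instRing : Ring (DrinfeldDouble k H) where
  __ := instAddCommGroup k H
  mul F G := mulMap k H F G
  one := (1 ⊗ₜ 1 : DualCop k H ⊗[k] H)
  left_distrib F G K := map_add (mulMap k H F) G K
  right_distrib F G K := LinearMap.congr_fun (map_add (mulMap k H) F G) K
  zero_mul F := LinearMap.congr_fun (map_zero (mulMap k H)) F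
  mul_zero F := map_zero (mulMap k H F)
  mul_assoc F G K := mulMap_assoc F G K
  one_mul F := one_mulMap F
  mul_one F := mulMap_one F

instance instModule : Module k (DrinfeldDouble k H) :=
  inferInstanceAs (Module k (DualCop k H ⊗[k] H))

instance instAlgebra : Algebra k (DrinfeldDouble k H) :=
  Algebra.ofModule (fun c F G => LinearMap.congr_fun (map_smul (mulMap k H) c F) G)
    (fun c F G => map_smul (mulMap k H F) c G)

instance instCoalgebra : Coalgebra k (DrinfeldDouble k H) :=
  inferInstanceAs (Coalgebra k (DualCop k H ⊗[k] H))

lemma mul_def (F G : DrinfeldDouble k H) : F * G = mulMap k H F G := rfl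

lemma tensor_mul_eq (s t : DrinfeldDouble k H ⊗[k] DrinfeldDouble k H) :
    s * t = TensorProduct.homTensorHomMap (.id k) _ _ _ _
      (TensorProduct.map (LinearMap.mul k (DrinfeldDouble k H))
        (LinearMap.mul k (DrinfeldDouble k H)) s) t := by
  induction s using TensorProduct.induction_on with
  | zero => simp
  | add s s' hs hs' => simp only [map_add, add_mul, LinearMap.add_apply, hs, hs']
  | tmul a b =>
    induction t using TensorProduct.induction_on with
    | zero => simp
    | add s s' hs hs' => simp only [map_add, mul_add, hs, hs']
    | tmul c d => simp

instance instBialgebra : Bialgebra k (DrinfeldDouble k H) :=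
  Bialgebra.mk' k (DrinfeldDouble k H)
    (by
      change counit (R := k) (A := DualCop k H ⊗[k] H) (1 ⊗ₜ 1) = 1
      simp)
    (fun {F G} => counit_mulMap F G)
    (by
      change comul (R := k) (A := DualCop k H ⊗[k] H) (1 ⊗ₜ 1) = (1 ⊗ₜ 1) ⊗ₜ (1 ⊗ₜ 1)
      rw [TensorProduct.comul_tmul, DualCop.comul_one, Bialgebra.comul_one]
      rfl)
    (fun {F G} => (comul_mulMap F G).trans (tensor_mul_eq k H _ _).symm)

instance instHopfAlgebra : HopfAlgebra k (DrinfeldDouble k H) where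
  antipode := antipodeMap k H
  mul_antipode_rTensor_comul := LinearMap.ext fun F => antipodeMap_mul_comul F
  mul_antipode_lTensor_comul := LinearMap.ext fun F => mul_antipodeMap_comul F

end DrinfeldDouble

end double

/-! ### The antipode of Sweedler's Hopf algebra is bijective -/

namespace H4

lemma antipode_antipode (k : Type u) [Field k] (a : H4 k) :
    HopfAlgebra.antipode k (HopfAlgebra.antipode k (HopfAlgebra.antipode k
      (HopfAlgebra.antipode k a))) = a := by
  have ha : a ∈ Algebra.adjoin k ({g k, x k} : Set (H4 k)) := by rw [adjoin_eq_top]; trivial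
  induction ha using Algebra.adjoin_induction with
  | mem a ha =>
    rcases ha with rfl | rfl
    · simp
    · have h : HopfAlgebra.antipode k (g k * x k) = x k := by
        rw [HopfAlgebra.antipode_mul_antidistrib, antipode_g, antipode_x, neg_mul, mul_assoc,
          x_mul_g, mul_neg, neg_neg, ← mul_assoc, g_mul_g, one_mul]
      simp [h]
  | algebraMap r => simp [Algebra.algebraMap_eq_smul_one]
  | add a b _ _ ha hb => simp only [map_add, ha, hb]
  | mul a b _ _ ha hb => simp only [HopfAlgebra.antipode_mul_antidistrib, ha, hb]

instance instBijectiveAntipode (k : Type u) [Field k] :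
    HopfAlgebra.BijectiveAntipode k (H4 k) where
  bijective := by
    refine ⟨fun a b h => ?_, fun a => ⟨_, antipode_antipode k a⟩⟩
    rw [← antipode_antipode k a, h, antipode_antipode]

end H4

/-! ### Factorizations, pointed and unimodular Hopf algebras -/

/-- A Hopf algebra `E` factorizes through `A` and `H` if there are injective morphisms of Hopf
algebras `i : A → E` and `j : H → E` such that `A ⊗ H → E`, `a ⊗ h ↦ i(a) j(h)`, is bijective. -/
def Factorizes (k : Type u) (A : Type v) (H : Type v) (E : Type w) [Field k] [Ring A]
    [HopfAlgebra k A] [Ring H] [HopfAlgebra k H] [Ring E] [HopfAlgebra k E] : Prop :=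
  ∃ (i : A →ₐc[k] E) (j : H →ₐc[k] E), Function.Injective i ∧ Function.Injective j ∧
    Function.Bijective (LinearMap.mul' k E ∘ₗ
      TensorProduct.map (i : A →ₗ[k] E) (j : H →ₗ[k] E))

/-- A subspace `D` of a coalgebra is a subcoalgebra if `Δ(D) ⊆ D ⊗ D`. -/
def IsSubcoalgebra (k : Type u) {C : Type v} [Field k] [AddCommGroup C] [Module k C]
    [Coalgebra k C] (D : Submodule k C) : Prop :=
  ∀ d ∈ D, Coalgebra.comul (R := k) d ∈ LinearMap.range (TensorProduct.map D.subtype D.subtype)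

/-- A subcoalgebra is simple if it is nonzero and has no subcoalgebras except `0` and itself. -/
def IsSimpleSubcoalgebra (k : Type u) {C : Type v} [Field k] [AddCommGroup C] [Module k C]
    [Coalgebra k C] (D : Submodule k C) : Prop :=
  IsSubcoalgebra k D ∧ D ≠ ⊥ ∧ ∀ D' : Submodule k C, IsSubcoalgebra k D' → D' ≤ D →
    D' = ⊥ ∨ D' = D

/-- A coalgebra is pointed if all its simple subcoalgebras are one-dimensional. -/
def IsPointed (k : Type u) (C : Type v) [Field k] [AddCommGroup C] [Module k C]
    [Coalgebra k C] : Prop :=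
  ∀ D : Submodule k C, IsSimpleSubcoalgebra k D → Module.finrank k D = 1

/-- The space of left integrals in `H`: `h t = ε(h) t` for all `h`. -/
def leftIntegrals (k : Type u) (H : Type v) [Field k] [Ring H] [HopfAlgebra k H] :
    Submodule k H where
  carrier := {t | ∀ h : H, h * t = Coalgebra.counit (R := k) h • t}
  add_mem' ha hb h := by rw [mul_add, ha h, hb h, smul_add]
  zero_mem' h := by simp
  smul_mem' c a ha h := by rw [mul_smul_comm, ha h, smul_comm]

/-- The space of right integrals in `H`: `t h = ε(h) t` for all `h`. -/
def rightIntegrals (k : Type u) (H : Type v) [Field k] [Ring H] [HopfAlgebra k H] :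
    Submodule k H where
  carrier := {t | ∀ h : H, t * h = Coalgebra.counit (R := k) h • t}
  add_mem' ha hb h := by rw [add_mul, ha h, hb h, smul_add]
  zero_mem' h := by simp
  smul_mem' c a ha h := by rw [smul_mul_assoc, ha h, smul_comm]

/-- A finite-dimensional Hopf algebra is unimodular if its left and right integrals coincide. -/
def IsUnimodular (k : Type u) (H : Type v) [Field k] [Ring H] [HopfAlgebra k H] : Prop :=
  leftIntegrals k H = rightIntegrals k H

end

/-! Let Φ be the map a ⊗ h ↦ i(a) j(h), and write g, x and G, X for the images of the generators
under i and j. Multiplication of a bialgebra is a coalgebra map, so a factorization amounts to Φ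
being an isomorphism of coalgebras. Thus E has the coalgebra structure of H4 ⊗ H4, and only the
commutation between the two factors is unknown. It is pinned down by elements that the coalgebra
controls. The group-likes are 1, g, G, gG, whence Gg = gG. In characteristic ≠ 2, a nonzero
skew-primitive element anticommuting with its group-like is a multiple of x or of X
(`H4.eq_or_eq_of_comul_eq`).

Hence conjugation by g multiplies X by a sign α, and conjugation by G multiplies x by a sign α'. The
element xX - αXx is skew-primitive for gG up to a term (1 - αα') xG ⊗ X. The coalgebra excludes this
term, so α' = α and xX - αXx = β(1 - gG). If α = 1, conjugation by g forces β = 0 and the factors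
commute; if α = -1, these are the defining relations of `H16` with parameter β
(`H4.relations_of_bijective`).

Conversely, the presentation of `H16` must be shown not to collapse. The modules induced from the
trivial module of one factor provide linear extensions P, Q of the two projections of H4 ⊗ H4, and
(P ⊗ Q)Δ is then a left inverse of Φ (`BialgHom.mulMap_injective`, `H16.mulMap_bijective`). So the
classification of skew-primitives applies to `H16` too: an isomorphism matches the pairs (g, x), (G,
X) up to order and scalars. Commutation of g with X and the vanishing of xX + Xx then separate the
three algebras, while rescaling X turns any nonzero parameter into 1.

An explicit integral spans the left integrals. It is also a right integral, and its counit vanishes,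
which gives unimodularity and excludes semisimplicity. Pointedness depends only on the coalgebra H4
⊗ H4. For the double, the dual of H4 is again generated by a group-like χ and a skew-primitive ξ;
the cross relation in the double is the one with parameter 1, and a surjection between spaces of
dimension 16 is bijective. -/

open scoped Matrix

noncomputable section

/-! ### The projections of a tensor product of coalgebras -/

section projections

open Coalgebra (comul counit)

variable {k : Type u} [Field k] {A : Type v} {H : Type w}
  [AddCommGroup A] [Module k A] [Coalgebra k A] [AddCommGroup H] [Module k H] [Coalgebra k H]

variable (k A H) in
/-- The coalgebra map `a ⊗ h ↦ ε(h) a`. -/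
def TensorProduct.projLeft : A ⊗[k] H →ₗc[k] A :=
  (Coalgebra.TensorProduct.rid k k A : A ⊗[k] k →ₗc[k] A).comp
    (Coalgebra.TensorProduct.map (CoalgHom.id k A) (Coalgebra.counitCoalgHom k H))

variable (k A H) in
/-- The coalgebra map `a ⊗ h ↦ ε(a) h`. -/
def TensorProduct.projRight : A ⊗[k] H →ₗc[k] H :=
  (Coalgebra.TensorProduct.lid k H : k ⊗[k] H →ₗc[k] H).comp
    (Coalgebra.TensorProduct.map (Coalgebra.counitCoalgHom k A) (CoalgHom.id k H))

@[simp] lemma TensorProduct.projLeft_tmul (a : A) (h : H) :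
    projLeft k A H (a ⊗ₜ h) = counit (R := k) h • a := rfl

@[simp] lemma TensorProduct.projRight_tmul (a : A) (h : H) :
    projRight k A H (a ⊗ₜ h) = counit (R := k) a • h := rfl

/-- An element `t` of `A ⊗ H` is the image of `Δ(t)` under the two projections. -/
lemma TensorProduct.map_projLeft_projRight_comul (t : A ⊗[k] H) :
    TensorProduct.map (projLeft k A H : A ⊗[k] H →ₗ[k] A) (projRight k A H : A ⊗[k] H →ₗ[k] H)
      (comul (R := k) t) = t := by
  induction t using TensorProduct.induction_on with
  | zero => simp
  | add s t hs ht => simp only [map_add, hs, ht]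
  | tmul a h =>
    -- The middle swap pairs a₁ with h₁ and a₂ with h₂, so the projections leave a₁ ε(a₂) ⊗ ε(h₁)
    -- h₂. Arbitrary tensors replace Δ(a) and Δ(h) so that linearity can be used.
    have key : ∀ (s : A ⊗[k] A) (t : H ⊗[k] H),
        TensorProduct.map (projLeft k A H : A ⊗[k] H →ₗ[k] A)
          (projRight k A H : A ⊗[k] H →ₗ[k] H)
          (TensorProduct.tensorTensorTensorComm k A A H H (s ⊗ₜ t)) =
        TensorProduct.rid k A ((counit (R := k) (A := A)).lTensor A s) ⊗ₜ
          TensorProduct.lid k H ((counit (R := k) (A := H)).rTensor H t) := by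
      intro s t
      induction s using TensorProduct.induction_on with
      | zero => simp
      | add s s' hs hs' => simp only [map_add, TensorProduct.add_tmul, hs, hs']
      | tmul a b =>
        induction t using TensorProduct.induction_on with
        | zero => simp
        | add s s' hs hs' => simp only [map_add, TensorProduct.tmul_add, hs, hs']
        | tmul c d => simp [TensorProduct.smul_tmul, TensorProduct.tmul_smul, smul_smul, mul_comm]
    rw [TensorProduct.comul_tmul]
    refine (key _ _).trans ?_
    simp

/-- An element `t` of `A ⊗ H` is the image of `Δ(t)` under the two projections, in the opposite
order. -/
lemma TensorProduct.comm_map_projRight_projLeft_comul (t : A ⊗[k] H) :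
    TensorProduct.comm k H A (TensorProduct.map (projRight k A H : A ⊗[k] H →ₗ[k] H)
      (projLeft k A H : A ⊗[k] H →ₗ[k] A) (comul (R := k) t)) = t := by
  induction t using TensorProduct.induction_on with
  | zero => simp
  | add s t hs ht => simp only [map_add, hs, ht]
  | tmul a h =>
    have key : ∀ (s : A ⊗[k] A) (t : H ⊗[k] H), TensorProduct.comm k H A
        (TensorProduct.map (projRight k A H : A ⊗[k] H →ₗ[k] H)
          (projLeft k A H : A ⊗[k] H →ₗ[k] A)
          (TensorProduct.tensorTensorTensorComm k A A H H (s ⊗ₜ t))) =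
        TensorProduct.lid k A ((counit (R := k) (A := A)).rTensor A s) ⊗ₜ
          TensorProduct.rid k H ((counit (R := k) (A := H)).lTensor H t) := by
      intro s t
      induction s using TensorProduct.induction_on with
      | zero => simp
      | add s s' hs hs' => simp only [map_add, TensorProduct.add_tmul, hs, hs']
      | tmul a b =>
        induction t using TensorProduct.induction_on with
        | zero => simp
        | add s s' hs hs' => simp only [map_add, TensorProduct.tmul_add, hs, hs']
        | tmul c d => simp [TensorProduct.smul_tmul, TensorProduct.tmul_smul, smul_smul, mul_comm]
    rw [TensorProduct.comul_tmul]
    refine (key _ _).trans ?_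
    simp

end projections

/-! ### The product map of a pair of bialgebra maps -/

section factorization

open Coalgebra (comul counit)
open TensorProduct (projLeft projRight map_projLeft_projRight_comul
  comm_map_projRight_projLeft_comul)

variable {k : Type u} [Field k] {A H : Type v} {E : Type w} [Ring A] [HopfAlgebra k A]
  [Ring H] [HopfAlgebra k H] [Ring E] [HopfAlgebra k E] (i : A →ₐc[k] E) (j : H →ₐc[k] E)

/-- The coalgebra map `a ⊗ h ↦ i(a) j(h)`. -/
def BialgHom.mulMap : A ⊗[k] H →ₗc[k] E :=
  (Bialgebra.mulCoalgHom k E).comp (Coalgebra.TensorProduct.map (i : A →ₗc[k] E) (j : H →ₗc[k] E))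

@[simp] lemma BialgHom.mulMap_tmul (a : A) (h : H) : i.mulMap j (a ⊗ₜ h) = i a * j h := rfl

/-- Injectivity of i and j is automatic: restrict the product map to a ⊗ 1 or 1 ⊗ h, and recover a
or h by applying a counit. -/
lemma factorizes_of_bijective (h : Function.Bijective (i.mulMap j)) : Factorizes k A H E := by
  refine ⟨i, j, fun a b hab => ?_, fun a b hab => ?_, h⟩
  · have := h.1 (a₁ := a ⊗ₜ 1) (a₂ := b ⊗ₜ 1) (by simp [hab])
    simpa using congrArg (projLeft k A H) this
  · have := h.1 (a₁ := 1 ⊗ₜ a) (a₂ := 1 ⊗ₜ b) (by simp [hab])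
    simpa using congrArg (projRight k A H) this

lemma factorizes_iff : Factorizes k A H E ↔
    ∃ (i : A →ₐc[k] E) (j : H →ₐc[k] E), Function.Bijective (i.mulMap j) :=
  ⟨fun ⟨i, j, _, _, h⟩ => ⟨i, j, h⟩, fun ⟨i, j, h⟩ => factorizes_of_bijective i j h⟩

lemma Factorizes.of_equiv {E' : Type*} [Ring E'] [HopfAlgebra k E'] (e : E ≃ₐc[k] E')
    (h : Factorizes k A H E') : Factorizes k A H E := by
  obtain ⟨i, j, h⟩ := factorizes_iff.1 h
  refine factorizes_of_bijective ((e.symm : E' →ₐc[k] E).comp i) ((e.symm : E' →ₐc[k] E).comp j) ?_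
  have : ⇑(((e.symm : E' →ₐc[k] E).comp i).mulMap ((e.symm : E' →ₐc[k] E).comp j)) =
      e.symm ∘ i.mulMap j := by
    ext t
    induction t using TensorProduct.induction_on with
    | zero => simp
    | add s t hs ht => simp only [map_add, hs, ht, Function.comp_apply]
    | tmul a b => simp
  rw [this]
  exact e.symm.bijective.comp h

/-- The product map is injective if the two projections extend to `E`. -/
lemma BialgHom.mulMap_injective (P : E →ₗ[k] A) (Q : E →ₗ[k] H)
    (hP : ∀ a h, P (i a * j h) = counit (R := k) h • a)
    (hQ : ∀ a h, Q (i a * j h) = counit (R := k) a • h) : Function.Injective (i.mulMap j) := by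
  have hP' : P ∘ₗ (i.mulMap j : A ⊗[k] H →ₗ[k] E) = (projLeft k A H : A ⊗[k] H →ₗ[k] A) := by
    ext a h; simp [hP]
  have hQ' : Q ∘ₗ (i.mulMap j : A ⊗[k] H →ₗ[k] E) = (projRight k A H : A ⊗[k] H →ₗ[k] H) := by
    ext a h; simp [hQ]
  -- The left inverse is (P ⊗ Q)Δ. The product map commutes with Δ, so this composite can be
  -- computed in A ⊗ H, where P and Q become the two projections. Only linearity of P and Q is
  -- needed.
  refine Function.LeftInverse.injective (g := fun e => TensorProduct.map P Q (comul (R := k) e))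
    fun t => ?_
  have := map_projLeft_projRight_comul t
  rw [← hP', ← hQ', TensorProduct.map_comp, LinearMap.comp_apply] at this
  change TensorProduct.map P Q (comul (R := k) (i.mulMap j t)) = t
  rw [← CoalgHomClass.map_comp_comul_apply]
  exact this

end factorization

/-! ### A basis of Sweedler's Hopf algebra -/

namespace H4

open Coalgebra (comul counit)

variable (k : Type u) [Field k]

/-- The regular representation of `H4 k` in the coordinates given by `1, g, x, g x`. -/
def rep : H4 k →ₐ[k] Matrix (Fin 4) (Fin 4) k :=
  lift !![0, 1, 0, 0; 1, 0, 0, 0; 0, 0, 0, 1; 0, 0, 1, 0]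
    !![0, 0, 0, 0; 0, 0, 0, 0; 1, 0, 0, 0; 0, -1, 0, 0]
    (by ext i j; fin_cases i <;> fin_cases j <;> simp [Matrix.mul_apply, Fin.sum_univ_four])
    (by ext i j; fin_cases i <;> fin_cases j <;> simp [Matrix.mul_apply, Fin.sum_univ_four])
    (by ext i j; fin_cases i <;> fin_cases j <;> simp [Matrix.mul_apply, Fin.sum_univ_four])

/-- The element of `H4 k` with given coordinates. -/
def ofCoords : (Fin 4 → k) →ₗ[k] H4 k :=
  Fintype.linearCombination k ![1, g k, x k, g k * x k]

variable {k}

lemma ofCoords_apply (v : Fin 4 → k) :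
    ofCoords k v = v 0 • 1 + v 1 • g k + v 2 • x k + v 3 • (g k * x k) := by
  simp [ofCoords, Fintype.linearCombination_apply, Fin.sum_univ_four]

/-- Both sides are multiplicative in a, so generators suffice. Applied to the coordinate vector of
1, this says that 1, g, x, gx span; the same vector gives the coordinate map, which proves
independence. -/
lemma mul_ofCoords (a : H4 k) (v : Fin 4 → k) : a * ofCoords k v = ofCoords k (rep k a *ᵥ v) := by
  have ha : a ∈ Algebra.adjoin k ({g k, x k} : Set (H4 k)) := by rw [adjoin_eq_top]; trivial
  induction ha using Algebra.adjoin_induction generalizing v with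
  | mem a ha =>
    rcases ha with rfl | rfl
    · simp [ofCoords_apply, rep, Matrix.mulVec, dotProduct, Fin.sum_univ_four, mul_add, g_mul_g,
        ← mul_assoc]
      abel
    · have : x k * (g k * x k) = 0 := by rw [← mul_assoc, x_mul_g, neg_mul, mul_assoc, x_mul_x]; simp
      simp [ofCoords_apply, rep, Matrix.mulVec, dotProduct, Fin.sum_univ_four, mul_add, this,
        x_mul_x, x_mul_g]
  | algebraMap r => simp [Algebra.algebraMap_eq_smul_one, Matrix.smul_mulVec]
  | add a b _ _ ha hb => simp only [add_mul, ha, hb, map_add, Matrix.add_mulVec]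
  | mul a b _ _ ha hb => rw [mul_assoc, hb, ha, map_mul, Matrix.mulVec_mulVec]

variable (k)

/-- The coordinates with respect to `1, g, x, g x`. -/
def coords : H4 k →ₗ[k] (Fin 4 → k) where
  toFun a := rep k a *ᵥ Pi.single 0 1
  map_add' a b := by rw [map_add, Matrix.add_mulVec]
  map_smul' c a := by rw [map_smul, Matrix.smul_mulVec]; rfl

variable {k}

@[simp] lemma ofCoords_coords (a : H4 k) : ofCoords k (coords k a) = a := by
  refine (mul_ofCoords a _).symm.trans ?_
  simp [ofCoords_apply]

lemma coords_one : coords k 1 = ![1, 0, 0, 0] := by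
  ext i; fin_cases i <;> simp [coords]

lemma coords_g : coords k (g k) = ![0, 1, 0, 0] := by
  ext i; fin_cases i <;> simp [coords, rep]

lemma coords_x : coords k (x k) = ![0, 0, 1, 0] := by
  ext i; fin_cases i <;> simp [coords, rep]

lemma coords_g_mul_x : coords k (g k * x k) = ![0, 0, 0, 1] := by
  ext i; fin_cases i <;> simp [coords, rep, Matrix.mul_apply, Fin.sum_univ_four]

@[simp] lemma coords_ofCoords (v : Fin 4 → k) : coords k (ofCoords k v) = v := by
  rw [ofCoords_apply]
  ext i
  fin_cases i <;> simp [coords_one, coords_g, coords_x, coords_g_mul_x]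

variable (k)

/-- The basis `1, g, x, g x` of Sweedler's Hopf algebra. -/
def basis : Module.Basis (Fin 4) k (H4 k) :=
  .ofEquivFun (.ofLinearMap (coords k) (ofCoords k)
    (LinearMap.ext coords_ofCoords) (LinearMap.ext ofCoords_coords))

lemma finrank_eq : Module.finrank k (H4 k) = 4 := by
  rw [Module.finrank_eq_card_basis (basis k), Fintype.card_fin]

variable {k}

lemma exists_eq (a : H4 k) :
    ∃ c₀ c₁ c₂ c₃ : k, a = c₀ • 1 + c₁ • g k + c₂ • x k + c₃ • (g k * x k) :=
  ⟨_, _, _, _, (ofCoords_coords a).symm.trans (ofCoords_apply _)⟩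

lemma linearMap_ext {M : Type*} [AddCommGroup M] [Module k M] {f f' : H4 k →ₗ[k] M}
    (h₁ : f 1 = f' 1) (hg : f (g k) = f' (g k)) (hx : f (x k) = f' (x k))
    (hgx : f (g k * x k) = f' (g k * x k)) : f = f' := by
  ext a
  obtain ⟨c₀, c₁, c₂, c₃, rfl⟩ := exists_eq a
  simp only [map_add, map_smul, h₁, hg, hx, hgx]

lemma comul_g_mul_x : comul (R := k) (g k * x k) = (g k * x k) ⊗ₜ g k + 1 ⊗ₜ (g k * x k) := by
  rw [Bialgebra.comul_mul, comul_g, comul_x]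
  simp [mul_add, g_mul_g]

variable (k)

/-- The coefficient of the tensor of two basis vectors in an element of `H4 k ⊗ H4 k`. -/
def coeff₂ (p q : Fin 4) : H4 k ⊗[k] H4 k →ₗ[k] k :=
  LinearMap.mul' k k ∘ₗ TensorProduct.map (LinearMap.proj p ∘ₗ coords k) (LinearMap.proj q ∘ₗ coords k)

variable {k}

@[simp] lemma coeff₂_tmul (p q : Fin 4) (a b : H4 k) :
    coeff₂ k p q (a ⊗ₜ b) = coords k a p * coords k b q := rfl

lemma isGroupLikeElem_g : IsGroupLikeElem k (g k) := ⟨by simp, by simp⟩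

/-- The group-like elements of Sweedler's Hopf algebra are `1` and `g`. -/
lemma eq_one_or_eq_g {a : H4 k} (h : IsGroupLikeElem k a) : a = 1 ∨ a = g k := by
  obtain ⟨c₀, c₁, c₂, c₃, rfl⟩ := exists_eq a
  have h0 := h.counit_eq_one
  have h1 := h.comul_eq_tmul_self
  simp only [map_add, map_smul, Bialgebra.comul_one, Algebra.TensorProduct.one_def, comul_g,
    comul_x, comul_g_mul_x] at h1
  have key : ∀ p q : Fin 4, _ := fun p q => congrArg (coeff₂ k p q) h1
  simp only [map_add, map_smul, TensorProduct.tmul_add, TensorProduct.add_tmul,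
    TensorProduct.tmul_smul, ← TensorProduct.smul_tmul', coeff₂_tmul, coords_one, coords_g,
    coords_x, coords_g_mul_x] at key
  have k00 := key 0 0
  have k01 := key 0 1
  have k22 := key 2 2
  have k33 := key 3 3
  simp at k00 k01 k22 k33 h0
  subst k22 k33
  rcases k01 with rfl | rfl
  · left; rw [add_zero] at h0; simp [h0]
  · right; rw [zero_add] at h0; simp [h0]

/-- A primitive element of Sweedler's Hopf algebra is zero. -/
lemma eq_zero_of_comul {a : H4 k} (h : comul (R := k) a = a ⊗ₜ 1 + 1 ⊗ₜ a) : a = 0 := by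
  obtain ⟨c₀, c₁, c₂, c₃, rfl⟩ := exists_eq a
  simp only [map_add, map_smul, Bialgebra.comul_one, Algebra.TensorProduct.one_def, comul_g,
    comul_x, comul_g_mul_x] at h
  have key : ∀ p q : Fin 4, _ := fun p q => congrArg (coeff₂ k p q) h
  simp only [map_add, map_smul, TensorProduct.tmul_add, TensorProduct.add_tmul,
    TensorProduct.tmul_smul, ← TensorProduct.smul_tmul', coeff₂_tmul, coords_one, coords_g,
    coords_x, coords_g_mul_x] at key
  -- At 1 ⊗ 1 one gets c₀ = 2c₀; the other three tensors g ⊗ g, g ⊗ x, gx ⊗ g occur only on the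
  -- left-hand side. No assumption on the characteristic enters.
  have k00 := key 0 0
  have k11 := key 1 1
  have k12 := key 1 2
  have k31 := key 3 1
  simp at k00 k11 k12 k31
  simp [k00, k11, k12, k31]

/-- The `(1, g)`-primitive elements of Sweedler's Hopf algebra. -/
lemma eq_of_comul {a : H4 k} (h : comul (R := k) a = a ⊗ₜ 1 + g k ⊗ₜ a) :
    ∃ α β : k, a = α • x k + β • (1 - g k) := by
  obtain ⟨c₀, c₁, c₂, c₃, rfl⟩ := exists_eq a
  simp only [map_add, map_smul, Bialgebra.comul_one, Algebra.TensorProduct.one_def, comul_g,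
    comul_x, comul_g_mul_x] at h
  have key : ∀ p q : Fin 4, _ := fun p q => congrArg (coeff₂ k p q) h
  simp only [map_add, map_smul, TensorProduct.tmul_add, TensorProduct.add_tmul,
    TensorProduct.tmul_smul, ← TensorProduct.smul_tmul', coeff₂_tmul, coords_one, coords_g,
    coords_x, coords_g_mul_x] at key
  -- At g ⊗ 1 one reads 0 = c₁ + c₀, and at gx ⊗ g one reads c₃ = 0.
  have k10 := key 1 0
  have k31 := key 3 1
  simp at k10 k31
  refine ⟨c₂, c₀, ?_⟩
  rw [show c₁ = -c₀ by linear_combination -k10, k31]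
  simp only [smul_sub]
  module

end H4

end

noncomputable section

/-! ### The factorization of `H16 k l` -/

namespace H16

open Coalgebra (comul counit)

variable (k : Type u) [Field k] (l : k)

/-- The inclusion of `H4 k` with image generated by `g` and `x`. -/
def inclLeft : H4 k →ₐc[k] H16 k l :=
  .ofAlgHom (H4.lift (g k l) (x k l) (g_mul_g k l) (x_mul_x k l) (by rw [g_mul_x, neg_neg]))
    (H4.algHom_ext (by simp) (by simp)) (H4.algHom_ext (by simp) (by simp))

/-- The inclusion of `H4 k` with image generated by `G` and `X`. -/
def inclRight : H4 k →ₐc[k] H16 k l :=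
  .ofAlgHom (H4.lift (G k l) (X k l) (G_mul_G k l) (X_mul_X k l) (by rw [G_mul_X, neg_neg]))
    (H4.algHom_ext (by simp) (by simp)) (H4.algHom_ext (by simp) (by simp))

@[simp] lemma inclLeft_g : inclLeft k l (H4.g k) = g k l := H4.lift_g ..
@[simp] lemma inclLeft_x : inclLeft k l (H4.x k) = x k l := H4.lift_x ..
@[simp] lemma inclRight_g : inclRight k l (H4.g k) = G k l := H4.lift_g ..
@[simp] lemma inclRight_x : inclRight k l (H4.x k) = X k l := H4.lift_x ..

set_option maxHeartbeats 1000000 in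
/-- The left module `H16 k l ⊗ k` induced from the trivial module of the right factor, in the
coordinates given by `1, g, x, g x`. -/
def repLeft : H16 k l →ₐ[k] Matrix (Fin 4) (Fin 4) k :=
  lift !![0, 1, 0, 0; 1, 0, 0, 0; 0, 0, 0, 1; 0, 0, 1, 0]
    !![0, 0, 0, 0; 0, 0, 0, 0; 1, 0, 0, 0; 0, -1, 0, 0]
    !![1, 0, 0, 0; 0, 1, 0, 0; 0, 0, -1, 0; 0, 0, 0, -1]
    -- X kills 1 and g. On x and gx it acts through Xx = l(1 - Gg) - xX, with G and X replaced by
    -- their counits, which gives l(1 - g) in both cases.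
    !![0, 0, l, l; 0, 0, -l, -l; 0, 0, 0, 0; 0, 0, 0, 0]
    (by ext i j; fin_cases i <;> fin_cases j <;> simp [Matrix.mul_apply, Fin.sum_univ_four])
    (by ext i j; fin_cases i <;> fin_cases j <;> simp [Matrix.mul_apply, Fin.sum_univ_four])
    (by ext i j; fin_cases i <;> fin_cases j <;> simp [Matrix.mul_apply, Fin.sum_univ_four])
    (by ext i j; fin_cases i <;> fin_cases j <;> simp [Matrix.mul_apply, Fin.sum_univ_four])
    (by ext i j; fin_cases i <;> fin_cases j <;> simp [Matrix.mul_apply, Fin.sum_univ_four])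
    (by ext i j; fin_cases i <;> fin_cases j <;> simp [Matrix.mul_apply, Fin.sum_univ_four])
    (by ext i j; fin_cases i <;> fin_cases j <;> simp [Matrix.mul_apply, Fin.sum_univ_four])
    (by ext i j; fin_cases i <;> fin_cases j <;> simp [Matrix.mul_apply, Fin.sum_univ_four])
    (by ext i j; fin_cases i <;> fin_cases j <;> simp [Matrix.mul_apply, Fin.sum_univ_four])
    (by ext i j; fin_cases i <;> fin_cases j <;> simp [Matrix.mul_apply, Fin.sum_univ_four])

set_option maxHeartbeats 1000000 in
/-- The right module `k ⊗ H16 k l` induced from the trivial module of the left factor, in the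
coordinates given by `1, G, X, G X`; the matrices act on row vectors. -/
def repRight : H16 k l →ₐ[k] Matrix (Fin 4) (Fin 4) k :=
  lift !![1, 0, 0, 0; 0, 1, 0, 0; 0, 0, -1, 0; 0, 0, 0, -1]
    -- Mirror image of the left module: Xx becomes l(1 - G) and GXx becomes -l(1 - G) once g and x
    -- on the left are replaced by their counits.
    !![0, 0, 0, 0; 0, 0, 0, 0; l, -l, 0, 0; -l, l, 0, 0]
    !![0, 1, 0, 0; 1, 0, 0, 0; 0, 0, 0, -1; 0, 0, -1, 0]
    !![0, 0, 1, 0; 0, 0, 0, 1; 0, 0, 0, 0; 0, 0, 0, 0]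
    (by ext i j; fin_cases i <;> fin_cases j <;> simp [Matrix.mul_apply, Fin.sum_univ_four])
    (by ext i j; fin_cases i <;> fin_cases j <;> simp [Matrix.mul_apply, Fin.sum_univ_four])
    (by ext i j; fin_cases i <;> fin_cases j <;> simp [Matrix.mul_apply, Fin.sum_univ_four])
    (by ext i j; fin_cases i <;> fin_cases j <;> simp [Matrix.mul_apply, Fin.sum_univ_four])
    (by ext i j; fin_cases i <;> fin_cases j <;> simp [Matrix.mul_apply, Fin.sum_univ_four])
    (by ext i j; fin_cases i <;> fin_cases j <;> simp [Matrix.mul_apply, Fin.sum_univ_four])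
    (by ext i j; fin_cases i <;> fin_cases j <;> simp [Matrix.mul_apply, Fin.sum_univ_four])
    (by ext i j; fin_cases i <;> fin_cases j <;> simp [Matrix.mul_apply, Fin.sum_univ_four])
    (by ext i j; fin_cases i <;> fin_cases j <;> simp [Matrix.mul_apply, Fin.sum_univ_four])
    (by ext i j; fin_cases i <;> fin_cases j <;> simp [Matrix.mul_apply, Fin.sum_univ_four])

/-- The extension of `a ⊗ h ↦ ε(h) a` to `H16 k l`. -/
def projLeft : H16 k l →ₗ[k] H4 k :=
  H4.ofCoords k ∘ₗ (Matrix.mulVecBilin k k).flip (Pi.single (0 : Fin 4) (1 : k)) ∘ₗ (repLeft k l).toLinearMap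

/-- The extension of `a ⊗ h ↦ ε(a) h` to `H16 k l`. -/
def projRight : H16 k l →ₗ[k] H4 k :=
  H4.ofCoords k ∘ₗ Matrix.vecMulBilin k k (Pi.single (0 : Fin 4) (1 : k)) ∘ₗ (repRight k l).toLinearMap

variable {k l}

/-- The first coordinate vector generates the induced module. The right factor acts on it by the
counit, and the left factor acts by the regular representation, so a·h sends it to the coordinates
of ε(h) a. -/
lemma projLeft_mul (a h : H4 k) :
    projLeft k l (inclLeft k l a * inclRight k l h) = counit (R := k) h • a := by
  have h1 : (repLeft k l).comp (inclLeft k l : H4 k →ₐ[k] H16 k l) = H4.rep k :=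
    H4.algHom_ext (by simp [repLeft, H4.rep]) (by simp [repLeft, H4.rep])
  have h2 : (Matrix.mulVecBilin k k).flip (Pi.single (0 : Fin 4) (1 : k)) ∘ₗ (repLeft k l).toLinearMap ∘ₗ
      (inclRight k l : H4 k →ₗ[k] H16 k l) =
      (LinearMap.toSpanSingleton k _ (Pi.single (0 : Fin 4) (1 : k))) ∘ₗ counit (R := k) (A := H4 k) :=
    H4.linearMap_ext (by simp) (by ext i; fin_cases i <;> simp [repLeft])
      (by ext i; fin_cases i <;> simp [repLeft])
      (by ext i; fin_cases i <;> simp [repLeft, Matrix.mul_apply, Fin.sum_univ_four])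
  have h3 := LinearMap.congr_fun h2 h
  have h4 := DFunLike.congr_fun h1 a
  simp at h3 h4
  have h5 := H4.ofCoords_coords a
  simp [H4.coords] at h5
  simp [projLeft, ← Matrix.mulVec_mulVec, h3, h4, Matrix.mulVec_smul, h5]

lemma projRight_mul (a h : H4 k) :
    projRight k l (inclLeft k l a * inclRight k l h) = counit (R := k) a • h := by
  have h2 : Matrix.vecMulBilin k k (Pi.single (0 : Fin 4) (1 : k)) ∘ₗ (repRight k l).toLinearMap ∘ₗ
      (inclLeft k l : H4 k →ₗ[k] H16 k l) =
      (LinearMap.toSpanSingleton k _ (Pi.single (0 : Fin 4) (1 : k))) ∘ₗ counit (R := k) (A := H4 k) :=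
    H4.linearMap_ext (by simp) (by ext i; fin_cases i <;> simp [repRight])
      (by ext i; fin_cases i <;> simp [repRight])
      (by ext i; fin_cases i <;> simp [repRight, Matrix.mul_apply, Fin.sum_univ_four])
  have h1 : projRight k l ∘ₗ (inclRight k l : H4 k →ₗ[k] H16 k l) = LinearMap.id :=
    H4.linearMap_ext (by simp [projRight, H4.ofCoords_apply])
      (by simp [projRight, H4.ofCoords_apply, repRight])
      (by simp [projRight, H4.ofCoords_apply, repRight])
      (by simp [projRight, H4.ofCoords_apply, repRight, Matrix.mul_apply, Fin.sum_univ_four])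
  have h3 := LinearMap.congr_fun h2 a
  have h4 := LinearMap.congr_fun h1 h
  simp [projRight] at h3 h4
  simp [projRight, ← Matrix.vecMul_vecMul, h3, h4, Matrix.smul_vecMul]

/-- The span of the products i(a) j(h) is a left ideal containing 1, which gives surjectivity. The
cross relations move G and X past the left factor. -/
lemma mul_mulMap_mem_range (u : H16 k l) (t : H4 k ⊗[k] H4 k) :
    u * (inclLeft k l).mulMap (inclRight k l) t ∈
      LinearMap.range ((inclLeft k l).mulMap (inclRight k l) : H4 k ⊗[k] H4 k →ₗ[k] H16 k l) := by
  set M := LinearMap.range ((inclLeft k l).mulMap (inclRight k l) : H4 k ⊗[k] H4 k →ₗ[k] H16 k l)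
    with hM
  have hmem : ∀ a h, inclLeft k l a * inclRight k l h ∈ M := fun a h => ⟨a ⊗ₜ h, rfl⟩
  -- For G and X the expression is linear in the left factor, so it need only be checked on 1, g, x,
  -- gx.
  have key : ∀ f : H4 k →ₗ[k] H16 k l, f 1 ∈ M → f (H4.g k) ∈ M → f (H4.x k) ∈ M →
      f (H4.g k * H4.x k) ∈ M → ∀ a, f a ∈ M := by
    intro f h1 hg hx hgx a
    obtain ⟨c₀, c₁, c₂, c₃, rfl⟩ := H4.exists_eq a
    simp only [map_add, map_smul]
    exact add_mem (add_mem (add_mem (M.smul_mem _ h1) (M.smul_mem _ hg)) (M.smul_mem _ hx))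
      (M.smul_mem _ hgx)
  have hu : u ∈ Algebra.adjoin k ({g k l, x k l, G k l, X k l} : Set (H16 k l)) := by
    rw [adjoin_eq_top]; trivial
  have hgen : ∀ u ∈ ({g k l, x k l, G k l, X k l} : Set (H16 k l)), ∀ a h : H4 k,
      u * (inclLeft k l a * inclRight k l h) ∈ M := by
    have hGx : G k l * x k l = -(x k l * G k l) := by rw [x_mul_G, neg_neg]
    have hXg : X k l * g k l = -(g k l * X k l) := by rw [g_mul_X, neg_neg]
    have hXx : X k l * x k l = l • (1 - G k l * g k l) - x k l * X k l :=
      eq_sub_of_add_eq' (x_mul_X_add k l)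
    rintro u (rfl | rfl | rfl | rfl) a h
    · simpa [mul_assoc] using hmem (H4.g k * a) h
    · simpa [mul_assoc] using hmem (H4.x k * a) h
    · refine key (LinearMap.mulLeft k (G k l) ∘ₗ LinearMap.mulRight k (inclRight k l h) ∘ₗ
        (inclLeft k l : H4 k →ₗ[k] H16 k l)) ?_ ?_ ?_ ?_ a
      · simpa using hmem 1 (H4.g k * h)
      · have := hmem (H4.g k) (H4.g k * h)
        simpa [← mul_assoc, g_mul_G] using this
      · have := M.neg_mem (hmem (H4.x k) (H4.g k * h))
        simpa [← mul_assoc, hGx] using this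
      · have := M.neg_mem (hmem (H4.g k * H4.x k) (H4.g k * h))
        have e : G k l * (g k l * x k l) = -(g k l * x k l * G k l) := by
          rw [← mul_assoc, ← g_mul_G, mul_assoc, hGx, mul_neg, mul_assoc]
        simpa [← mul_assoc, e, ← mul_assoc (G k l) (g k l) (x k l)] using this
    · refine key (LinearMap.mulLeft k (X k l) ∘ₗ LinearMap.mulRight k (inclRight k l h) ∘ₗ
        (inclLeft k l : H4 k →ₗ[k] H16 k l)) ?_ ?_ ?_ ?_ a
      · simpa using hmem 1 (H4.x k * h)
      · have := M.neg_mem (hmem (H4.g k) (H4.x k * h))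
        simpa [← mul_assoc, hXg] using this
      · have := M.sub_mem (M.smul_mem l (M.sub_mem (hmem 1 h) (hmem (H4.g k) (H4.g k * h))))
          (hmem (H4.x k) (H4.x k * h))
        simpa [← mul_assoc, hXx, ← g_mul_G, sub_mul] using this
      · have := M.add_mem (M.neg_mem (M.smul_mem l (M.sub_mem (hmem (H4.g k) h)
          (hmem 1 (H4.g k * h))))) (hmem (H4.g k * H4.x k) (H4.x k * h))
        have e : X k l * g k l * x k l =
            -(l • (g k l - G k l)) + g k l * x k l * X k l := by
          rw [hXg, neg_mul, mul_assoc, hXx, mul_sub, mul_smul_comm, mul_sub, mul_one,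
            ← g_mul_G, ← mul_assoc (g k l) (g k l), g_mul_g, one_mul, mul_assoc]
          abel
        simpa only [LinearMap.comp_apply, LinearMap.mulLeft_apply, LinearMap.mulRight_apply,
          BialgHom.coe_toLinearMap, map_mul, map_one, inclLeft_g, inclLeft_x, inclRight_g,
          inclRight_x, ← mul_assoc, one_mul, e, add_mul,
          neg_mul, smul_mul_assoc, sub_mul] using this
  induction hu using Algebra.adjoin_induction generalizing t with
  | mem u hu =>
    induction t using TensorProduct.induction_on with
    | zero => simp
    | add s t hs ht => simpa [mul_add] using M.add_mem hs ht
    | tmul a h => exact hgen u hu a h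
  | algebraMap r =>
    rw [← Algebra.smul_def]
    exact M.smul_mem r ⟨t, rfl⟩
  | add a b _ _ ha hb => rw [add_mul]; exact M.add_mem (ha t) (hb t)
  | mul a b _ _ ha hb =>
    obtain ⟨s, hs⟩ := hb t
    rw [mul_assoc, ← hs]
    exact ha s

variable (k l)

lemma mulMap_bijective : Function.Bijective ((inclLeft k l).mulMap (inclRight k l)) := by
  refine ⟨BialgHom.mulMap_injective _ _ (projLeft k l) (projRight k l) projLeft_mul projRight_mul,
    fun u => ?_⟩
  obtain ⟨t, ht⟩ := mul_mulMap_mem_range u (1 ⊗ₜ 1)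
  exact ⟨t, ht.trans (by simp)⟩

lemma factorizes : Factorizes k (H4 k) (H4 k) (H16 k l) :=
  factorizes_of_bijective _ _ (mulMap_bijective k l)

lemma finrank_eq : Module.finrank k (H16 k l) = 16 := by
  rw [← (LinearEquiv.ofBijective ((inclLeft k l).mulMap (inclRight k l) :
    H4 k ⊗[k] H4 k →ₗ[k] H16 k l) (mulMap_bijective k l)).finrank_eq, Module.finrank_tensorProduct,
    H4.finrank_eq]

end H16

end

noncomputable section

/-! ### Group-like and skew-primitive elements of a factorizable Hopf algebra -/

section factorization

open Coalgebra (comul counit)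
open TensorProduct (projLeft projRight)

variable {k : Type u} [Field k] {A H : Type v} {E : Type w} [Ring A] [HopfAlgebra k A]
  [Ring H] [HopfAlgebra k H] [Ring E] [HopfAlgebra k E] {i : A →ₐc[k] E} {j : H →ₐc[k] E}

/-- Transporting the projections through the coalgebra isomorphism gives coalgebra maps on E. The
last two clauses recover e as ∑ i(P(e₁)) j(Q(e₂)) and as ∑ i(P(e₂)) j(Q(e₁)). Comparing these two
expressions constrains a skew-primitive element. -/
lemma exists_projections (hb : Function.Bijective (i.mulMap j)) :
    ∃ (P : E →ₗc[k] A) (Q : E →ₗc[k] H), (∀ a h, P (i a * j h) = counit (R := k) h • a) ∧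
      (∀ a h, Q (i a * j h) = counit (R := k) a • h) ∧
      (∀ e, i.mulMap j (TensorProduct.map (P : E →ₗ[k] A) (Q : E →ₗ[k] H)
        (comul (R := k) e)) = e) ∧
      (∀ e, i.mulMap j (TensorProduct.comm k H A (TensorProduct.map (Q : E →ₗ[k] H)
        (P : E →ₗ[k] A) (comul (R := k) e))) = e) := by
  let Φ : A ⊗[k] H ≃ₗc[k] E := CoalgEquiv.ofBijective hb
  have hΦ : ∀ t, Φ t = i.mulMap j t := fun t => rfl
  have hs : ∀ a h, Φ.symm (i a * j h) = a ⊗ₜ h := fun a h => Φ.symm_apply_apply (a ⊗ₜ h)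
  refine ⟨(projLeft k A H).comp (Φ.symm : E →ₗc[k] A ⊗[k] H),
    (projRight k A H).comp (Φ.symm : E →ₗc[k] A ⊗[k] H), fun a h => ?_, fun a h => ?_,
    fun e => ?_, fun e => ?_⟩
  · simp [hs]
  · simp [hs]
  · have h1 := TensorProduct.map_projLeft_projRight_comul (k := k) (Φ.symm e)
    rw [← CoalgHomClass.map_comp_comul_apply, ← LinearMap.comp_apply, ← TensorProduct.map_comp] at h1
    exact (congrArg Φ h1).trans (Φ.apply_symm_apply e)
  · have h1 := TensorProduct.comm_map_projRight_projLeft_comul (k := k) (Φ.symm e)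
    rw [← CoalgHomClass.map_comp_comul_apply, ← LinearMap.comp_apply (TensorProduct.map _ _),
      ← TensorProduct.map_comp] at h1
    exact (congrArg Φ h1).trans (Φ.apply_symm_apply e)

/-- A group-like element of a factorizable Hopf algebra is a product of group-like elements. -/
lemma IsGroupLikeElem.exists_eq_mul (hb : Function.Bijective (i.mulMap j)) {e : E}
    (he : IsGroupLikeElem k e) :
    ∃ a h, IsGroupLikeElem k a ∧ IsGroupLikeElem k h ∧ e = i a * j h := by
  obtain ⟨P, Q, -, -, h, -⟩ := exists_projections hb
  refine ⟨P e, Q e, he.map P, he.map Q, ?_⟩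
  have := h e
  rw [he.comul_eq_tmul_self] at this
  simpa using this.symm

/-- The decomposition of a skew-primitive element of a factorizable Hopf algebra, allowing for an
additional term in its comultiplication. -/
lemma exists_of_comul_eq (hb : Function.Bijective (i.mulMap j)) {a p₀ : A} {h q₀ : H} {e : E}
    (ha : counit (R := k) a = 1) (hh : counit (R := k) h = 1) (hp₀ : counit (R := k) p₀ = 0)
    (hq₀ : counit (R := k) q₀ = 0)
    (he : comul (R := k) e = e ⊗ₜ 1 + (i a * j h) ⊗ₜ e + (i p₀ * j h) ⊗ₜ (j q₀)) :
    ∃ p q, comul (R := k) p = p ⊗ₜ 1 + a ⊗ₜ p ∧ comul (R := k) q = q ⊗ₜ 1 + h ⊗ₜ q ∧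
      e = i p + i a * j q + i p₀ * j q₀ ∧ e = j q + i p * j h := by
  obtain ⟨P, Q, hP, hQ, hPQ, hQP⟩ := exists_projections hb
  have hP1 : P 1 = 1 := by simpa using hP 1 1
  have hQ1 : Q 1 = 1 := by simpa using hQ 1 1
  have hPj : P (j q₀) = 0 := by simpa [hq₀] using hP 1 q₀
  have hQj : Q (j q₀) = q₀ := by simpa using hQ 1 q₀
  -- P kills the extra term because ε(q₀) = 0, and Q kills it because ε(p₀) = 0. Hence P e and Q e
  -- are genuinely skew-primitive, and the extra term survives only in the first of the two
  -- reconstructions of e.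
  refine ⟨P e, Q e, ?_, ?_, ?_, ?_⟩
  · rw [← CoalgHomClass.map_comp_comul_apply, he]
    simp [hP, hP1, hPj, hh]
  · rw [← CoalgHomClass.map_comp_comul_apply, he]
    simp [hQ, hQ1, hp₀, ha]
  · have := hPQ e
    rw [he] at this
    simpa [hP, hQ, hP1, hQ1, hPj, hQj, ha, hh] using this.symm
  · have := hQP e
    rw [he] at this
    simpa [hP, hQ, hP1, hQ1, hPj, hQj, ha, hh, hp₀] using this.symm

end factorization

/-! ### Factorizations through two copies of Sweedler's Hopf algebra -/

namespace H4

open Coalgebra (comul counit)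

variable {k : Type u} [Field k] {E : Type w} [Ring E] [HopfAlgebra k E] {i j : H4 k →ₐc[k] E}

/-- Allows comparison of coefficients in E: an equation between sums of products i(a) j(b) is read
off in the basis of H4 ⊗ H4. -/
lemma map_mul_map_injective (hb : Function.Bijective (i.mulMap j)) {t t' : H4 k ⊗[k] H4 k}
    (h : i.mulMap j t = i.mulMap j t') (p q : Fin 4) : coeff₂ k p q t = coeff₂ k p q t' := by
  rw [hb.1 h]

lemma map_left_g_ne_one (hb : Function.Bijective (i.mulMap j)) : i (g k) ≠ 1 := fun h => by
  have := map_mul_map_injective hb (t := g k ⊗ₜ 1) (t' := 1 ⊗ₜ 1) (by simp [h]) 0 0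
  simp [coords_one, coords_g] at this

lemma map_right_g_ne_one (hb : Function.Bijective (i.mulMap j)) : j (g k) ≠ 1 := fun h => by
  have := map_mul_map_injective hb (t := 1 ⊗ₜ g k) (t' := 1 ⊗ₜ 1) (by simp [h]) 0 0
  simp [coords_one, coords_g] at this

lemma map_left_g_ne_map_right_g (hb : Function.Bijective (i.mulMap j)) : i (g k) ≠ j (g k) :=
  fun h => by
    have := map_mul_map_injective hb (t := g k ⊗ₜ 1) (t' := 1 ⊗ₜ g k) (by simp [h]) 1 0
    simp [coords_one, coords_g] at this

lemma map_left_x_ne_zero (hb : Function.Bijective (i.mulMap j)) : i (x k) ≠ 0 := fun h => by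
  have := map_mul_map_injective hb (t := x k ⊗ₜ 1) (t' := 0) (by simp [h]) 2 0
  simp [coords_one, coords_x] at this

lemma map_right_x_ne_zero (hb : Function.Bijective (i.mulMap j)) : j (x k) ≠ 0 := fun h => by
  have := map_mul_map_injective hb (t := 1 ⊗ₜ x k) (t' := 0) (by simp [h]) 0 2
  simp [coords_one, coords_x] at this

lemma map_g_mul_map_g (i : H4 k →ₐc[k] E) : i (g k) * i (g k) = 1 := by
  rw [← map_mul, g_mul_g, map_one]

lemma map_x_mul_map_x (i : H4 k →ₐc[k] E) : i (x k) * i (x k) = 0 := by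
  rw [← map_mul, x_mul_x, map_zero]

lemma map_x_mul_map_g (i : H4 k →ₐc[k] E) : i (x k) * i (g k) = -(i (g k) * i (x k)) := by
  rw [← map_mul, x_mul_g, map_neg, map_mul]

lemma comul_map_g (i : H4 k →ₐc[k] E) : comul (R := k) (i (g k)) = i (g k) ⊗ₜ i (g k) := by
  rw [← CoalgHomClass.map_comp_comul_apply]; simp

lemma comul_map_x (i : H4 k →ₐc[k] E) :
    comul (R := k) (i (x k)) = i (x k) ⊗ₜ 1 + i (g k) ⊗ₜ i (x k) := by
  rw [← CoalgHomClass.map_comp_comul_apply]; simp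

lemma isGroupLikeElem_map_g (i : H4 k →ₐc[k] E) : IsGroupLikeElem k (i (g k)) :=
  isGroupLikeElem_g.map i

/-- The `(1, g G)`-primitive elements, where an additional term `c (x G ⊗ X)` is excluded. -/
lemma eq_of_comul_eq_add_smul (hb : Function.Bijective (i.mulMap j)) {w : E} {c : k}
    (hw : comul (R := k) w = w ⊗ₜ 1 + (i (g k) * j (g k)) ⊗ₜ w +
      c • ((i (x k) * j (g k)) ⊗ₜ j (x k))) :
    c = 0 ∧ ∃ β : k, w = β • (1 - i (g k) * j (g k)) := by
  obtain ⟨p, q, hp, hq, h1, h2⟩ := exists_of_comul_eq hb (p₀ := c • x k) (q₀ := x k)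
    (counit_g k) (counit_g k) (by simp) (by simp) (by simpa [TensorProduct.smul_tmul'] using hw)
  obtain ⟨α, β, rfl⟩ := eq_of_comul hp
  obtain ⟨α', β', rfl⟩ := eq_of_comul hq
  -- The two decompositions of w, namely p + gq + c xX and q + pG, are equated inside H4 ⊗ H4.
  have key := map_mul_map_injective hb (t := (α • x k + β • (1 - g k)) ⊗ₜ 1 +
    g k ⊗ₜ (α' • x k + β' • (1 - g k)) + (c • x k) ⊗ₜ x k)
    (t' := 1 ⊗ₜ (α' • x k + β' • (1 - g k)) + (α • x k + β • (1 - g k)) ⊗ₜ g k)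
    (by
      simp only [map_add, BialgHom.mulMap_tmul, map_one, one_mul, mul_one] at h1 h2 ⊢
      exact h1.symm.trans h2)
  -- The coefficients at x ⊗ x, x ⊗ 1, g ⊗ x and 1 ⊗ 1 yield c = 0, α = 0, α' = 0 and β = β'. What
  -- remains is β(1 - G) + β(1 - g)G = β(1 - gG).
  have k22 := key 2 2
  have k20 := key 2 0
  have k12 := key 1 2
  have k00 := key 0 0
  simp [coords_one, coords_x, coords_g] at k22 k20 k12 k00
  subst k22 k20 k12 k00
  refine ⟨rfl, β, ?_⟩
  rw [h2]
  simp [smul_sub, sub_mul]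

/-- The classification and the non-isomorphisms use the characteristic only through this fact; for
the double one also divides by 2. -/
lemma smul_two_eq_zero {M : Type*} [AddCommGroup M] [Module k M] (hk : ringChar k ≠ 2) {a : M}
    (h : a + a = 0) : a = 0 := by
  have h2 : (2 : k) ≠ 0 := Ring.two_ne_zero hk
  rw [← two_smul k] at h
  exact (smul_eq_zero.1 h).resolve_left h2

/-- The skew-primitive elements that anticommute with their group-like element. -/
lemma eq_or_eq_of_comul_eq (hk : ringChar k ≠ 2) (hb : Function.Bijective (i.mulMap j)) {h y : E}
    (hh : IsGroupLikeElem k h) (hy : comul (R := k) y = y ⊗ₜ 1 + h ⊗ₜ y) (h0 : y ≠ 0)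
    (hhy : h * y = -(y * h)) :
    (h = i (g k) ∧ ∃ α : k, α ≠ 0 ∧ y = α • i (x k)) ∨
      (h = j (g k) ∧ ∃ α : k, α ≠ 0 ∧ y = α • j (x k)) := by
  obtain ⟨a, b, ha, hb', rfl⟩ := hh.exists_eq_mul hb
  obtain ⟨p, q, hp, hq, h1, h2⟩ := exists_of_comul_eq hb (p₀ := 0) (q₀ := 0)
    ha.counit_eq_one hb'.counit_eq_one (by simp) (by simp) (by simpa using hy)
  -- The part αx already anticommutes with g, so the condition reduces to 2β(g - 1) = 0.
  have anti : ∀ (f : H4 k →ₐc[k] E) (α β : k), f (g k) ≠ 1 →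
      f (g k) * f (α • x k + β • (1 - g k)) = -(f (α • x k + β • (1 - g k)) * f (g k)) →
      β = 0 := by
    intro f α β hf hfy
    rw [eq_neg_iff_add_eq_zero] at hfy
    simp only [map_add, map_sub, map_smul, map_one, mul_add, add_mul, mul_smul_comm,
      smul_mul_assoc, mul_sub, sub_mul, map_g_mul_map_g, map_x_mul_map_g, mul_one, one_mul] at hfy
    have h3 : β • (f (g k) - 1) + β • (f (g k) - 1) = 0 := by
      rw [← hfy]; simp only [smul_sub, smul_neg]; abel
    exact (smul_eq_zero.1 (smul_two_eq_zero hk h3)).resolve_right (sub_ne_zero.2 hf)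
  rcases eq_one_or_eq_g ha with rfl | rfl <;> rcases eq_one_or_eq_g hb' with rfl | rfl
  -- The group-like is 1, so both components are primitive and hence zero.
  · simp [eq_zero_of_comul hp, eq_zero_of_comul hq] at h1
    exact absurd h1 h0
  · right
    obtain ⟨α, β, rfl⟩ := eq_of_comul hq
    simp only [eq_zero_of_comul hp, map_zero, zero_add, add_zero, map_one, one_mul, zero_mul] at h1 hhy
    subst h1
    obtain rfl := anti j α β (map_right_g_ne_one hb) hhy
    refine ⟨by simp, α, ?_, by simp⟩
    rintro rfl
    simp at h0
  · left
    obtain ⟨α, β, rfl⟩ := eq_of_comul hp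
    simp only [eq_zero_of_comul hq, map_zero, zero_add, add_zero, map_one, mul_one, mul_zero] at h1 hhy
    subst h1
    obtain rfl := anti i α β (map_left_g_ne_one hb) hhy
    refine ⟨by simp, α, ?_, by simp⟩
    rintro rfl
    simp at h0
  -- The group-like is gG. Taking c = 0, y is a multiple of 1 - gG and commutes with gG. Since it
  -- also anticommutes and gG is a unit, y = 0.
  · obtain ⟨-, β, rfl⟩ := eq_of_comul_eq_add_smul hb (w := y) (c := 0) (by simpa using hy)
    have hcomm : (i (g k) * j (g k)) * (β • (1 - i (g k) * j (g k))) =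
        (β • (1 - i (g k) * j (g k))) * (i (g k) * j (g k)) := by
      simp [mul_sub, sub_mul]
    rw [hcomm, eq_neg_iff_add_eq_zero] at hhy
    have h3 := smul_two_eq_zero hk hhy
    exact absurd ((hh.isUnit.mul_left_eq_zero).1 h3) h0

/-- The relations between the two factors. -/
lemma relations_of_bijective (hk : ringChar k ≠ 2) (hb : Function.Bijective (i.mulMap j)) :
    i (g k) * j (g k) = j (g k) * i (g k) ∧
      ((i (g k) * j (x k) = j (x k) * i (g k) ∧ i (x k) * j (g k) = j (g k) * i (x k) ∧
        i (x k) * j (x k) = j (x k) * i (x k)) ∨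
      (i (g k) * j (x k) = -(j (x k) * i (g k)) ∧ i (x k) * j (g k) = -(j (g k) * i (x k)) ∧
        ∃ l : k, i (x k) * j (x k) + j (x k) * i (x k) = l • (1 - j (g k) * i (g k)))) := by
  have hgg := map_g_mul_map_g i
  have hGG := map_g_mul_map_g j
  have hne := map_left_g_ne_map_right_g hb
  have cancel_g : ∀ z, i (g k) * (i (g k) * z) = z := fun z => by rw [← mul_assoc, hgg, one_mul]
  have cancel_G : ∀ z, j (g k) * (j (g k) * z) = z := fun z => by rw [← mul_assoc, hGG, one_mul]
  -- Gg is group-like, hence one of 1, G, g, gG. Cancellation turns the first three into g = G, g =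
  -- 1 and G = 1.
  have hgG : i (g k) * j (g k) = j (g k) * i (g k) := by
    obtain ⟨a, b, ha, hb', h⟩ := ((isGroupLikeElem_map_g j).mul
      (isGroupLikeElem_map_g i)).exists_eq_mul hb
    rcases eq_one_or_eq_g ha with rfl | rfl <;> rcases eq_one_or_eq_g hb' with rfl | rfl
    · have := congrArg (j (g k) * ·) h
      simp [cancel_G] at this
      exact absurd this hne
    · have := congrArg (j (g k) * ·) h
      simp [cancel_G, hGG] at this
      exact absurd this (map_left_g_ne_one hb)
    · have := congrArg (· * i (g k)) h
      simp [mul_assoc, hgg] at this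
      exact absurd this (map_right_g_ne_one hb)
    · exact h.symm
  -- Conjugating the skew-primitive generator of one factor by the group-like of the other preserves
  -- its comultiplication type and its anticommutation, so it returns a multiple α of that
  -- generator. Stated for a pair f, f' because both orders are used; the classification enters as
  -- the last hypothesis.
  have conj : ∀ f f' : H4 k →ₐc[k] E, f (g k) * f' (g k) = f' (g k) * f (g k) →
      f' (x k) ≠ 0 →
      (∀ y, comul (R := k) y = y ⊗ₜ 1 + f' (g k) ⊗ₜ y → y ≠ 0 → f' (g k) * y = -(y * f' (g k)) →
        ∃ α : k, y = α • f' (x k)) →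
      ∃ α : k, α * α = 1 ∧ f (g k) * f' (x k) = α • (f' (x k) * f (g k)) := by
    intro f f' hff hx0 hcl
    have hgg := map_g_mul_map_g f
    have cancel : ∀ z, f (g k) * (f (g k) * z) = z := fun z => by rw [← mul_assoc, hgg, one_mul]
    have e1 : f' (g k) * (f (g k) * f' (x k) * f (g k)) =
        -(f (g k) * f' (x k) * f (g k) * f' (g k)) := by
      have h3 : f (g k) * (f' (g k) * f' (x k)) * f (g k) =
          -(f (g k) * (f' (x k) * f' (g k)) * f (g k)) := by
        rw [map_x_mul_map_g]; simp
      calc _ = f (g k) * (f' (g k) * f' (x k)) * f (g k) := by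
            simp only [← mul_assoc, hff]
        _ = _ := h3
        _ = _ := by simp only [mul_assoc, hff]
    obtain ⟨α, hα⟩ := hcl (f (g k) * f' (x k) * f (g k)) (by
        rw [Bialgebra.comul_mul, Bialgebra.comul_mul, comul_map_g, comul_map_x]
        simp [mul_add, add_mul, hgg, hff]
        simp [mul_assoc, hgg]) (by
        intro h0
        have := congrArg (fun z => f (g k) * z * f (g k)) h0
        simp [mul_assoc, cancel, hgg] at this
        exact hx0 this) e1
    refine ⟨α, ?_, ?_⟩
    -- Conjugating twice is the identity, so α² = 1.
    · have h3 := congrArg (fun z => f (g k) * z * f (g k)) hα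
      simp only [mul_assoc, cancel, hgg, mul_one, mul_smul_comm, smul_mul_assoc] at h3 hα
      rw [hα, smul_smul] at h3
      have h4 : (α * α - 1) • f' (x k) = 0 := by rw [sub_smul, ← h3, one_smul, sub_self]
      exact sub_eq_zero.1 ((smul_eq_zero.1 h4).resolve_right hx0)
    · have h3 := congrArg (· * f (g k)) hα
      simpa [mul_assoc, hgg] using h3
  obtain ⟨α, hα, h1⟩ := conj i j hgG (map_right_x_ne_zero hb)
    fun y h1 h2 h3 => by
      rcases eq_or_eq_of_comul_eq hk hb (isGroupLikeElem_map_g j) h1 h2 h3 with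
        ⟨h, -⟩ | ⟨-, α, -, h⟩
      · exact absurd h.symm hne
      · exact ⟨α, h⟩
  obtain ⟨α', hα', h2⟩ := conj j i hgG.symm
    (map_left_x_ne_zero hb) fun y h1 h2 h3 => by
      rcases eq_or_eq_of_comul_eq hk hb (isGroupLikeElem_map_g i) h1 h2 h3 with
        ⟨-, α, -, h⟩ | ⟨h, -⟩
      · exact ⟨α, h⟩
      · exact absurd h hne
  -- In Δ(xX - αXx) the terms gX ⊗ x and αXg ⊗ x cancel, while xG ⊗ X and αGx ⊗ X combine to (1 -
  -- αα') xG ⊗ X.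
  obtain ⟨h3, β, h4⟩ := eq_of_comul_eq_add_smul hb
    (w := i (x k) * j (x k) - α • (j (x k) * i (x k))) (c := 1 - α * α') (by
      simp only [map_sub, map_smul, Bialgebra.comul_mul, comul_map_x, mul_add, add_mul,
        Algebra.TensorProduct.tmul_mul_tmul, one_mul, mul_one, h1, h2, ← hgG, smul_add,
        ← TensorProduct.smul_tmul', TensorProduct.sub_tmul, TensorProduct.tmul_sub,
        TensorProduct.tmul_smul, smul_smul, sub_smul, one_smul]
      abel)
  have h5 : α' = α := by
    have : α * α' = 1 := (sub_eq_zero.1 h3).symm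
    calc α' = α * α * α' := by rw [hα, one_mul]
      _ = α := by rw [mul_assoc, this, mul_one]
  subst h5
  have h6 : α' = 1 ∨ α' = -1 := mul_self_eq_one_iff.1 hα
  refine ⟨hgG, ?_⟩
  rcases h6 with rfl | rfl
  · left
    simp only [one_smul] at h1 h2 h4
    refine ⟨h1, h2.symm, ?_⟩
    -- Conjugation by g negates x and fixes X, hence negates xX - Xx. It fixes 1 - gG, so 2β(1 - gG)
    -- = 0 and x commutes with X.
    have h7 : i (g k) * (i (x k) * j (x k) - j (x k) * i (x k)) * i (g k) =
        -(i (x k) * j (x k) - j (x k) * i (x k)) := by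
      have e1 : ∀ z, i (g k) * (i (x k) * z) = -(i (x k) * (i (g k) * z)) := fun z => by
        rw [← mul_assoc, ← neg_eq_iff_eq_neg.2 (map_x_mul_map_g i), neg_mul, mul_assoc]
      have e2 : ∀ z, i (g k) * (j (x k) * z) = j (x k) * (i (g k) * z) := fun z => by
        rw [← mul_assoc, h1, mul_assoc]
      simp only [mul_sub, sub_mul, mul_assoc, e1, e2, mul_neg, neg_mul, hgg, mul_one]
      abel
    rw [h4] at h7
    have h8 : i (g k) * (β • (1 - i (g k) * j (g k))) * i (g k) = β • (1 - i (g k) * j (g k)) := by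
      simp [mul_sub, sub_mul, hgg, cancel_g, ← hgG]
    rw [h8, eq_neg_iff_add_eq_zero] at h7
    rw [smul_two_eq_zero hk h7, sub_eq_zero] at h4
    exact h4
  · right
    simp only [neg_smul, one_smul, sub_neg_eq_add] at h1 h2 h4
    exact ⟨h1, by rw [h2, neg_neg], β, by rw [h4, hgG]⟩

end H4

end

noncomputable section

/-! ### The classification of the factorizations -/

namespace H4

open Coalgebra (comul counit)

variable {k : Type u} [Field k] {E : Type w} [Ring E] [HopfAlgebra k E] {i j : H4 k →ₐc[k] E}

lemma commute_map {u : E} (hg : Commute u (j (g k))) (hx : Commute u (j (x k))) (b : H4 k) :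
    Commute u (j b) := by
  obtain ⟨c₀, c₁, c₂, c₃, rfl⟩ := exists_eq b
  simp only [map_add, map_smul, map_one, map_mul]
  exact ((((Commute.one_right u).smul_right c₀).add_right (hg.smul_right c₁)).add_right
    (hx.smul_right c₂)).add_right ((hg.mul_right hx).smul_right c₃)

/-- The isomorphism with `H4 k ⊗ H4 k` if the two factors commute. -/
def tensorEquiv (hb : Function.Bijective (i.mulMap j)) (h : ∀ a b, Commute (i a) (j b)) :
    H4 k ⊗[k] H4 k ≃ₐc[k] E :=
  .ofBijective
    { i.mulMap j with
      map_one' := (Algebra.TensorProduct.lift (i : H4 k →ₐ[k] E) (j : H4 k →ₐ[k] E) h).map_one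
      map_mul' := fun s t => by
        -- When the factors commute, the product map coincides with the algebra map from the
        -- universal property of the tensor product, hence is multiplicative.
        have e : ∀ s, i.mulMap j s =
            Algebra.TensorProduct.lift (i : H4 k →ₐ[k] E) (j : H4 k →ₐ[k] E) h s := by
          intro s
          induction s using TensorProduct.induction_on with
          | zero => simp
          | add s t hs ht => simp only [map_add, hs, ht]
          | tmul a b => rfl
        change i.mulMap j (s * t) = i.mulMap j s * i.mulMap j t
        rw [e, e, e, map_mul] } hb

/-- The isomorphism with `H16 k l` if the generators of the two factors satisfy the relations of
`H16 k l`. -/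
def h16Equiv (hb : Function.Bijective (i.mulMap j)) {l : k}
    (hgG : i (g k) * j (g k) = j (g k) * i (g k)) (hgX : i (g k) * j (x k) = -(j (x k) * i (g k)))
    (hxG : i (x k) * j (g k) = -(j (g k) * i (x k)))
    (hxX : i (x k) * j (x k) + j (x k) * i (x k) = l • (1 - j (g k) * i (g k))) :
    H16 k l ≃ₐc[k] E :=
  let f : H16 k l →ₐ[k] E := H16.lift (i (g k)) (i (x k)) (j (g k)) (j (x k)) (map_g_mul_map_g i)
    (map_g_mul_map_g j) (map_x_mul_map_x i) (map_x_mul_map_x j)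
    (by rw [map_x_mul_map_g, neg_neg]) (by rw [map_x_mul_map_g, neg_neg]) hgG hgX hxG hxX
  .ofBijective
    (.ofAlgHom f
      (H16.algHom_ext (by simp [f]) (by simp [f]) (by simp [f]) (by simp [f]))
      (H16.algHom_ext (by simp [f, comul_map_g]) (by simp [f, comul_map_x])
        (by simp [f, comul_map_g]) (by simp [f, comul_map_x])))
    (by
      have e1 : f.comp (H16.inclLeft k l : H4 k →ₐ[k] H16 k l) = i :=
        algHom_ext (by simp [f]) (by simp [f])
      have e2 : f.comp (H16.inclRight k l : H4 k →ₐ[k] H16 k l) = j :=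
        algHom_ext (by simp [f]) (by simp [f])
      -- Composing with the product map of `H16 k l` gives the product map of E. Both product maps
      -- are bijective, hence so is f.
      have e3 : f ∘ (H16.inclLeft k l).mulMap (H16.inclRight k l) = i.mulMap j := by
        ext t
        induction t using TensorProduct.induction_on with
        | zero => simp
        | add s t hs ht => simpa using congrArg₂ (· + ·) hs ht
        | tmul a b =>
          have h1 := DFunLike.congr_fun e1 a
          have h2 := DFunLike.congr_fun e2 b
          simp at h1 h2
          simp [h1, h2]
      have h := hb
      rw [← e3] at h
      exact (Function.Bijective.of_comp_iff f (H16.mulMap_bijective k l)).1 h)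

/-! ### The tensor product as a factorization, and the classification -/

variable (k)

/-- The inclusion of the left factor of `H4 k ⊗ H4 k`. -/
def inclLeft : H4 k →ₐc[k] H4 k ⊗[k] H4 k :=
  .ofAlgHom Algebra.TensorProduct.includeLeft (algHom_ext (by simp) (by simp))
    (algHom_ext (by simp [Algebra.TensorProduct.one_def])
      (by simp [Algebra.TensorProduct.one_def, TensorProduct.add_tmul]))

/-- The inclusion of the right factor of `H4 k ⊗ H4 k`. -/
def inclRight : H4 k →ₐc[k] H4 k ⊗[k] H4 k :=
  .ofAlgHom Algebra.TensorProduct.includeRight (algHom_ext (by simp) (by simp))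
    (algHom_ext (by simp [Algebra.TensorProduct.one_def])
      (by simp [Algebra.TensorProduct.one_def, TensorProduct.tmul_add]))

@[simp] lemma inclLeft_apply (a : H4 k) : inclLeft k a = a ⊗ₜ 1 := rfl
@[simp] lemma inclRight_apply (a : H4 k) : inclRight k a = 1 ⊗ₜ a := rfl

lemma tensor_mulMap_bijective : Function.Bijective ((inclLeft k).mulMap (inclRight k)) := by
  have : ⇑((inclLeft k).mulMap (inclRight k)) = id := by
    ext t
    induction t using TensorProduct.induction_on with
    | zero => simp
    | add s t hs ht => simp only [map_add, hs, ht, id_eq]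
    | tmul a b => simp
  rw [this]
  exact Function.bijective_id

lemma tensor_factorizes : Factorizes k (H4 k) (H4 k) (H4 k ⊗[k] H4 k) :=
  factorizes_of_bijective _ _ (tensor_mulMap_bijective k)

variable {k}

theorem factorizes_iff_equiv (hk : ringChar k ≠ 2) : Factorizes k (H4 k) (H4 k) E ↔
    (Nonempty (E ≃ₐc[k] H4 k ⊗[k] H4 k) ∨ ∃ l : k, Nonempty (E ≃ₐc[k] H16 k l)) := by
  constructor
  · intro h
    obtain ⟨i, j, hb⟩ := factorizes_iff.1 h
    obtain ⟨hgG, ⟨h1, h2, h3⟩ | ⟨h1, h2, l, h3⟩⟩ := relations_of_bijective hk hb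
    · refine Or.inl ⟨(tensorEquiv hb fun a b => ?_).symm⟩
      -- Commutation is extended from generators in one factor at a time: first over a with a
      -- generator on the right fixed, then over b.
      exact commute_map (commute_map (Commute.symm hgG) (Commute.symm h2) a).symm
        (commute_map (Commute.symm h1) (Commute.symm h3) a).symm b
    · exact Or.inr ⟨l, ⟨(h16Equiv hb hgG h1 h2 h3).symm⟩⟩
  · rintro (⟨⟨e⟩⟩ | ⟨l, ⟨e⟩⟩)
    · exact (tensor_factorizes k).of_equiv e
    · exact (H16.factorizes k l).of_equiv e

end H4

/-! ### Isomorphisms between the Hopf algebras of dimension sixteen -/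

namespace H16

open Coalgebra (comul counit)

variable {k : Type u} [Field k]

/-- The isomorphism `X ↦ c X`. -/
def scaleEquiv {l m c : k} (hc : c ≠ 0) (h : l = c * m) : H16 k l ≃ₐc[k] H16 k m :=
  -- The parameters are left free so that one formula serves for c and, in the opposite direction,
  -- for c⁻¹.
  let f : ∀ {l m : k} (c : k), l = c * m → (H16 k l →ₐc[k] H16 k m) := fun {l m} c h =>
    .ofAlgHom (lift (g k m) (x k m) (G k m) (c • X k m) (g_mul_g k m) (G_mul_G k m) (x_mul_x k m)
      (by simp [X_mul_X]) (g_mul_x k m) (by simp [G_mul_X]) (g_mul_G k m) (by simp [g_mul_X])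
      (x_mul_G k m) (by
        rw [mul_smul_comm, smul_mul_assoc, ← smul_add, x_mul_X_add, smul_smul, h]))
      (algHom_ext (by simp) (by simp) (by simp) (by simp))
      (algHom_ext (by simp) (by simp) (by simp)
        (by simp [TensorProduct.smul_tmul, TensorProduct.tmul_smul]))
  .ofBialgHom (f c h) (f c⁻¹ (by rw [h, inv_mul_cancel_left₀ hc]))
    (BialgHom.coe_toAlgHom_injective (algHom_ext (by simp [f]) (by simp [f]) (by simp [f])
      (by simp [f, smul_smul, hc])))
    (BialgHom.coe_toAlgHom_injective (algHom_ext (by simp [f]) (by simp [f]) (by simp [f])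
      (by simp [f, smul_smul, hc])))

/-- The image in `H16 k l` of two pairs of a group-like element and an anticommuting skew-primitive
element. -/
lemma apply_eq_or_apply_eq (hk : ringChar k ≠ 2) {F : Type*} [Ring F] [HopfAlgebra k F] {l : k}
    (e : F ≃ₐc[k] H16 k l) {i j : H4 k →ₐc[k] F} (hb : Function.Bijective (i.mulMap j)) :
    ∃ α β : k, α ≠ 0 ∧ β ≠ 0 ∧
      ((e (i (H4.g k)) = g k l ∧ e (i (H4.x k)) = α • x k l ∧
        e (j (H4.x k)) = β • X k l) ∨
      (e (i (H4.g k)) = G k l ∧ e (i (H4.x k)) = α • X k l ∧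
        e (j (H4.x k)) = β • x k l)) := by
  -- The image of (g, x) under a bialgebra map followed by e is again a group-like with an
  -- anticommuting skew-primitive, so it is (g, αx) or (G, αX) in `H16 k l`.
  have key : ∀ f : H4 k →ₐc[k] F, f (H4.x k) ≠ 0 → _ := fun f hf =>
    H4.eq_or_eq_of_comul_eq hk (mulMap_bijective k l) (h := e (f (H4.g k))) (y := e (f (H4.x k)))
      ((H4.isGroupLikeElem_map_g f).map e) (by
        have := H4.comul_map_x ((e : F →ₐc[k] H16 k l).comp f)
        simpa using this)
      (by simpa using hf)
      (by
        have := congrArg e (H4.map_x_mul_map_g f)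
        rw [map_neg, map_mul, map_mul] at this
        rw [this, neg_neg])
  have hne := H4.map_left_g_ne_map_right_g hb
  -- The two pairs cannot land on the same group-like, because i(g) ≠ j(g) and e is injective.
  rcases key i (H4.map_left_x_ne_zero hb) with ⟨h1, α, hα, h2⟩ | ⟨h1, α, hα, h2⟩ <;>
    rcases key j (H4.map_right_x_ne_zero hb) with ⟨h3, β, hβ, h4⟩ | ⟨h3, β, hβ, h4⟩
  · exact absurd (e.injective (h1.trans h3.symm)) hne
  · exact ⟨α, β, hα, hβ, Or.inl ⟨by simpa using h1, by simpa using h2, by simpa using h4⟩⟩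
  · exact ⟨α, β, hα, hβ, Or.inr ⟨by simpa using h1, by simpa using h2, by simpa using h4⟩⟩
  · exact absurd (e.injective (h1.trans h3.symm)) hne

variable (k)

/-- In the tensor product the left g commutes with the right x. Their images are g and a multiple of
X, or G and a multiple of x, and these anticommute. Commuting as well would make a unit times a
nonzero element vanish. -/
lemma isEmpty_tensor_equiv (hk : ringChar k ≠ 2) (l : k) :
    IsEmpty (H4 k ⊗[k] H4 k ≃ₐc[k] H16 k l) := by
  refine ⟨fun e => ?_⟩
  obtain ⟨α, β, hα, hβ, h⟩ := apply_eq_or_apply_eq hk e (H4.tensor_mulMap_bijective k)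
  have hcomm : e (H4.inclLeft k (H4.g k)) * e (H4.inclRight k (H4.x k)) =
      e (H4.inclRight k (H4.x k)) * e (H4.inclLeft k (H4.g k)) := by
    rw [← map_mul, ← map_mul]; simp
  have key : ∀ {h y : H16 k l} {γ : k}, γ ≠ 0 → IsUnit h → y ≠ 0 → h * y = -(y * h) →
      h * (γ • y) = (γ • y) * h → False := by
    intro h y γ hγ hh hy h1 h2
    rw [mul_smul_comm, smul_mul_assoc] at h2
    have h3 := smul_right_injective _ hγ h2
    rw [h1, neg_eq_iff_add_eq_zero] at h3
    exact hy ((hh.mul_left_eq_zero).1 (H4.smul_two_eq_zero hk h3))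
  have hX : X k l ≠ 0 := by simpa using H4.map_right_x_ne_zero (mulMap_bijective k l)
  have hx : x k l ≠ 0 := by simpa using H4.map_left_x_ne_zero (mulMap_bijective k l)
  have hg : IsUnit (g k l) := ⟨⟨_, _, g_mul_g k l, g_mul_g k l⟩, rfl⟩
  have hG : IsUnit (G k l) := ⟨⟨_, _, G_mul_G k l, G_mul_G k l⟩, rfl⟩
  rcases h with ⟨h1, -, h2⟩ | ⟨h1, -, h2⟩
  · rw [h1, h2] at hcomm
    exact key hβ hg hX (g_mul_X k l) hcomm
  · rw [h1, h2] at hcomm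
    exact key hβ hG hx (by rw [x_mul_G, neg_neg]) hcomm

/-- The expression xX + Xx is symmetric, so an isomorphism carries it to αβ(xX + Xx) whether or not
it swaps the pairs. It vanishes for parameter 0, while for parameter 1 it equals 1 - Gg, which is
nonzero because g ≠ G. -/
lemma isEmpty_zero_equiv_one (hk : ringChar k ≠ 2) : IsEmpty (H16 k 0 ≃ₐc[k] H16 k 1) := by
  refine ⟨fun e => ?_⟩
  obtain ⟨α, β, hα, hβ, h⟩ := apply_eq_or_apply_eq hk e (mulMap_bijective k 0)
  simp only [inclLeft_g, inclLeft_x, inclRight_x] at h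
  have hxX : e (x k 0) * e (X k 0) + e (X k 0) * e (x k 0) = 0 := by
    rw [← map_mul, ← map_mul, ← map_add, x_mul_X_add, zero_smul, map_zero]
  have h0 : (α * β) • (x k 1 * X k 1 + X k 1 * x k 1) = 0 := by
    rcases h with ⟨-, h1, h2⟩ | ⟨-, h1, h2⟩ <;> rw [h1, h2] at hxX <;> rw [← hxX] <;>
      simp [smul_smul, mul_comm, add_comm]
  have h1 := (smul_eq_zero.1 h0).resolve_left (mul_ne_zero hα hβ)
  rw [x_mul_X_add, one_smul, sub_eq_zero] at h1
  have h2 := congrArg (G k 1 * ·) h1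
  simp [← mul_assoc, G_mul_G] at h2
  exact H4.map_left_g_ne_map_right_g (mulMap_bijective k 1) (by simpa using h2.symm)

variable {k}

theorem _root_.H4.factorizes_iff_equiv_or (hk : ringChar k ≠ 2) {E : Type w} [Ring E]
    [HopfAlgebra k E] : Factorizes k (H4 k) (H4 k) E ↔
    (Nonempty (E ≃ₐc[k] H4 k ⊗[k] H4 k) ∨ Nonempty (E ≃ₐc[k] H16 k 0) ∨
      Nonempty (E ≃ₐc[k] H16 k 1)) := by
  rw [H4.factorizes_iff_equiv hk]
  refine or_congr_right ⟨?_, ?_⟩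
  · rintro ⟨l, ⟨e⟩⟩
    by_cases hl : l = 0
    · subst hl
      exact Or.inl ⟨e⟩
    · exact Or.inr ⟨e.trans (scaleEquiv hl (mul_one l).symm)⟩
  · rintro (h | h)
    · exact ⟨0, h⟩
    · exact ⟨1, h⟩

end H16

end

noncomputable section

/-! ### Pointed coalgebras -/

section pointed

open Coalgebra (comul counit)

variable {k : Type u} [Field k] {C : Type v} [AddCommGroup C] [Module k C] [Coalgebra k C]
  {C' : Type w} [AddCommGroup C'] [Module k C'] [Coalgebra k C']

variable (C) in
/-- The map `c ↦ ∑ f(c₁) c₂`. -/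
def dualActLeft (f : Module.Dual k C) : C →ₗ[k] C :=
  (TensorProduct.lid k C).toLinearMap ∘ₗ f.rTensor C ∘ₗ comul

variable (C) in
/-- The map `c ↦ ∑ c₁ f(c₂)`. -/
def dualActRight (f : Module.Dual k C) : C →ₗ[k] C :=
  (TensorProduct.rid k C).toLinearMap ∘ₗ f.lTensor C ∘ₗ comul

lemma IsSubcoalgebra.actLeft_mem {D : Submodule k C} (hD : IsSubcoalgebra k D)
    (f : Module.Dual k C) {d : C} (hd : d ∈ D) : dualActLeft C f d ∈ D := by
  obtain ⟨s, hs⟩ := hD d hd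
  rw [dualActLeft, LinearMap.comp_apply, LinearMap.comp_apply, ← hs]
  clear hs
  induction s using TensorProduct.induction_on with
  | zero => simp
  | add s t hs ht => simpa using D.add_mem hs ht
  | tmul a b => simpa using D.smul_mem _ b.2

lemma IsSubcoalgebra.actRight_mem {D : Submodule k C} (hD : IsSubcoalgebra k D)
    (f : Module.Dual k C) {d : C} (hd : d ∈ D) : dualActRight C f d ∈ D := by
  obtain ⟨s, hs⟩ := hD d hd
  rw [dualActRight, LinearMap.comp_apply, LinearMap.comp_apply, ← hs]
  clear hs
  induction s using TensorProduct.induction_on with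
  | zero => simp
  | add s t hs ht => simpa using D.add_mem hs ht
  | tmul a b => simpa using D.smul_mem _ a.2

lemma IsGroupLikeElem.isSubcoalgebra_span {c : C} (hc : IsGroupLikeElem k c) :
    IsSubcoalgebra k (Submodule.span k {c}) := by
  intro d hd
  obtain ⟨r, rfl⟩ := Submodule.mem_span_singleton.1 hd
  refine ⟨⟨r • c, hd⟩ ⊗ₜ ⟨c, Submodule.mem_span_singleton_self c⟩, ?_⟩
  simp [hc.comul_eq_tmul_self, TensorProduct.smul_tmul']

/-- A coalgebra is pointed if every nonzero element generates a group-like element. -/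
lemma isPointed_of_exists (h : ∀ d : C, d ≠ 0 → ∃ f f' : Module.Dual k C,
    IsGroupLikeElem k (dualActLeft C f (dualActRight C f' d))) : IsPointed k C := by
  intro D hD
  obtain ⟨d, hd, hd0⟩ := Submodule.exists_mem_ne_zero_of_ne_bot hD.2.1
  obtain ⟨f, f', hγ⟩ := h d hd0
  have hmem := hD.1.actLeft_mem f (hD.1.actRight_mem f' hd)
  -- The group-like lies in D and spans a subcoalgebra, so by simplicity it spans D.
  rcases hD.2.2 _ hγ.isSubcoalgebra_span
    ((Submodule.span_singleton_le_iff_mem _ _).2 hmem) with h0 | h0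
  · exact absurd (Submodule.span_singleton_eq_bot.1 h0) hγ.ne_zero
  · rw [← h0, finrank_span_singleton hγ.ne_zero]

lemma dualActLeft_equiv (e : C ≃ₗc[k] C') (f : Module.Dual k C) (c : C) :
    dualActLeft C' (f ∘ₗ (e.symm : C' →ₗ[k] C)) (e c) = e (dualActLeft C f c) := by
  simp only [dualActLeft, LinearMap.comp_apply, ← CoalgHomClass.map_comp_comul_apply]
  generalize comul (R := k) c = t
  induction t using TensorProduct.induction_on with
  | zero => simp
  | add s t hs ht => simp only [map_add, hs, ht]
  | tmul a b => simp

lemma dualActRight_equiv (e : C ≃ₗc[k] C') (f : Module.Dual k C) (c : C) :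
    dualActRight C' (f ∘ₗ (e.symm : C' →ₗ[k] C)) (e c) = e (dualActRight C f c) := by
  simp only [dualActRight, LinearMap.comp_apply, ← CoalgHomClass.map_comp_comul_apply]
  generalize comul (R := k) c = t
  induction t using TensorProduct.induction_on with
  | zero => simp
  | add s t hs ht => simp only [map_add, hs, ht]
  | tmul a b => simp

lemma dualActLeft_tmul (f : Module.Dual k C) (f' : Module.Dual k C') (c : C) (c' : C') :
    dualActLeft (C ⊗[k] C') (LinearMap.mul' k k ∘ₗ TensorProduct.map f f') (c ⊗ₜ c') =
      dualActLeft C f c ⊗ₜ dualActLeft C' f' c' := by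
  simp only [dualActLeft, LinearMap.comp_apply, TensorProduct.comul_tmul]
  generalize comul (R := k) c = s
  generalize comul (R := k) c' = t
  induction s using TensorProduct.induction_on with
  | zero => simp
  | add s s' hs hs' => simp only [map_add, TensorProduct.add_tmul, hs, hs']
  | tmul a b =>
    induction t using TensorProduct.induction_on with
    | zero => simp
    | add s s' hs hs' => simp only [map_add, TensorProduct.tmul_add, hs, hs']
    | tmul a' b' => simp [TensorProduct.smul_tmul, TensorProduct.tmul_smul, smul_smul, mul_comm]

lemma dualActRight_tmul (f : Module.Dual k C) (f' : Module.Dual k C') (c : C) (c' : C') :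
    dualActRight (C ⊗[k] C') (LinearMap.mul' k k ∘ₗ TensorProduct.map f f') (c ⊗ₜ c') =
      dualActRight C f c ⊗ₜ dualActRight C' f' c' := by
  simp only [dualActRight, LinearMap.comp_apply, TensorProduct.comul_tmul]
  generalize comul (R := k) c = s
  generalize comul (R := k) c' = t
  induction s using TensorProduct.induction_on with
  | zero => simp
  | add s s' hs hs' => simp only [map_add, TensorProduct.add_tmul, hs, hs']
  | tmul a b =>
    induction t using TensorProduct.induction_on with
    | zero => simp
    | add s s' hs hs' => simp only [map_add, TensorProduct.tmul_add, hs, hs']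
    | tmul a' b' => simp [TensorProduct.smul_tmul, TensorProduct.tmul_smul, smul_smul, mul_comm]

end pointed

/-! ### Pointedness of factorizations through two copies of Sweedler's algebra -/

namespace H4

open Coalgebra (comul counit)

variable (k : Type u) [Field k]

/-- In the comultiplication of the basis vector with index p, the terms having that vector on the
right have a group-like on the left: 1, g, g, 1 for 1, g, x, gx. The functional `f'` selects these
terms, and `f` removes the non-group-like remainders coming from other basis vectors. Together they
isolate one coordinate. -/
lemma exists_actLeft_actRight (p : Fin 4) : ∃ (f f' : Module.Dual k (H4 k)) (c : H4 k),
    IsGroupLikeElem k c ∧ ∀ a, dualActLeft (H4 k) f (dualActRight (H4 k) f' a) = coords k a p • c := by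
  let q : Fin 4 → Fin 4 := ![0, 1, 1, 0]
  let γ : Fin 4 → H4 k := ![1, g k, g k, 1]
  have h : dualActLeft (H4 k) (LinearMap.proj (q p) ∘ₗ coords k) ∘ₗ
      dualActRight (H4 k) (LinearMap.proj p ∘ₗ coords k) =
      LinearMap.toSpanSingleton k _ (γ p) ∘ₗ LinearMap.proj p ∘ₗ coords k := by
    apply linearMap_ext <;> fin_cases p <;>
    simp [dualActLeft, dualActRight, Algebra.TensorProduct.one_def, coords_one, coords_g, coords_x,
      coords_g_mul_x, comul_g_mul_x, q, γ, -Bialgebra.comul_mul]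
  refine ⟨_, _, γ p, ?_, fun a => LinearMap.congr_fun h a⟩
  fin_cases p
  exacts [.one, isGroupLikeElem_g, isGroupLikeElem_g, .one]

variable {k}

lemma tensor_ext {t : H4 k ⊗[k] H4 k} (h : ∀ p q, coeff₂ k p q t = 0) : t = 0 := by
  apply ((basis k).tensorProduct (basis k)).repr.injective
  ext ⟨p, q⟩
  rw [map_zero, Finsupp.zero_apply, ← h p q]
  clear h
  induction t using TensorProduct.induction_on with
  | zero => simp
  | add s t hs ht => simp only [map_add, Finsupp.add_apply, hs, ht]
  | tmul a b => simp [basis, mul_comm]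

/-- A Hopf algebra that factorizes through two copies of Sweedler's Hopf algebra is pointed. -/
lemma isPointed_of_bijective {E : Type w} [Ring E] [HopfAlgebra k E] {i j : H4 k →ₐc[k] E}
    (hb : Function.Bijective (i.mulMap j)) : IsPointed k E := by
  refine isPointed_of_exists fun d hd => ?_
  let Φ : H4 k ⊗[k] H4 k ≃ₗc[k] E := CoalgEquiv.ofBijective hb
  obtain ⟨t, rfl⟩ := hb.2 d
  have ht : t ≠ 0 := by rintro rfl; simp at hd
  obtain ⟨p, q, hpq⟩ : ∃ p q, coeff₂ k p q t ≠ 0 := by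
    by_contra! h
    exact ht (tensor_ext h)
  obtain ⟨f₁, f₁', c₁, hc₁, h₁⟩ := exists_actLeft_actRight k p
  obtain ⟨f₂, f₂', c₂, hc₂, h₂⟩ := exists_actLeft_actRight k q
  have key : ∀ t, dualActLeft _ (LinearMap.mul' k k ∘ₗ TensorProduct.map f₁ f₂)
      (dualActRight _ (LinearMap.mul' k k ∘ₗ TensorProduct.map f₁' f₂') t) =
        coeff₂ k p q t • (c₁ ⊗ₜ[k] c₂) := by
    intro t
    induction t using TensorProduct.induction_on with
    | zero => simp
    | add s t hs ht => simp only [map_add, hs, ht, add_smul]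
    | tmul a b =>
      rw [dualActRight_tmul, dualActLeft_tmul, h₁, h₂]
      simp [TensorProduct.smul_tmul, TensorProduct.tmul_smul, smul_smul, mul_comm]
  -- Tensor products of functionals act factorwise and extract the chosen nonzero coefficient of t.
  -- Dividing by it makes the result exactly group-like rather than a multiple of a group-like.
  refine ⟨((coeff₂ k p q t)⁻¹ • (LinearMap.mul' k k ∘ₗ TensorProduct.map f₁ f₂)) ∘ₗ
    (Φ.symm : E →ₗ[k] H4 k ⊗[k] H4 k),
    (LinearMap.mul' k k ∘ₗ TensorProduct.map f₁' f₂') ∘ₗ (Φ.symm : E →ₗ[k] H4 k ⊗[k] H4 k), ?_⟩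
  have h1 : i.mulMap j t = Φ t := rfl
  rw [h1, dualActRight_equiv, dualActLeft_equiv]
  refine IsGroupLikeElem.map Φ ?_
  have h2 : ∀ (c : k) (f : Module.Dual k (H4 k ⊗[k] H4 k)), dualActLeft _ (c • f) = c • dualActLeft _ f := by
    intro c f
    refine LinearMap.ext fun a => ?_
    simp [dualActLeft, LinearMap.rTensor_smul]
  rw [h2, LinearMap.smul_apply, key, smul_smul, inv_mul_cancel₀ hpq, one_smul]
  refine ⟨by simp [hc₁.counit_eq_one, hc₂.counit_eq_one], ?_⟩
  rw [TensorProduct.comul_tmul, hc₁.comul_eq_tmul_self, hc₂.comul_eq_tmul_self]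
  simp

end H4

/-! ### Integrals of `H16 k l` -/

namespace H16

open Coalgebra (comul counit)

/-! ### Rewriting to the normal order g, x, G, X, also in front of a further factor -/

section rules

variable {k : Type u} [Field k] {l : k}

lemma G_mul_g : G k l * g k l = g k l * G k l := (g_mul_G k l).symm
lemma x_mul_g : x k l * g k l = -(g k l * x k l) := by rw [g_mul_x, neg_neg]
lemma X_mul_g : X k l * g k l = -(g k l * X k l) := by rw [g_mul_X, neg_neg]
lemma X_mul_G : X k l * G k l = -(G k l * X k l) := by rw [G_mul_X, neg_neg]
lemma G_mul_x : G k l * x k l = -(x k l * G k l) := by rw [x_mul_G, neg_neg]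
lemma X_mul_x : X k l * x k l = l • (1 - g k l * G k l) - x k l * X k l := by
  rw [g_mul_G]; exact eq_sub_of_add_eq' (x_mul_X_add k l)

variable (z : H16 k l)

lemma g_mul_g_mul : g k l * (g k l * z) = z := by rw [← mul_assoc, g_mul_g, one_mul]
lemma G_mul_G_mul : G k l * (G k l * z) = z := by rw [← mul_assoc, G_mul_G, one_mul]
lemma x_mul_x_mul : x k l * (x k l * z) = 0 := by rw [← mul_assoc, x_mul_x, zero_mul]
lemma G_mul_g_mul : G k l * (g k l * z) = g k l * (G k l * z) := by
  rw [← mul_assoc, G_mul_g, mul_assoc]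
lemma x_mul_g_mul : x k l * (g k l * z) = -(g k l * (x k l * z)) := by
  rw [← mul_assoc, x_mul_g, neg_mul, mul_assoc]
lemma X_mul_g_mul : X k l * (g k l * z) = -(g k l * (X k l * z)) := by
  rw [← mul_assoc, X_mul_g, neg_mul, mul_assoc]
lemma X_mul_G_mul : X k l * (G k l * z) = -(G k l * (X k l * z)) := by
  rw [← mul_assoc, X_mul_G, neg_mul, mul_assoc]
lemma G_mul_x_mul : G k l * (x k l * z) = -(x k l * (G k l * z)) := by
  rw [← mul_assoc, G_mul_x, neg_mul, mul_assoc]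
lemma X_mul_x_mul :
    X k l * (x k l * z) = l • (z - g k l * (G k l * z)) - x k l * (X k l * z) := by
  rw [← mul_assoc, X_mul_x, sub_mul, smul_mul_assoc, sub_mul, one_mul, mul_assoc, mul_assoc]

end rules

variable (k : Type u) [Field k] (l : k)

/-- The integral `(1 + g) x (1 - G) X` of `H16 k l`. -/
def integral : H16 k l :=
  (x k l + g k l * x k l) * (X k l - G k l * X k l)

variable {k l}

lemma mem_leftIntegrals {t : H16 k l} (hg : g k l * t = t) (hx : x k l * t = 0)
    (hG : G k l * t = t) (hX : X k l * t = 0) : t ∈ leftIntegrals k (H16 k l) := by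
  intro h
  have hh : h ∈ Algebra.adjoin k ({g k l, x k l, G k l, X k l} : Set (H16 k l)) := by
    rw [adjoin_eq_top]; trivial
  induction hh using Algebra.adjoin_induction with
  | mem h hh => rcases hh with rfl | rfl | rfl | rfl <;> simp [*]
  | algebraMap r => simp [Algebra.smul_def]
  | add a b _ _ ha hb => rw [add_mul, ha, hb, map_add, add_smul]
  | mul a b _ _ ha hb =>
    rw [mul_assoc, hb, mul_smul_comm, ha, smul_smul, Bialgebra.counit_mul, mul_comm]

lemma mem_rightIntegrals {t : H16 k l} (hg : t * g k l = t) (hx : t * x k l = 0)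
    (hG : t * G k l = t) (hX : t * X k l = 0) : t ∈ rightIntegrals k (H16 k l) := by
  intro h
  have hh : h ∈ Algebra.adjoin k ({g k l, x k l, G k l, X k l} : Set (H16 k l)) := by
    rw [adjoin_eq_top]; trivial
  induction hh using Algebra.adjoin_induction with
  | mem h hh => rcases hh with rfl | rfl | rfl | rfl <;> simp [*]
  | algebraMap r => simp [Algebra.smul_def, Algebra.commutes]
  | add a b _ _ ha hb => rw [mul_add, ha, hb, map_add, add_smul]
  | mul a b _ _ ha hb =>
    rw [← mul_assoc, ha, smul_mul_assoc, hb, smul_smul, Bialgebra.counit_mul]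

variable (k l)

/-- The factor 1 + g absorbs g, and x(1 + g)x = 0. Moving G past (1 + g)x costs a sign, which G(1 -
G) = -(1 - G) restores. In X(1 + g)x(1 - G)X the l-term vanishes since (1 - g)(1 - gG) = (1 - g)(1 +
G) and (1 + G)(1 - G) = 0; the rest vanishes by X² = 0. -/
lemma integral_mem_leftIntegrals : integral k l ∈ leftIntegrals k (H16 k l) := by
  apply mem_leftIntegrals <;>
    simp only [integral, mul_add, add_mul, mul_sub, sub_mul, mul_assoc, mul_neg, neg_mul, neg_neg,
      mul_one, one_mul, mul_zero, sub_zero, smul_sub, smul_neg, smul_zero, neg_zero,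
      mul_smul_comm, smul_mul_assoc, g_mul_g, G_mul_G,
      x_mul_x, X_mul_X, G_mul_g, x_mul_g, X_mul_g, X_mul_G, G_mul_x, X_mul_x, g_mul_g_mul,
      G_mul_G_mul, x_mul_x_mul, G_mul_g_mul, x_mul_g_mul, X_mul_g_mul, X_mul_G_mul,
      G_mul_x_mul, X_mul_x_mul] <;>
    abel

lemma integral_mem_rightIntegrals : integral k l ∈ rightIntegrals k (H16 k l) := by
  apply mem_rightIntegrals <;>
    simp only [integral, mul_add, add_mul, mul_sub, sub_mul, mul_assoc, mul_neg, neg_mul, neg_neg,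
      mul_one, one_mul, mul_zero, sub_zero, smul_sub, smul_neg, smul_zero, neg_zero,
      mul_smul_comm, smul_mul_assoc, g_mul_g, G_mul_G,
      x_mul_x, X_mul_X, G_mul_g, x_mul_g, X_mul_g, X_mul_G, G_mul_x, X_mul_x, g_mul_g_mul,
      G_mul_G_mul, x_mul_x_mul, G_mul_g_mul, x_mul_g_mul, X_mul_g_mul, X_mul_G_mul,
      G_mul_x_mul, X_mul_x_mul] <;>
    abel

/-! ### Uniqueness of the left integral up to scalars -/

variable {k l}

/-- Every element of `H16 k l` has unique coordinates in the right factor with respect to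
`1, g, x, g x`. -/
lemma exists_eq (u : H16 k l) : ∃ s₀ s₁ s₂ s₃ : H4 k, u = inclRight k l s₀ +
    g k l * inclRight k l s₁ + x k l * inclRight k l s₂ + g k l * (x k l * inclRight k l s₃) := by
  obtain ⟨t, rfl⟩ := (mulMap_bijective k l).2 u
  induction t using TensorProduct.induction_on with
  | zero => exact ⟨0, 0, 0, 0, by simp⟩
  | add s t hs ht =>
    obtain ⟨s₀, s₁, s₂, s₃, hs⟩ := hs
    obtain ⟨t₀, t₁, t₂, t₃, ht⟩ := ht
    refine ⟨s₀ + t₀, s₁ + t₁, s₂ + t₂, s₃ + t₃, ?_⟩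
    rw [map_add, hs, ht]
    simp only [map_add, mul_add]
    abel
  | tmul a b =>
    obtain ⟨c₀, c₁, c₂, c₃, rfl⟩ := H4.exists_eq a
    refine ⟨c₀ • b, c₁ • b, c₂ • b, c₃ • b, ?_⟩
    simp [add_mul, mul_assoc]

/-- Freeness over the right factor on 1, g, x, gx. It converts each equation satisfied by an
integral into equations in H4. -/
lemma eq_zero_of_eq_zero {s₀ s₁ s₂ s₃ : H4 k} (h : inclRight k l s₀ +
    g k l * inclRight k l s₁ + x k l * inclRight k l s₂ + g k l * (x k l * inclRight k l s₃) = 0) :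
    s₀ = 0 ∧ s₁ = 0 ∧ s₂ = 0 ∧ s₃ = 0 := by
  have h1 : (inclLeft k l).mulMap (inclRight k l) (1 ⊗ₜ s₀ + H4.g k ⊗ₜ s₁ + H4.x k ⊗ₜ s₂ +
      (H4.g k * H4.x k) ⊗ₜ s₃) = 0 := by
    rw [← h]; simp [mul_assoc]
  have h2 := (mulMap_bijective k l).1 (h1.trans (map_zero _).symm)
  have key : ∀ p : Fin 4, _ := fun p => congrArg (fun t => TensorProduct.lid k (H4 k)
    ((LinearMap.proj p ∘ₗ H4.coords k).rTensor (H4 k) t)) h2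
  have k0 := key 0
  have k1 := key 1
  have k2 := key 2
  have k3 := key 3
  simp [H4.coords_one, H4.coords_g, H4.coords_x, H4.coords_g_mul_x] at k0 k1 k2 k3
  exact ⟨k0, k1, k2, k3⟩

variable (k l) in
lemma integral_ne_zero : integral k l ≠ 0 := by
  intro h
  have := (eq_zero_of_eq_zero (l := l) (s₀ := 0) (s₁ := 0) (s₂ := H4.x k - H4.g k * H4.x k)
    (s₃ := H4.x k - H4.g k * H4.x k) (by rw [← h]; simp [integral, add_mul, mul_assoc])).2.2.1
  have := congrFun (congrArg (H4.coords k) this) 2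
  simp [H4.coords_x, H4.coords_g_mul_x] at this

/-- Invariance under g makes the coordinates agree in pairs, and annihilation by x kills the first
pair, so t = (1 + g)x s with s in the right factor. The conditions from G and X then become Gs = -s
and Xs = 0, whose solutions are the multiples of X - GX. -/
lemma exists_eq_smul_integral {t : H16 k l} (ht : t ∈ leftIntegrals k (H16 k l)) :
    ∃ c : k, t = c • integral k l := by
  have hg : g k l * t = t := by simpa using ht (g k l)
  have hx : x k l * t = 0 := by simpa using ht (x k l)
  have hG : G k l * t = t := by simpa using ht (G k l)
  have hX : X k l * t = 0 := by simpa using ht (X k l)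
  obtain ⟨s₀, s₁, s₂, s₃, rfl⟩ := exists_eq t
  obtain ⟨h0, h0', h2, -⟩ := eq_zero_of_eq_zero (l := l) (s₀ := s₁ - s₀) (s₁ := s₀ - s₁)
    (s₂ := s₃ - s₂) (s₃ := s₂ - s₃) (by
      rw [← sub_eq_zero.2 hg]
      simp only [map_sub, mul_add, mul_sub, g_mul_g_mul]
      abel)
  obtain ⟨-, -, h1, -⟩ := eq_zero_of_eq_zero (l := l) (s₀ := 0) (s₁ := 0)
    (s₂ := s₀) (s₃ := -s₁) (by
      rw [← hx]
      simp [mul_add, x_mul_x_mul, x_mul_g_mul])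
  obtain rfl := sub_eq_zero.1 h0
  obtain rfl := sub_eq_zero.1 h2
  subst h1
  obtain ⟨-, -, h3, -⟩ := eq_zero_of_eq_zero (l := l) (s₀ := 0) (s₁ := 0)
    (s₂ := -(H4.g k * s₃ + s₃)) (s₃ := -(H4.g k * s₃ + s₃)) (by
      rw [← sub_eq_zero.2 hG]
      simp [mul_add, G_mul_x_mul, G_mul_g_mul]
      abel)
  have h3' := congrArg (inclRight k l) (neg_eq_zero.1 h3)
  simp only [map_add, map_mul, inclRight_g, map_zero] at h3'
  have h3'' := eq_neg_of_add_eq_zero_left h3'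
  -- Since Gs = -s, the l-term of Xt is l(1 - g)(1 + g)s = 0. What remains is -(1 - g)xXs.
  obtain ⟨-, -, h4, -⟩ := eq_zero_of_eq_zero (l := l) (s₀ := 0) (s₁ := 0)
    (s₂ := -(H4.x k * s₃)) (s₃ := H4.x k * s₃) (by
      rw [← hX]
      simp [mul_add, mul_sub, X_mul_x_mul, X_mul_g_mul, h3'', g_mul_g_mul]
      abel)
  obtain ⟨c₀, c₁, c₂, c₃, rfl⟩ := H4.exists_eq s₃
  have e1 : H4.x k * (H4.g k * H4.x k) = 0 := by
    rw [← mul_assoc, H4.x_mul_g, neg_mul, mul_assoc, H4.x_mul_x, mul_zero, neg_zero]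
  have e2 : H4.g k * (H4.g k * H4.x k) = H4.x k := by rw [← mul_assoc, H4.g_mul_g, one_mul]
  have k4 := congrFun (congrArg (H4.coords k) (neg_eq_zero.1 h4)) 2
  have k3 := congrFun (congrArg (H4.coords k) (neg_eq_zero.1 h3)) 2
  have k3' := congrFun (congrArg (H4.coords k) (neg_eq_zero.1 h3)) 0
  simp [mul_add, e1, e2, H4.g_mul_g, H4.x_mul_x, H4.x_mul_g, H4.coords_one, H4.coords_g,
    H4.coords_x, H4.coords_g_mul_x] at k3 k3' k4
  subst k4
  obtain rfl : c₁ = 0 := by simpa using k3'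
  obtain rfl := eq_neg_of_add_eq_zero_left k3
  refine ⟨c₂, ?_⟩
  simp [integral, add_mul, mul_sub, mul_add, mul_assoc, smul_sub, smul_add]
  abel

/-! ### Unimodularity and failure of semisimplicity -/

variable (k l)

/-- The algebra anti-automorphism that fixes the generators. -/
def reverse : H16 k l →ₐ[k] (H16 k l)ᵐᵒᵖ :=
  lift (.op (g k l)) (.op (x k l)) (.op (G k l)) (.op (X k l))
    (by rw [← MulOpposite.op_mul, g_mul_g, MulOpposite.op_one])
    (by rw [← MulOpposite.op_mul, G_mul_G, MulOpposite.op_one])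
    (by rw [← MulOpposite.op_mul, x_mul_x, MulOpposite.op_zero])
    (by rw [← MulOpposite.op_mul, X_mul_X, MulOpposite.op_zero])
    (by rw [← MulOpposite.op_mul, ← MulOpposite.op_mul, ← MulOpposite.op_neg, x_mul_g])
    (by rw [← MulOpposite.op_mul, ← MulOpposite.op_mul, ← MulOpposite.op_neg, X_mul_G])
    (by rw [← MulOpposite.op_mul, ← MulOpposite.op_mul, G_mul_g])
    (by rw [← MulOpposite.op_mul, ← MulOpposite.op_mul, ← MulOpposite.op_neg, X_mul_g])
    (by rw [← MulOpposite.op_mul, ← MulOpposite.op_mul, ← MulOpposite.op_neg, G_mul_x])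
    (by
      rw [← MulOpposite.op_mul, ← MulOpposite.op_mul, ← MulOpposite.op_mul, ← MulOpposite.op_add,
        ← MulOpposite.op_one, ← MulOpposite.op_sub, ← MulOpposite.op_smul, add_comm, x_mul_X_add,
        G_mul_g])

variable {k l}

lemma unop_reverse_mul (a b : H16 k l) : (reverse k l (a * b)).unop =
    (reverse k l b).unop * (reverse k l a).unop := by
  rw [map_mul, MulOpposite.unop_mul]

lemma unop_reverse_unop_reverse (a : H16 k l) :
    (reverse k l (reverse k l a).unop).unop = a := by
  have ha : a ∈ Algebra.adjoin k ({g k l, x k l, G k l, X k l} : Set (H16 k l)) := by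
    rw [adjoin_eq_top]; trivial
  induction ha using Algebra.adjoin_induction with
  | mem a ha => rcases ha with rfl | rfl | rfl | rfl <;> simp [reverse]
  | algebraMap r => simp
  | add a b _ _ ha hb => simp only [map_add, MulOpposite.unop_add, ha, hb]
  | mul a b _ _ ha hb => simp only [unop_reverse_mul, ha, hb]

/-- An anti-automorphism exchanges left and right multiplication. As it fixes the generators, the
generator criterion for left integrals applies to the reversed element. -/
lemma reverse_mem_leftIntegrals {t : H16 k l} (ht : t ∈ rightIntegrals k (H16 k l)) :
    (reverse k l t).unop ∈ leftIntegrals k (H16 k l) := by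
  have key : ∀ h : H16 k l, (reverse k l h).unop * (reverse k l t).unop =
      counit (R := k) h • (reverse k l t).unop := by
    intro h
    rw [← unop_reverse_mul, ht h, map_smul, MulOpposite.unop_smul]
  refine mem_leftIntegrals ?_ ?_ ?_ ?_
  · simpa [reverse] using key (g k l)
  · simpa [reverse] using key (x k l)
  · simpa [reverse] using key (G k l)
  · simpa [reverse] using key (X k l)

variable (k l)

/-- Left integrals are multiples of one element that is also a right integral. A right integral
reverses to such a multiple; reversing back gives a multiple of the reverse of a right integral,
which is a left integral. -/
lemma isUnimodular : IsUnimodular k (H16 k l) := by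
  refine le_antisymm (fun t ht => ?_) fun t ht => ?_
  · obtain ⟨c, rfl⟩ := exists_eq_smul_integral ht
    exact (rightIntegrals k _).smul_mem c (integral_mem_rightIntegrals k l)
  · obtain ⟨c, hc⟩ := exists_eq_smul_integral (reverse_mem_leftIntegrals ht)
    rw [← unop_reverse_unop_reverse t, hc, map_smul, MulOpposite.unop_smul]
    exact (leftIntegrals k _).smul_mem c
      (reverse_mem_leftIntegrals (integral_mem_rightIntegrals k l))

/-- The left ideal generated by the integral t is kt, and t² = ε(t)t = 0. In a semisimple ring it
would be generated by an idempotent; that idempotent is a multiple of t, hence zero, contradicting t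
≠ 0. -/
lemma not_isSemisimpleRing : ¬ IsSemisimpleRing (H16 k l) := by
  intro h
  obtain ⟨e, he, hI⟩ := IsSemisimpleRing.ideal_eq_span_idempotent (Ideal.span {integral k l})
  have hint := integral_mem_leftIntegrals k l
  obtain ⟨a, ha⟩ := Ideal.mem_span_singleton'.1 (hI ▸ Ideal.mem_span_singleton_self e)
  rw [hint a] at ha
  have h0 : counit (R := k) (integral k l) = 0 := by simp [integral]
  have he0 : e = 0 := by
    rw [← he.eq, ← ha, smul_mul_smul_comm, hint, h0, zero_smul, smul_zero]
  have h1 : integral k l ∈ Ideal.span {e} := hI ▸ Ideal.mem_span_singleton_self _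
  rw [he0, Ideal.mem_span_singleton'] at h1
  obtain ⟨b, hb⟩ := h1
  exact integral_ne_zero k l (by rw [← hb, mul_zero])

lemma isPointed : IsPointed k (H16 k l) := H4.isPointed_of_bijective (mulMap_bijective k l)

end H16

end

noncomputable section

/-! ### The Drinfel'd double of Sweedler's Hopf algebra -/

namespace DrinfeldDouble

open Coalgebra (comul counit)

variable {k : Type u} {H : Type v} [Field k] [Ring H] [HopfAlgebra k H]
  [HopfAlgebra.BijectiveAntipode k H] [Module.Finite k H]

variable (k H) in
/-- The bilinear map `(p, a) ↦ p ⊗ a` to the Drinfel'd double. -/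
def mk : DualCop k H →ₗ[k] H →ₗ[k] DrinfeldDouble k H := TensorProduct.mk k (DualCop k H) H

lemma one_eq_mk : (1 : DrinfeldDouble k H) = mk k H 1 1 := rfl

@[elab_as_elim]
lemma mk_induction {motive : DrinfeldDouble k H → Prop} (F : DrinfeldDouble k H)
    (zero : motive 0) (mk : ∀ p a, motive (mk k H p a))
    (add : ∀ F G, motive F → motive G → motive (F + G)) : motive F :=
  TensorProduct.induction_on F zero mk add

lemma mk_mul_mk (p q : DualCop k H) (a : H) : mk k H p 1 * mk k H q a = mk k H (p * q) a := by
  change mulMap k H (p ⊗ₜ 1) (q ⊗ₜ a) = (p * q) ⊗ₜ a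
  simp

lemma mk_one_mul_mk_one (a b : H) : mk k H 1 a * mk k H 1 b = mk k H 1 (a * b) := by
  change mulMap k H (1 ⊗ₜ a) (1 ⊗ₜ b) = 1 ⊗ₜ (a * b)
  rw [mulMap_tmul, mulDual_one, ← mulH_one_tmul_one b, ← mulH_mul, mulH_one_tmul_one]

lemma mk_one_mul_mk (a : H) (p : DualCop k H) :
    mk k H 1 a * mk k H p 1 = (actT k H (comul₃ k H a) (p ⊗ₜ 1) : DualCop k H ⊗[k] H) := by
  change mulMap k H (1 ⊗ₜ a) (p ⊗ₜ 1) = _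
  rw [mulMap_tmul, mulDual_one, mulH_apply]

lemma counit_mk (p : DualCop k H) (a : H) :
    counit (R := k) (mk k H p a) = counit (R := k) a * p 1 := rfl

lemma comul_mk_one (p : DualCop k H) : comul (R := k) (mk k H p 1) =
    TensorProduct.map ((mk k H).flip 1) ((mk k H).flip 1) (comul (R := k) p) := by
  have h : ∀ s : DualCop k H ⊗[k] DualCop k H,
      TensorProduct.tensorTensorTensorComm k _ _ _ _ (s ⊗ₜ[k] ((1 : H) ⊗ₜ[k] (1 : H))) =
        TensorProduct.map ((TensorProduct.mk k (DualCop k H) H).flip 1)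
          ((TensorProduct.mk k (DualCop k H) H).flip 1) s := by
    intro s
    induction s using TensorProduct.induction_on with
    | zero => simp
    | add s t hs ht => simp only [map_add, TensorProduct.add_tmul, hs, ht]
    | tmul a b => rfl
  refine (TensorProduct.comul_tmul p (1 : H)).trans ?_
  rw [Bialgebra.comul_one]
  exact h _

lemma comul_one_mk (a : H) : comul (R := k) (mk k H 1 a) =
    TensorProduct.map (mk k H 1) (mk k H 1) (comul (R := k) a) := by
  have h : ∀ s : H ⊗[k] H, TensorProduct.tensorTensorTensorComm k _ _ _ _
      (((1 : DualCop k H) ⊗ₜ[k] (1 : DualCop k H)) ⊗ₜ[k] s) =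
        TensorProduct.map (TensorProduct.mk k (DualCop k H) H 1)
          (TensorProduct.mk k (DualCop k H) H 1) s := by
    intro s
    induction s using TensorProduct.induction_on with
    | zero => simp
    | add s t hs ht => simp only [map_add, TensorProduct.tmul_add, hs, ht]
    | tmul a b => rfl
  refine (TensorProduct.comul_tmul (1 : DualCop k H) a).trans ?_
  rw [DualCop.comul_one]
  exact h _

end DrinfeldDouble

/-! ### The dual of Sweedler's algebra and the cross relations of its double -/

namespace H4

open Coalgebra (comul counit)
open DrinfeldDouble (actL actR)

variable {k : Type u} [Field k]

lemma g_mul_g_mul (z : H4 k) : g k * (g k * z) = z := by rw [← mul_assoc, g_mul_g, one_mul]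
lemma x_mul_g_mul (z : H4 k) : x k * (g k * z) = -(g k * (x k * z)) := by
  rw [← mul_assoc, x_mul_g, neg_mul, mul_assoc]

lemma antipodeInv_g : HopfAlgebra.antipodeInv k (H4 k) (g k) = g k := by
  have := HopfAlgebra.antipodeInv_antipode (k := k) (g k)
  rwa [antipode_g] at this

lemma antipodeInv_x : HopfAlgebra.antipodeInv k (H4 k) (x k) = g k * x k := by
  have := HopfAlgebra.antipodeInv_antipode (k := k) (g k * x k)
  rwa [HopfAlgebra.antipode_mul_antidistrib, antipode_g, antipode_x, neg_mul, mul_assoc, x_mul_g,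
    mul_neg, neg_neg, g_mul_g_mul] at this

lemma dualCop_map_neg (p : DualCop k (H4 k)) (y : H4 k) : p (-y) = -p y :=
  map_neg (DualCop.toDual k (H4 k) p) y

lemma dualCop_ext {p q : DualCop k (H4 k)} (h₁ : p 1 = q 1) (hg : p (g k) = q (g k))
    (hx : p (x k) = q (x k)) (hgx : p (g k * x k) = q (g k * x k)) : p = q :=
  (DualCop.toDual k (H4 k)).injective (linearMap_ext h₁ hg hx hgx)

variable (k)

/-- The group-like element `1 ↦ 1`, `g ↦ -1`, `x ↦ 0`, `g x ↦ 0` of the dual. -/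
def χ : DualCop k (H4 k) :=
  (DualCop.toDual k (H4 k)).symm
    (LinearMap.proj 0 ∘ₗ coords k - LinearMap.proj 1 ∘ₗ coords k)

/-- The skew-primitive element `1 ↦ 0`, `g ↦ 0`, `x ↦ 1`, `g x ↦ 1` of the dual. -/
def ξ : DualCop k (H4 k) :=
  (DualCop.toDual k (H4 k)).symm
    (LinearMap.proj 2 ∘ₗ coords k + LinearMap.proj 3 ∘ₗ coords k)

@[simp] lemma χ_one : χ k 1 = 1 := by
  change coords k 1 0 - coords k 1 1 = _
  simp [coords_one]
@[simp] lemma χ_g : χ k (g k) = -1 := by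
  change coords k (g k) 0 - coords k (g k) 1 = _
  simp [coords_g]
@[simp] lemma χ_x : χ k (x k) = 0 := by
  change coords k (x k) 0 - coords k (x k) 1 = _
  simp [coords_x]
@[simp] lemma χ_g_mul_x : χ k (g k * x k) = 0 := by
  change coords k (g k * x k) 0 - coords k (g k * x k) 1 = _
  simp [coords_g_mul_x]
@[simp] lemma ξ_one : ξ k 1 = 0 := by simp [ξ, coords_one]
@[simp] lemma ξ_g : ξ k (g k) = 0 := by simp [ξ, coords_g]
@[simp] lemma ξ_x : ξ k (x k) = 1 := by simp [ξ, coords_x]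
@[simp] lemma ξ_g_mul_x : ξ k (g k * x k) = 1 := by simp [ξ, coords_g_mul_x]

variable {k}

lemma dualCop_mul_one (p q : DualCop k (H4 k)) : (p * q) 1 = p 1 * q 1 := by
  simp [DualCop.mul_apply, Algebra.TensorProduct.one_def]
lemma dualCop_mul_g (p q : DualCop k (H4 k)) : (p * q) (g k) = p (g k) * q (g k) := by
  simp [DualCop.mul_apply]
lemma dualCop_mul_x (p q : DualCop k (H4 k)) :
    (p * q) (x k) = p (x k) * q 1 + p (g k) * q (x k) := by
  simp [DualCop.mul_apply]
lemma dualCop_mul_g_mul_x (p q : DualCop k (H4 k)) :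
    (p * q) (g k * x k) = p (g k * x k) * q (g k) + p 1 * q (g k * x k) := by
  simp [DualCop.mul_apply, comul_g_mul_x, -Bialgebra.comul_mul]

lemma χ_mul_χ : χ k * χ k = 1 := by
  apply dualCop_ext <;>
    simp [dualCop_mul_one, dualCop_mul_g, dualCop_mul_x, dualCop_mul_g_mul_x]
lemma ξ_mul_ξ : ξ k * ξ k = 0 := by
  apply dualCop_ext <;>
    simp [dualCop_mul_one, dualCop_mul_g, dualCop_mul_x, dualCop_mul_g_mul_x]
lemma χ_mul_ξ : χ k * ξ k = -(ξ k * χ k) := by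
  rw [eq_neg_iff_add_eq_zero]
  apply dualCop_ext <;>
    simp [dualCop_mul_one, dualCop_mul_g, dualCop_mul_x, dualCop_mul_g_mul_x]

lemma comul_χ : comul (R := k) (χ k) = χ k ⊗ₜ χ k := by
  apply (DualCop.ev₂ k (H4 k)).injective
  refine TensorProduct.ext' fun y z => ?_
  rw [DualCop.ev₂_comul, DualCop.ev₂_tmul]
  obtain ⟨c₀, c₁, c₂, c₃, rfl⟩ := exists_eq y
  obtain ⟨d₀, d₁, d₂, d₃, rfl⟩ := exists_eq z
  simp [mul_add, add_mul, mul_assoc, g_mul_g, x_mul_x, x_mul_g, g_mul_g_mul,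
    x_mul_g_mul, dualCop_map_neg]
  ring

/-- In the co-opposite dual, the pairing of Δ(ξ) with y ⊗ z is ξ(zy). Pairing with x ⊗ g shows why ξ
must take equal values on x and gx. -/
lemma comul_ξ : comul (R := k) (ξ k) = ξ k ⊗ₜ 1 + χ k ⊗ₜ ξ k := by
  apply (DualCop.ev₂ k (H4 k)).injective
  refine TensorProduct.ext' fun y z => ?_
  rw [DualCop.ev₂_comul, map_add, LinearMap.add_apply, DualCop.ev₂_tmul, DualCop.ev₂_tmul]
  obtain ⟨c₀, c₁, c₂, c₃, rfl⟩ := exists_eq y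
  obtain ⟨d₀, d₁, d₂, d₃, rfl⟩ := exists_eq z
  simp [mul_add, add_mul, mul_assoc, g_mul_g, x_mul_x, x_mul_g, g_mul_g_mul,
    x_mul_g_mul, dualCop_map_neg]
  ring

/-- 1 and χ agree at 1 and differ by a sign at g; ξ and χξ agree at gx and differ by a sign at x.
The coefficients are therefore half sums and half differences, which is where 2 must be invertible.
-/
lemma dualCop_exists_eq (hk : ringChar k ≠ 2) (p : DualCop k (H4 k)) :
    ∃ c₀ c₁ c₂ c₃ : k, p = c₀ • 1 + c₁ • χ k + c₂ • ξ k + c₃ • (χ k * ξ k) := by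
  have h2 : (2 : k) ≠ 0 := Ring.two_ne_zero hk
  refine ⟨(p 1 + p (g k)) / 2, (p 1 - p (g k)) / 2, (p (g k * x k) + p (x k)) / 2,
    (p (g k * x k) - p (x k)) / 2, ?_⟩
  apply dualCop_ext <;>
    simp [dualCop_mul_one, dualCop_mul_g, dualCop_mul_x, dualCop_mul_g_mul_x] <;>
    field_simp <;> ring

open DrinfeldDouble (mk mk_mul_mk mk_one_mul_mk_one mk_one_mul_mk one_eq_mk)

lemma mk_g_mul_mk (p : DualCop k (H4 k)) : mk k (H4 k) 1 (g k) * mk k (H4 k) p 1 =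
    mk k (H4 k) (actL k (H4 k) (g k) (actR k (H4 k) (g k) p)) (g k) := by
  rw [mk_one_mul_mk]
  simp [DrinfeldDouble.comul₃, mk]
  rfl

/-- The three terms come from the iterated comultiplication x ⊗ 1 ⊗ 1 + g ⊗ x ⊗ 1 + g ⊗ g ⊗ x. -/
lemma mk_x_mul_mk (p : DualCop k (H4 k)) : mk k (H4 k) 1 (x k) * mk k (H4 k) p 1 =
    mk k (H4 k) (actR k (H4 k) (x k) p) 1 + mk k (H4 k) (actR k (H4 k) (g k) p) (x k) +
      mk k (H4 k) (actL k (H4 k) (x k) (actR k (H4 k) (g k) p)) (g k) := by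
  rw [mk_one_mul_mk]
  simp [DrinfeldDouble.comul₃, mk, Algebra.TensorProduct.one_def, TensorProduct.tmul_add,
    add_assoc]
  rfl

lemma mk_g_mul_χ : mk k (H4 k) 1 (g k) * mk k (H4 k) (χ k) 1 = mk k (H4 k) (χ k) (g k) := by
  rw [mk_g_mul_mk]
  congr 2
  apply dualCop_ext <;>
    simp [antipodeInv_g, mul_assoc, g_mul_g, x_mul_x, x_mul_g, g_mul_g_mul,
      x_mul_g_mul, dualCop_map_neg]

lemma mk_g_mul_ξ : mk k (H4 k) 1 (g k) * mk k (H4 k) (ξ k) 1 = -mk k (H4 k) (ξ k) (g k) := by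
  rw [mk_g_mul_mk, ← LinearMap.neg_apply, ← map_neg]
  congr 2
  rw [eq_neg_iff_add_eq_zero]
  apply dualCop_ext <;>
    simp [antipodeInv_g, mul_assoc, g_mul_g, x_mul_x, x_mul_g, g_mul_g_mul,
      x_mul_g_mul, dualCop_map_neg]

lemma actR_g_χ : actR k (H4 k) (g k) (χ k) = -χ k := by
  rw [eq_neg_iff_add_eq_zero]
  apply dualCop_ext <;> simp [mul_assoc, g_mul_g, x_mul_g, g_mul_g_mul, dualCop_map_neg]

lemma actR_g_ξ : actR k (H4 k) (g k) (ξ k) = -ξ k := by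
  rw [eq_neg_iff_add_eq_zero]
  apply dualCop_ext <;> simp [mul_assoc, g_mul_g, x_mul_g, g_mul_g_mul, dualCop_map_neg]

lemma mk_x_mul_χ : mk k (H4 k) 1 (x k) * mk k (H4 k) (χ k) 1 = -mk k (H4 k) (χ k) (x k) := by
  have h1 : actR k (H4 k) (x k) (χ k) = 0 := by
    apply dualCop_ext <;> simp [mul_assoc, x_mul_x]
  have h2 : actL k (H4 k) (x k) (χ k) = 0 := by
    apply dualCop_ext <;>
      simp [antipodeInv_x, mul_assoc, x_mul_x, x_mul_g, x_mul_g_mul, g_mul_g_mul, dualCop_map_neg]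
  rw [mk_x_mul_mk, actR_g_χ, h1, map_neg, map_neg, h2]
  simp

/-- The origin of the parameter 1: ξ(? x) is the counit and gives the term 1, while ξ(S⁻¹(x) ? g) =
-χ gives the term -χ ⊗ g. -/
lemma mk_x_mul_ξ : mk k (H4 k) 1 (x k) * mk k (H4 k) (ξ k) 1 =
    1 - mk k (H4 k) (ξ k) (x k) - mk k (H4 k) (χ k) (g k) := by
  have h1 : actR k (H4 k) (x k) (ξ k) = 1 := by
    apply dualCop_ext <;> simp [mul_assoc, x_mul_x]
  have h2 : actL k (H4 k) (x k) (ξ k) = χ k := by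
    apply dualCop_ext <;>
      simp [antipodeInv_x, mul_assoc, x_mul_x, x_mul_g, x_mul_g_mul, g_mul_g_mul, dualCop_map_neg]
  rw [mk_x_mul_mk, actR_g_ξ, h1, map_neg, map_neg, h2, one_eq_mk]
  simp [sub_eq_add_neg]

/-! ### The comparison map to the double -/

variable (k)

/-- The map to the Drinfel'd double of Sweedler's Hopf algebra given by `g ↦ ε ⊗ g`, `x ↦ ε ⊗ x`,
`G ↦ χ ⊗ 1`, `X ↦ ξ ⊗ 1`. -/
def toDoubleAlgHom : H16 k 1 →ₐ[k] DrinfeldDouble k (H4 k) :=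
  H16.lift (mk k (H4 k) 1 (g k)) (mk k (H4 k) 1 (x k)) (mk k (H4 k) (χ k) 1) (mk k (H4 k) (ξ k) 1)
    (by rw [mk_one_mul_mk_one, g_mul_g, one_eq_mk])
    (by rw [mk_mul_mk, χ_mul_χ, one_eq_mk])
    (by rw [mk_one_mul_mk_one, x_mul_x, map_zero])
    (by rw [mk_mul_mk, ξ_mul_ξ, map_zero, LinearMap.zero_apply])
    (by rw [mk_one_mul_mk_one, mk_one_mul_mk_one, x_mul_g, map_neg, neg_neg])
    (by rw [mk_mul_mk, mk_mul_mk, χ_mul_ξ, map_neg, LinearMap.neg_apply])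
    (by rw [mk_g_mul_χ, mk_mul_mk, mul_one])
    (by rw [mk_g_mul_ξ, mk_mul_mk, mul_one])
    (by rw [mk_x_mul_χ, mk_mul_mk, mul_one])
    (by
      rw [mk_x_mul_ξ, mk_mul_mk, mk_mul_mk, mul_one, mul_one, one_smul]
      abel)

/-- `H16 k 1 → D(H4)` as a map of bialgebras. -/
def toDouble : H16 k 1 →ₐc[k] DrinfeldDouble k (H4 k) :=
  .ofAlgHom (toDoubleAlgHom k)
    (H16.algHom_ext (by simp [toDoubleAlgHom, DrinfeldDouble.counit_mk])
      (by simp [toDoubleAlgHom, DrinfeldDouble.counit_mk])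
      (by simp [toDoubleAlgHom, DrinfeldDouble.counit_mk])
      (by simp [toDoubleAlgHom, DrinfeldDouble.counit_mk]))
    (H16.algHom_ext (by simp [toDoubleAlgHom, DrinfeldDouble.comul_one_mk])
      (by simp [toDoubleAlgHom, DrinfeldDouble.comul_one_mk, one_eq_mk])
      (by simp [toDoubleAlgHom, DrinfeldDouble.comul_mk_one, comul_χ])
      (by simp [toDoubleAlgHom, DrinfeldDouble.comul_mk_one, comul_ξ, one_eq_mk]))

variable {k}

/-- The range is a subalgebra and p ⊗ a = (p ⊗ 1)(1 ⊗ a). It therefore suffices that it contains the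
generators of H4 and those of its dual. -/
lemma toDouble_surjective (hk : ringChar k ≠ 2) : Function.Surjective (toDouble k) := by
  let f := toDoubleAlgHom k
  have hg : mk k (H4 k) 1 (g k) ∈ f.range := ⟨H16.g k 1, by simp [f, toDoubleAlgHom]⟩
  have hx : mk k (H4 k) 1 (x k) ∈ f.range := ⟨H16.x k 1, by simp [f, toDoubleAlgHom]⟩
  have hG : mk k (H4 k) (χ k) 1 ∈ f.range := ⟨H16.G k 1, by simp [f, toDoubleAlgHom]⟩
  have hX : mk k (H4 k) (ξ k) 1 ∈ f.range := ⟨H16.X k 1, by simp [f, toDoubleAlgHom]⟩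
  have h1 : mk k (H4 k) 1 1 ∈ f.range := one_mem f.range
  suffices h : ∀ F, F ∈ f.range from fun F => h F
  intro F
  induction F using DrinfeldDouble.mk_induction with
  | zero => exact zero_mem _
  | add F G hF hG => exact add_mem hF hG
  | mk p a =>
    rw [← mul_one p, ← mk_mul_mk]
    refine mul_mem ?_ ?_
    · obtain ⟨c₀, c₁, c₂, c₃, rfl⟩ := dualCop_exists_eq hk p
      simp only [map_add, map_smul, LinearMap.add_apply, LinearMap.smul_apply, ← mk_mul_mk]
      exact add_mem (add_mem (add_mem (f.range.smul_mem h1 _) (f.range.smul_mem hG _))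
        (f.range.smul_mem hX _)) (f.range.smul_mem (mul_mem hG hX) _)
    · obtain ⟨c₀, c₁, c₂, c₃, rfl⟩ := exists_eq a
      simp only [map_add, map_smul, ← mk_one_mul_mk_one]
      exact add_mem (add_mem (add_mem (f.range.smul_mem h1 _) (f.range.smul_mem hg _))
        (f.range.smul_mem hx _)) (f.range.smul_mem (mul_mem hg hx) _)

lemma finrank_drinfeldDouble : Module.finrank k (DrinfeldDouble k (H4 k)) = 16 := by
  change Module.finrank k (DualCop k (H4 k) ⊗[k] H4 k) = 16
  rw [Module.finrank_tensorProduct, (DualCop.toDual k (H4 k)).finrank_eq, Subspace.dual_finrank_eq,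
    finrank_eq]

/-- `H16 k 1` is the Drinfel'd double of Sweedler's Hopf algebra. -/
def doubleEquiv (hk : ringChar k ≠ 2) : H16 k 1 ≃ₐc[k] DrinfeldDouble k (H4 k) :=
  .ofBijective (toDouble k) <| by
    have h16 := H16.finrank_eq k 1
    have : FiniteDimensional k (H16 k 1) := .of_finrank_pos (by omega)
    have : FiniteDimensional k (DrinfeldDouble k (H4 k)) :=
      .of_finrank_pos (by rw [finrank_drinfeldDouble]; omega)
    refine ⟨?_, toDouble_surjective hk⟩
    exact (LinearMap.injective_iff_surjective_of_finrank_eq_finrank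
      (f := (toDouble k : H16 k 1 →ₗ[k] DrinfeldDouble k (H4 k)))
      (h16.trans finrank_drinfeldDouble.symm)).2 (toDouble_surjective hk)

end H4

end

/-! ### The main theorem -/

theorem mainTheorem1 (k : Type u) [Field k] (hk : ringChar k ≠ 2) :
    (∀ (E : Type v) [Ring E] [HopfAlgebra k E], Factorizes k (H4 k) (H4 k) E ↔
      (Nonempty (E ≃ₐc[k] H4 k ⊗[k] H4 k) ∨ ∃ l : k, Nonempty (E ≃ₐc[k] H16 k l))) ∧
    (∀ l : k, IsPointed k (H16 k l) ∧ IsUnimodular k (H16 k l) ∧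
      ¬ IsSemisimpleRing (H16 k l) ∧ Module.finrank k (H16 k l) = 16) ∧
    (∀ (E : Type v) [Ring E] [HopfAlgebra k E], Factorizes k (H4 k) (H4 k) E ↔
      (Nonempty (E ≃ₐc[k] H4 k ⊗[k] H4 k) ∨ Nonempty (E ≃ₐc[k] H16 k 0) ∨
        Nonempty (E ≃ₐc[k] H16 k 1))) ∧
    IsEmpty (H4 k ⊗[k] H4 k ≃ₐc[k] H16 k 0) ∧
    IsEmpty (H4 k ⊗[k] H4 k ≃ₐc[k] H16 k 1) ∧
    IsEmpty (H16 k 0 ≃ₐc[k] H16 k 1) ∧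
    Nonempty (H16 k 1 ≃ₐc[k] DrinfeldDouble k (H4 k)) :=
  ⟨fun E _ _ => H4.factorizes_iff_equiv hk,
    fun l => ⟨H16.isPointed k l, H16.isUnimodular k l, H16.not_isSemisimpleRing k l,
      H16.finrank_eq k l⟩,
    fun E _ _ => H4.factorizes_iff_equiv_or hk,
    H16.isEmpty_tensor_equiv k hk 0, H16.isEmpty_tensor_equiv k hk 1,
    H16.isEmpty_zero_equiv_one k hk, ⟨H4.doubleEquiv hk⟩⟩
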